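/- Let $d\ge 1$ and let $\varphi\in C^\infty(\mathbb R)$ be real-valued, not identically zero, and supported in $(\tfrac14,4)$. For $j\ge 1$, $t\in\mathbb R$ and $f\in L^2(\mathbb R^d)$ put \[ e^{-it\sqrt{-\Delta}}P_jf(x)=\frac1{(2\pi)^d}\int_{\mathbb R^d}\widehat f(\xi)\,\varphi(2^{-j}|\xi|)\,e^{i\langle x,\xi\rangle-it|\xi|}\,d\xi ,\] where $\widehat f$ is the $L^2$ Fourier transform extending $\widehat f(\xi)=\int f(y)e^{-i\langle y,\xi\rangle}dy$. Let $E\subset[1,2]$ be nonempty. A $2^{-j}$-discretization $E_j$ of $E$ is a maximal subset of $E$ any two distinct points of which are at distance at least $2^{-j}$. Let $N(A,\delta)$ be the minimal number of intervals of length $\delta$ needed to cover $A\subset\mathbb R$, and define \[ \nu_E^\sharp(\alpha)=\limsup_{\delta\to0+}\frac{\log\big(\sup_{\delta\le|I|\le1}|I|^{-\alpha}N(E\cap I,\delta)\big)}{\log(1/\delta)},\] the supremum being over intervals $I$ of length $|I|\in[\delta,1]$. For $2\le q<\infty$ set \[ s_E(q)=\tfrac{d+1}2\big(\tfrac12-\tfrac1q\big)+\tfrac1q\,\nu_E^\sharp\big(\tfrac{d-1}2(\tfrac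 q2-1)\big).\] (i) If $s>s_E(q)$, then there is a constant $C>0$ (depending only on $d,\varphi,E,q,s$) such that for all $2\le r\le q$, all $j\ge1$, all $2^{-j}$-discretizations $E_j$ of $E$ and all $f\in L^2(\mathbb R^d)$ (not only radial ones) \[ \Big\|\Big(\sum_{t\in E_j}|e^{-it\sqrt{-\Delta}}P_jf|^r\Big)^{1/r}\Big\|_{L^q(\mathbb R^d)}\le C\,2^{js}\,\|f\|_{L^2(\mathbb R^d)} .\qquad(*)\] (ii) If $s<s_E(q)$ and $2\le r\le q$, then the conclusion fails: for every choice of $2^{-j}$-discretizations $E_j$ of $E$, $j\ge1$, there is no constant $C$ such that $(*)$ holds for all $j\ge1$ and all $f\in L^2(\mathbb R^d)$. -/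

import Mathlib

open MeasureTheory
open scoped FourierTransform ENNReal Topology

noncomputable section

namespace FractalWave

/-- `N(A, δ)`: the minimal number of closed intervals of length `δ` needed to cover `A ⊂ ℝ`
(finite whenever `A` is bounded and `δ > 0`). -/
def coverNum (A : Set ℝ) (δ : ℝ) : ℕ :=
  sInf {n : ℕ | ∃ S : Finset ℝ, S.card = n ∧ A ⊆ ⋃ a ∈ S, Set.Icc a (a + δ)}

/-- `sup_{δ ≤ |I| ≤ 1} |I|^{-α} N(E ∩ I, δ)`, the supremum over all intervals `I = [a, b]`. -/
def assouadSup (E : Set ℝ) (α δ : ℝ) : ℝ :=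
  sSup {y : ℝ | ∃ a b : ℝ, δ ≤ b - a ∧ b - a ≤ 1 ∧
    y = (b - a) ^ (-α) * (coverNum (E ∩ Set.Icc a b) δ : ℝ)}

/-- The Legendre–Assouad function `ν_E^♯(α)`. For bounded nonempty `E` the quotient is
bounded as `δ → 0+`, so this is the genuine real `limsup`. -/
def legendreAssouad (E : Set ℝ) (α : ℝ) : ℝ :=
  Filter.limsup (fun δ : ℝ => Real.log (assouadSup E α δ) / Real.log (1 / δ)) (𝓝[>] (0 : ℝ))

/-- The critical exponent
`s_E(q) = (d+1)/2 (1/2 - 1/q) + (1/q) ν_E^♯((d-1)/2 (q/2 - 1))`. -/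
def critExp (d : ℕ) (E : Set ℝ) (q : ℝ) : ℝ :=
  ((d : ℝ) + 1) / 2 * (1 / 2 - 1 / q) +
    1 / q * legendreAssouad E (((d : ℝ) - 1) / 2 * (q / 2 - 1))

/-- `F` is a `δ`-discretization of `E`: a maximal `δ`-separated subset of `E`. For bounded `E`
and `δ > 0` every `δ`-separated subset is finite, so finsets give all of them. -/
def IsDiscretization (E : Set ℝ) (δ : ℝ) (F : Finset ℝ) : Prop :=
  Maximal (fun S : Set ℝ => S ⊆ E ∧ S.Pairwise fun t t' => δ ≤ |t - t'|) (F : Set ℝ)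

/-- The symbol of `e^{-it√(-Δ)} P_j`, where `P_j = φ(2^{-j}|D|)`. In the convention
`f̂(η) = ∫ f(y) e^{-i⟨y,η⟩} dy` it is `e^{-it|η|} φ(2^{-j}|η|)`; here `η = 2πξ`, because Mathlib's
Fourier transform has the kernel `e^{-2πi⟨y,ξ⟩}`. -/
def waveSymbol {d : ℕ} (φ : ℝ → ℝ) (j : ℕ) (t : ℝ) (ξ : EuclideanSpace ℝ (Fin d)) : ℂ :=
  Complex.exp (-Complex.I * (t : ℂ) * ((2 * Real.pi * ‖ξ‖ : ℝ) : ℂ)) *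
    ((φ ((2 : ℝ) ^ (-(j : ℝ)) * (2 * Real.pi * ‖ξ‖)) : ℝ) : ℂ)

/-- `e^{-it√(-Δ)} P_j f` for `f ∈ L²(ℝ^d)`: the inverse Fourier integral of the symbol times the
`L²` Fourier transform of `f`. When `φ` is continuous and supported in `(1/4, 4)` the symbol is
bounded with compact support, so the integrand is integrable and the integral converges
absolutely at every point. -/
def wave {d : ℕ} (φ : ℝ → ℝ) (j : ℕ) (t : ℝ)
    (f : Lp ℂ 2 (volume : Measure (EuclideanSpace ℝ (Fin d)))) :
    EuclideanSpace ℝ (Fin d) → ℂ :=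
  𝓕⁻ (fun ξ : EuclideanSpace ℝ (Fin d) => waveSymbol φ j t ξ *
    (𝓕 f : Lp ℂ 2 (volume : Measure (EuclideanSpace ℝ (Fin d)))) ξ)

/-- `‖(∑_{t ∈ F} |e^{-it√(-Δ)} P_j f|^r)^{1/r}‖_{L^q(ℝ^d)}`. -/
def waveNorm {d : ℕ} (φ : ℝ → ℝ) (q r : ℝ) (j : ℕ) (F : Finset ℝ)
    (f : Lp ℂ 2 (volume : Measure (EuclideanSpace ℝ (Fin d)))) : ℝ≥0∞ :=
  eLpNorm (fun x => (∑ t ∈ F, ‖wave φ j t f x‖ ^ r) ^ (1 / r)) (ENNReal.ofReal q) volume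

end FractalWave

end

/-! Write `n = d - 1`, `δ = 2^{-j}`, `p = q/2`, `α = (n/2)(p - 1)`, `S = assouadSup E α δ`, `D =
δ^{-(n/2+1)}`. By `mul_critExp`, `q · s_E(q) = (n/2 + 1)(p - 1) + ν(α)`, where `ν` is the
Legendre–Assouad function. Up to `ε`-losses the theorem therefore says that the best constant,
raised to the power `q`, has the size of `S · D^{p-1}`.

Upper bound. Since `r ≥ 2`, the `ℓ^r` norm is at most the `ℓ²` norm, so it suffices to integrate
`H^p`, where `H` is the sum of the squared waves. Let `A = {H > l²}`. Dualizing with functions `g_t`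
satisfying `∑ |g_t|² = 1_A` bounds `l |A|` by `‖f‖` times the norm of a sum over times
(`level_set_bound`), and that norm is squared out. Pairs of times within about `ℓ` are handled by
Plancherel and cost the number of times in an interval of length `ℓ`, which is at most a multiple of
`S ℓ^α`. The remaining pairs are handled pointwise in space by `exists_norm_sum_far_waveKernel_le`:
as a bilinear form on `ℓ²`, the wave kernels at separated times have norm at most a multiple of `D
ℓ^{-n/2}`. Hence `l² |A| ≲ ‖f‖² (S ℓ^α + D ℓ^{-n/2} |A|)`, and the best `ℓ` gives the weak type
bound with constant `S D^{p-1}` (`rpow_mul_le_of_optimize`, `exists_weak_type`). Bernstein leaves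
`O(1 + j)` dyadic levels, so passing to the strong type costs a factor `1 + j`, which the room in `s
> s_E(q)` absorbs.

The kernel estimate loses nothing in the number of times because the bilinear form is the Fourier
transform of one radial function, a product of two exponential sums in `|ξ|`. The decay of spherical
averages gives the factor `(|z|/δ)^{-n/2}` and the large sieve controls the exponential sums. For
`|z|` much smaller than the time separation, non-stationary phase takes over.

Lower bound. For an interval of length `L`, take a Knapp packet of angular width `√(δ/L)`. It stays
coherent for time `L`, so every discretization point in the interval contributes equally. Since `ℓ^r
≥ ℓ^q`, counting these points and taking the supremum over intervals bounds `S`, hence `ν(α)`. -/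

noncomputable section

namespace FractalWave

/-! ### Plancherel for the Fourier integral on `L¹ ∩ L²`. -/

section Plancherel

variable {V : Type*} [NormedAddCommGroup V] [InnerProductSpace ℝ V] [FiniteDimensional ℝ V]
  [MeasurableSpace V] [BorelSpace V]

-- Both Fourier transforms are compared by pairing with test functions. On the `L²` side the pairing
-- is the definition of the Fourier transform of a tempered distribution.
open scoped SchwartzMap in
theorem integral_smul_fourier_Lp (f : Lp ℂ 2 (volume : Measure V)) (Ψ : 𝓢(V, ℂ)) :
    ∫ x, Ψ x • (𝓕 f : Lp ℂ 2 (volume : Measure V)) x = ∫ x, (𝓕 Ψ) x • f x := by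
  rw [← Lp.toTemperedDistribution_apply, ← Lp.fourier_toTemperedDistribution_eq,
    TemperedDistribution.fourier_apply, Lp.toTemperedDistribution_apply]

theorem continuous_fourier_of_integrable {g : V → ℂ} (h1 : Integrable g) : Continuous (𝓕 g) :=
  VectorFourier.fourierIntegral_continuous Real.continuous_fourierChar
    (by exact continuous_inner) h1

open scoped SchwartzMap in
theorem integral_fourier_schwartz_smul {g : V → ℂ} (h1 : Integrable g) (Ψ : 𝓢(V, ℂ)) :
    ∫ x, (𝓕 Ψ) x • g x = ∫ x, Ψ x • (𝓕 g) x := by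
  rw [SchwartzMap.fourier_coe]
  simpa using! (VectorFourier.integral_fourierIntegral_smul_eq_flip (L := innerₗ V)
      Real.continuous_fourierChar continuous_inner Ψ.integrable h1)

open scoped SchwartzMap in
theorem integral_smul_fourier_toLp {g : V → ℂ} (h1 : Integrable g) (h2 : MemLp g 2)
    (Ψ : 𝓢(V, ℂ)) :
    ∫ x, Ψ x • (𝓕 (h2.toLp g) : Lp ℂ 2 (volume : Measure V)) x = ∫ x, Ψ x • (𝓕 g) x := by
  rw [integral_smul_fourier_Lp, ← integral_fourier_schwartz_smul h1]
  refine integral_congr_ae ?_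
  filter_upwards [h2.coeFn_toLp] with x hx
  rw [hx]

/-- On `L¹ ∩ L²` the `L²` Fourier transform is given by the Fourier integral. -/
theorem fourier_toLp_ae_eq {g : V → ℂ} (h1 : Integrable g) (h2 : MemLp g 2) :
    ((𝓕 (h2.toLp g) : Lp ℂ 2 (volume : Measure V)) : V → ℂ) =ᵐ[volume] 𝓕 g := by
  refine ae_eq_of_integral_contDiff_smul_eq
    ((Lp.memLp _).locallyIntegrable (by norm_num))
    (continuous_fourier_of_integrable h1).locallyIntegrable ?_
  intro ψ hψ hψc
  have hψ' : ContDiff ℝ (⊤ : ℕ∞) (Complex.ofRealCLM ∘ ψ) := Complex.ofRealCLM.contDiff.comp hψ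
  have hψc' : HasCompactSupport (Complex.ofRealCLM ∘ ψ) := hψc.comp_left (by simp)
  have := integral_smul_fourier_toLp h1 h2 (hψc'.toSchwartzMap hψ')
  simpa using this

theorem eLpNorm_fourier {g : V → ℂ} (h1 : Integrable g) (h2 : MemLp g 2) :
    eLpNorm (𝓕 g) 2 volume = eLpNorm g 2 volume := by
  rw [← eLpNorm_congr_ae (fourier_toLp_ae_eq h1 h2), ← eLpNorm_congr_ae h2.coeFn_toLp]
  have := Lp.norm_fourier_eq (h2.toLp g)
  rwa [Lp.norm_def, Lp.norm_def, ENNReal.toReal_eq_toReal_iff' (Lp.eLpNorm_ne_top _)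
    (Lp.eLpNorm_ne_top _)] at this

theorem memLp_fourier {g : V → ℂ} (h1 : Integrable g) (h2 : MemLp g 2) : MemLp (𝓕 g) 2 :=
  (memLp_congr_ae (fourier_toLp_ae_eq h1 h2)).1 (Lp.memLp _)

theorem integral_norm_sq_eq_toReal {g : V → ℂ} (h2 : MemLp g 2) :
    ∫ x, ‖g x‖ ^ 2 = (eLpNorm g 2 volume).toReal ^ 2 := by
  have h := h2.eLpNorm_eq_integral_rpow_norm (by norm_num) (by norm_num)
  rw [h, ENNReal.toReal_ofReal (by positivity), ← Real.rpow_natCast, ← Real.rpow_mul (by positivity)]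
  norm_num

theorem integral_norm_sq_fourier {g : V → ℂ} (h1 : Integrable g) (h2 : MemLp g 2) :
    ∫ ξ, ‖𝓕 g ξ‖ ^ 2 = ∫ x, ‖g x‖ ^ 2 := by
  rw [integral_norm_sq_eq_toReal h2, integral_norm_sq_eq_toReal (memLp_fourier h1 h2),
    eLpNorm_fourier h1 h2]

end Plancherel

/-! ### Separated points, Schur's test and the large sieve. -/

section Separated

/-- The points of `F` are pairwise at distance at least `δ`. -/
abbrev IsSep (δ : ℝ) (F : Set ℝ) : Prop := F.Pairwise fun t t' => δ ≤ |t - t'|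

theorem summable_inv_one_add_int_sq : Summable fun n : ℤ => (1 + (n : ℝ) ^ 2)⁻¹ := by
  have h := (Real.summable_one_div_int_pow (p := 2)).2 (by norm_num)
  refine Summable.of_norm_bounded_eventually h ?_
  have : ({0}ᶜ : Set ℤ) ∈ Filter.cofinite := (Set.finite_singleton _).compl_mem_cofinite
  filter_upwards [this] with n hn
  have hn0 : (n : ℝ) ≠ 0 := by exact_mod_cast hn
  rw [Real.norm_of_nonneg (by positivity), ← one_div]
  exact one_div_le_one_div_of_le (by positivity) (by linarith)

/-- With `m = ⌊x⌋` and `|x - m| < 1` one has `m² ≤ 2x² + 2`, hence the factor 3. -/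
theorem inv_one_add_sq_le_floor (x : ℝ) :
    (1 + x ^ 2)⁻¹ ≤ 3 * (1 + (⌊x⌋ : ℝ) ^ 2)⁻¹ := by
  have h1 := Int.floor_le x
  have h2 := Int.lt_floor_add_one x
  rw [← div_eq_mul_inv, inv_eq_one_div, div_le_div_iff₀ (by positivity) (by positivity)]
  rcases le_or_gt 0 ⌊x⌋ with h | h
  · have h' : (0 : ℝ) ≤ ⌊x⌋ := by exact_mod_cast h
    nlinarith
  · have h' : (⌊x⌋ : ℝ) + 1 ≤ 0 := by exact_mod_cast h
    nlinarith [sq_nonneg ((⌊x⌋ : ℝ) + 1), mul_nonneg (sub_nonneg.2 h2.le) (by linarith : 0 ≤ -((⌊x⌋ : ℝ) + 1)),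
      sq_nonneg (x + 1/2), sq_nonneg (x - (⌊x⌋ : ℝ) - 1), sq_nonneg ((⌊x⌋ : ℝ) + 2)]

/-- Uniform bound for sums of an integrable decaying weight over separated points. -/
theorem exists_sum_sep_le : ∃ C : ℝ, 0 < C ∧ ∀ δ : ℝ, 0 < δ → ∀ F : Finset ℝ, IsSep δ F →
    ∀ t : ℝ, ∑ t' ∈ F, (1 + ((t - t') / δ) ^ 2)⁻¹ ≤ C := by
  refine ⟨3 * ∑' n : ℤ, (1 + (n : ℝ) ^ 2)⁻¹, ?_, ?_⟩
  · have := summable_inv_one_add_int_sq.tsum_pos (fun n => by positivity) 0 (by norm_num)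
    positivity
  intro δ hδ F hF t
  -- Two points with the same floor would be closer than `δ`, so `b` is injective on `F` and the sum
  -- is dominated by a sum over distinct integers.
  set b : ℝ → ℤ := fun t' => ⌊(t - t') / δ⌋ with hb
  have hinj : Set.InjOn b F := by
    intro x hx y hy hxy
    by_contra hne
    have h1 := hF hx hy hne
    have h2 : |(t - x) / δ - (t - y) / δ| < 1 := Int.abs_sub_lt_one_of_floor_eq_floor hxy
    rw [← sub_div, abs_div, abs_of_pos hδ, div_lt_one hδ] at h2
    have : t - x - (t - y) = -(x - y) := by ring
    rw [this, abs_neg] at h2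
    linarith
  calc ∑ t' ∈ F, (1 + ((t - t') / δ) ^ 2)⁻¹ ≤ ∑ t' ∈ F, 3 * (1 + (b t' : ℝ) ^ 2)⁻¹ :=
        Finset.sum_le_sum fun t' _ => inv_one_add_sq_le_floor _
    _ = ∑ n ∈ F.image b, 3 * (1 + (n : ℝ) ^ 2)⁻¹ := by
        rw [Finset.sum_image hinj]
    _ = 3 * ∑ n ∈ F.image b, (1 + (n : ℝ) ^ 2)⁻¹ := by rw [Finset.mul_sum]
    _ ≤ _ := by
        gcongr
        exact summable_inv_one_add_int_sq.sum_le_tsum _ fun n _ => by positivity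

/-- Schur's test for finite matrices, in additive form. -/
theorem schur_sum_le {ι : Type*} (F : Finset ι) (w : ι → ι → ℝ) (a b : ι → ℝ) {C : ℝ}
    (hw : ∀ t t', 0 ≤ w t t') (h1 : ∀ t ∈ F, ∑ t' ∈ F, w t t' ≤ C)
    (h2 : ∀ t' ∈ F, ∑ t ∈ F, w t t' ≤ C) :
    ∑ t ∈ F, ∑ t' ∈ F, a t * b t' * w t t' ≤
      C / 2 * (∑ t ∈ F, a t ^ 2 + ∑ t ∈ F, b t ^ 2) := by
  calc ∑ t ∈ F, ∑ t' ∈ F, a t * b t' * w t t'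
      ≤ ∑ t ∈ F, ∑ t' ∈ F, (1 / 2 * a t ^ 2 * w t t' + 1 / 2 * b t' ^ 2 * w t t') := by
        refine Finset.sum_le_sum fun t _ => Finset.sum_le_sum fun t' _ => ?_
        nlinarith [mul_nonneg (sq_nonneg (a t - b t')) (hw t t')]
    _ = ∑ t ∈ F, 1 / 2 * a t ^ 2 * ∑ t' ∈ F, w t t' +
          ∑ t' ∈ F, 1 / 2 * b t' ^ 2 * ∑ t ∈ F, w t t' := by
        simp only [Finset.sum_add_distrib, Finset.mul_sum]
        congr 1
        exact Finset.sum_comm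
    _ ≤ ∑ t ∈ F, 1 / 2 * a t ^ 2 * C + ∑ t' ∈ F, 1 / 2 * b t' ^ 2 * C := by
        gcongr with t ht t ht
        · exact h1 t ht
        · exact h2 t ht
    _ = _ := by
        simp only [← Finset.sum_mul, ← Finset.mul_sum]
        ring

/-- The exponential sum `∑ c_t e^{2πi tρ}`. -/
def expSum (F : Finset ℝ) (c : ℝ → ℂ) (ρ : ℝ) : ℂ :=
  ∑ t ∈ F, c t * Complex.exp (2 * Real.pi * Complex.I * (t * ρ : ℝ))

theorem continuous_expSum (F : Finset ℝ) (c : ℝ → ℂ) : Continuous (expSum F c) := by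
  unfold expSum
  fun_prop

theorem expSum_mul_conj (F F' : Finset ℝ) (c c' : ℝ → ℂ) (ρ : ℝ) :
    expSum F c ρ * (starRingEnd ℂ) (expSum F' c' ρ) = ∑ t ∈ F, ∑ t' ∈ F',
      c t * (starRingEnd ℂ) (c' t') *
        Complex.exp (2 * Real.pi * Complex.I * ((t - t') * ρ : ℝ)) := by
  unfold expSum
  rw [map_sum, Finset.sum_mul_sum]
  refine Finset.sum_congr rfl fun t _ => Finset.sum_congr rfl fun t' _ => ?_
  rw [map_mul, ← Complex.exp_conj]
  simp only [map_mul, Complex.conj_I, Complex.conj_ofReal, map_ofNat]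
  rw [mul_mul_mul_comm, ← Complex.exp_add]
  congr 2
  push_cast
  ring

/-- The Fourier transform of this Gaussian is `δ⁻¹ exp(-π (s/δ)²)`. The quadratic decay kept here is
all that summation over `δ`-separated points needs. -/
theorem norm_integral_gaussian_exp_le {δ : ℝ} (hδ : 0 < δ) (s : ℝ) :
    ‖∫ ρ : ℝ, Complex.exp (2 * Real.pi * Complex.I * (s * ρ : ℝ)) *
      (Real.exp (-(Real.pi * δ ^ 2) * ρ ^ 2) : ℂ)‖ ≤ δ⁻¹ * (1 + (s / δ) ^ 2)⁻¹ := by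
  have hπ := Real.pi_pos
  have hb : 0 < ((Real.pi * δ ^ 2 : ℝ) : ℂ).re := by
    rw [Complex.ofReal_re]; positivity
  have h := fourierIntegral_gaussian hb ((2 * Real.pi * s : ℝ) : ℂ)
  have e : (fun ρ : ℝ => Complex.exp (2 * Real.pi * Complex.I * (s * ρ : ℝ)) *
      (Real.exp (-(Real.pi * δ ^ 2) * ρ ^ 2) : ℂ)) = fun ρ : ℝ =>
      Complex.exp (Complex.I * ((2 * Real.pi * s : ℝ) : ℂ) * ρ) *
        Complex.exp (-((Real.pi * δ ^ 2 : ℝ) : ℂ) * ρ ^ 2) := by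
    funext ρ
    rw [Complex.ofReal_exp]
    congr 2 <;> push_cast <;> ring
  rw [e, h, norm_mul, ← Complex.ofReal_div,
    Complex.norm_cpow_eq_rpow_re_of_pos (by positivity)]
  have e2 : -((2 * Real.pi * s : ℝ) : ℂ) ^ 2 / (4 * ((Real.pi * δ ^ 2 : ℝ) : ℂ)) =
      ((-(Real.pi * (s / δ) ^ 2) : ℝ) : ℂ) := by
    have hδ' : (δ : ℂ) ≠ 0 := by exact_mod_cast hδ.ne'
    have hp' : (Real.pi : ℂ) ≠ 0 := by exact_mod_cast hπ.ne'
    push_cast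
    field_simp
    ring
  rw [e2, ← Complex.ofReal_exp, Complex.norm_real, Real.norm_of_nonneg (Real.exp_pos _).le]
  have e3 : (Real.pi / (Real.pi * δ ^ 2)) ^ ((1 / 2 : ℂ)).re = δ⁻¹ := by
    have : Real.pi / (Real.pi * δ ^ 2) = (δ⁻¹) ^ (2 : ℝ) := by
      rw [Real.rpow_two]; field_simp
    rw [this, ← Real.rpow_mul (by positivity)]
    norm_num
  rw [e3, Real.exp_neg]
  gcongr
  have := Real.add_one_le_exp (Real.pi * (s / δ) ^ 2)
  nlinarith [Real.pi_gt_three, sq_nonneg (s / δ)]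

/-- The large sieve inequality for separated frequencies. -/
theorem exists_large_sieve : ∃ C : ℝ, 0 < C ∧ ∀ δ : ℝ, 0 < δ → ∀ F : Finset ℝ, IsSep δ F →
    ∀ c : ℝ → ℂ, ∫ ρ in Set.Icc 0 δ⁻¹, ‖expSum F c ρ‖ ^ 2 ≤ C * δ⁻¹ * ∑ t ∈ F, ‖c t‖ ^ 2 := by
  obtain ⟨C, hC, hsum⟩ := exists_sum_sep_le
  refine ⟨Real.exp Real.pi * C, by positivity, fun δ hδ F hF c => ?_⟩
  have hπ := Real.pi_pos
  -- A smooth weight replaces the sharp interval so that the cross terms decay. On `[0, δ⁻¹]` it is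
  -- at least `e^{-π}`, which is the origin of the factor `e^π`.
  set w : ℝ → ℝ := fun ρ => Real.exp (-(Real.pi * δ ^ 2) * ρ ^ 2) with hw
  have hcont := continuous_expSum F c
  have hterm : ∀ t t' : ℝ, Integrable fun ρ : ℝ =>
      c t * (starRingEnd ℂ) (c t') *
        (Complex.exp (2 * Real.pi * Complex.I * ((t - t') * ρ : ℝ)) * (w ρ : ℂ)) := by
    intro t t'
    refine Integrable.const_mul ?_ _
    have hwi : Integrable w := integrable_exp_neg_mul_sq (by positivity)
    refine hwi.ofReal.bdd_mul (c := 1) (by fun_prop) (Filter.Eventually.of_forall fun ρ => ?_)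
    rw [Complex.norm_exp]
    simp
  have hexp : ∀ ρ, ((‖expSum F c ρ‖ ^ 2 * w ρ : ℝ) : ℂ) = ∑ t ∈ F, ∑ t' ∈ F,
      c t * (starRingEnd ℂ) (c t') *
        (Complex.exp (2 * Real.pi * Complex.I * ((t - t') * ρ : ℝ)) * (w ρ : ℂ)) := by
    intro ρ
    have h := expSum_mul_conj F F c c ρ
    rw [Complex.mul_conj, Complex.normSq_eq_norm_sq] at h
    rw [Complex.ofReal_mul, h, Finset.sum_mul]
    refine Finset.sum_congr rfl fun t _ => ?_
    rw [Finset.sum_mul]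
    exact Finset.sum_congr rfl fun t' _ => by ring
  have hint : Integrable fun ρ => ‖expSum F c ρ‖ ^ 2 * w ρ := by
    have : Integrable fun ρ => ((‖expSum F c ρ‖ ^ 2 * w ρ : ℝ) : ℂ) := by
      simp_rw [hexp]
      exact integrable_finsetSum _ fun t _ => integrable_finsetSum _ fun t' _ => hterm t t'
    simpa only [RCLike.re_to_complex, Complex.ofReal_re] using this.re
  have hmain : ∫ ρ, ‖expSum F c ρ‖ ^ 2 * w ρ ≤ C * δ⁻¹ * ∑ t ∈ F, ‖c t‖ ^ 2 := by
    have h1 : ((∫ ρ, ‖expSum F c ρ‖ ^ 2 * w ρ : ℝ) : ℂ) = ∑ t ∈ F, ∑ t' ∈ F,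
        c t * (starRingEnd ℂ) (c t') * ∫ ρ : ℝ,
        (Complex.exp (2 * Real.pi * Complex.I * ((t - t') * ρ : ℝ)) * (w ρ : ℂ)) := by
      rw [← integral_complex_ofReal]
      simp_rw [hexp]
      rw [integral_finsetSum _ fun t _ => integrable_finsetSum _ fun t' _ => hterm t t']
      refine Finset.sum_congr rfl fun t _ => ?_
      rw [integral_finsetSum _ fun t' _ => hterm t t']
      exact Finset.sum_congr rfl fun t' _ => by rw [integral_const_mul]
    have h2 : ∫ ρ, ‖expSum F c ρ‖ ^ 2 * w ρ ≤ ∑ t ∈ F, ∑ t' ∈ F,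
        ‖c t‖ * ‖c t'‖ * (δ⁻¹ * (1 + ((t - t') / δ) ^ 2)⁻¹) := by
      refine (Real.le_norm_self _).trans ?_
      rw [← Complex.norm_real, h1]
      refine (norm_sum_le _ _).trans (Finset.sum_le_sum fun t _ => ?_)
      refine (norm_sum_le _ _).trans (Finset.sum_le_sum fun t' _ => ?_)
      rw [norm_mul, norm_mul, RCLike.norm_conj]
      gcongr
      exact norm_integral_gaussian_exp_le hδ (t - t')
    refine h2.trans ((schur_sum_le F _ _ _ (C := C * δ⁻¹) (fun t t' => by positivity)
      (fun t _ => ?_) (fun t' _ => ?_)).trans (le_of_eq (by ring)))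
    · rw [← Finset.mul_sum, mul_comm]
      gcongr
      exact hsum δ hδ F hF t
    · rw [← Finset.mul_sum, mul_comm]
      gcongr
      refine le_trans (le_of_eq ?_) (hsum δ hδ F hF t')
      refine Finset.sum_congr rfl fun t _ => ?_
      rw [← neg_sub, neg_div, neg_sq]
  calc ∫ ρ in Set.Icc 0 δ⁻¹, ‖expSum F c ρ‖ ^ 2
      ≤ ∫ ρ in Set.Icc 0 δ⁻¹, Real.exp Real.pi * (‖expSum F c ρ‖ ^ 2 * w ρ) := by
        refine setIntegral_mono_on (Continuous.integrableOn_Icc (by fun_prop))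
          (hint.const_mul _).integrableOn measurableSet_Icc fun ρ hρ => ?_
        have h1 : δ * ρ ≤ 1 := by
          have := mul_le_mul_of_nonneg_left hρ.2 hδ.le
          rwa [mul_inv_cancel₀ hδ.ne'] at this
        have h2 : (δ * ρ) ^ 2 ≤ 1 := by
          have : 0 ≤ δ * ρ := mul_nonneg hδ.le hρ.1
          nlinarith
        have h3 : 1 ≤ Real.exp Real.pi * w ρ := by
          rw [hw, ← Real.exp_add]
          apply Real.one_le_exp
          nlinarith
        nlinarith [sq_nonneg ‖expSum F c ρ‖]
    _ = Real.exp Real.pi * ∫ ρ in Set.Icc 0 δ⁻¹, ‖expSum F c ρ‖ ^ 2 * w ρ := by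
        rw [integral_const_mul]
    _ ≤ Real.exp Real.pi * ∫ ρ, ‖expSum F c ρ‖ ^ 2 * w ρ := by
        gcongr
        · exact Filter.Eventually.of_forall fun ρ => by positivity
        · exact Measure.restrict_le_self
    _ ≤ Real.exp Real.pi * (C * δ⁻¹ * ∑ t ∈ F, ‖c t‖ ^ 2) := by gcongr
    _ = _ := by ring

end Separated

/-! ### Decay of the Fourier transform of the sphere. -/

section Oscillatory

/-- The phase `e^{is cos θ}`. -/
def cosPhase (s θ : ℝ) : ℂ := Complex.exp (Complex.I * (s * Real.cos θ : ℝ))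

theorem norm_cosPhase (s θ : ℝ) : ‖cosPhase s θ‖ = 1 := by
  rw [cosPhase, mul_comm, Complex.norm_exp_ofReal_mul_I]

theorem continuous_cosPhase (s : ℝ) : Continuous (cosPhase s) := by
  unfold cosPhase; fun_prop

theorem hasDerivAt_cosPhase (s θ : ℝ) :
    HasDerivAt (cosPhase s) (cosPhase s θ * (Complex.I * (s * (-Real.sin θ) : ℝ))) θ := by
  have h : HasDerivAt (fun θ : ℝ => (s * Real.cos θ : ℝ)) (s * (-Real.sin θ)) θ :=
    (Real.hasDerivAt_cos θ).const_mul s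
  exact (h.ofReal_comp.const_mul Complex.I).cexp

/-- Integration by parts against `e^{is cos θ} sin θ`. -/
theorem integral_cosPhase_sin_mul {s : ℝ} (hs : s ≠ 0) {a b : ℝ} {p p' : ℝ → ℝ}
    (hp : ∀ θ ∈ Set.uIcc a b, HasDerivAt p (p' θ) θ) (hp' : ContinuousOn p' (Set.uIcc a b)) :
    ∫ θ in a..b, cosPhase s θ * (Real.sin θ * p θ : ℝ) =
      Complex.I / s * (cosPhase s b * p b - cosPhase s a * p a -
        ∫ θ in a..b, cosPhase s θ * p' θ) := by
  have hs' : (s : ℂ) ≠ 0 := by exact_mod_cast hs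
  have hc := continuous_cosPhase s
  have key := intervalIntegral.integral_mul_deriv_eq_deriv_mul (a := a) (b := b)
    (u := fun θ => (p θ : ℂ)) (u' := fun θ => (p' θ : ℂ)) (v := cosPhase s)
    (v' := fun θ => cosPhase s θ * (Complex.I * (s * (-Real.sin θ) : ℝ)))
    (fun θ hθ => (hp θ hθ).ofReal_comp) (fun θ _ => hasDerivAt_cosPhase s θ)
    (ContinuousOn.intervalIntegrable (Complex.continuous_ofReal.comp_continuousOn hp'))
    (Continuous.intervalIntegrable (by fun_prop) _ _)
  have e1 : ∫ θ in a..b, cosPhase s θ * (Real.sin θ * p θ : ℝ) =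
      Complex.I / s * ∫ θ in a..b, (p θ : ℂ) * (cosPhase s θ * (Complex.I * (s * (-Real.sin θ) : ℝ))) := by
    rw [← intervalIntegral.integral_const_mul]
    congr 1
    funext θ
    push_cast
    field_simp
    rw [Complex.I_sq]
    ring
  rw [e1, key]
  congr 1
  have e2 : ∫ θ in a..b, (p' θ : ℂ) * cosPhase s θ = ∫ θ in a..b, cosPhase s θ * p' θ := by
    congr 1; funext θ; ring
  rw [e2]
  ring

theorem norm_integral_cosPhase_mul_le (s : ℝ) {a b M : ℝ} (hab : a ≤ b) {p : ℝ → ℝ}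
    (hp : ∀ θ ∈ Set.Icc a b, |p θ| ≤ M) :
    ‖∫ θ in a..b, cosPhase s θ * p θ‖ ≤ M * (b - a) := by
  have := intervalIntegral.norm_integral_le_of_norm_le_const (a := a) (b := b) (C := M)
    (f := fun θ => cosPhase s θ * p θ) (fun θ hθ => by
      rw [Set.uIoc_of_le hab] at hθ
      rw [norm_mul, norm_cosPhase, one_mul, Complex.norm_real]
      exact hp θ ⟨hθ.1.le, hθ.2⟩)
  rwa [abs_of_nonneg (by linarith)] at this

theorem norm_I_div {s : ℝ} (hs : 0 < s) : ‖Complex.I / (s : ℂ)‖ = s⁻¹ := by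
  rw [norm_div, Complex.norm_I, Complex.norm_real, Real.norm_of_nonneg hs.le, one_div]

/-- A van der Corput bound for the phase `cos θ`. -/
theorem norm_integral_cosPhase_le {p p' : ℝ → ℝ} (hp : ∀ θ, HasDerivAt p (p' θ) θ)
    (hp' : Continuous p') (h1 : ∀ θ, |p θ| ≤ 1)
    (h2 : ∀ θ, |p' θ * Real.sin θ - p θ * Real.cos θ| ≤ 1) {s : ℝ} (hs : 1 ≤ s) :
    ‖∫ θ in (0 : ℝ)..Real.pi, cosPhase s θ * p θ‖ ≤ 10 * s ^ (-(1 / 2) : ℝ) := by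
  have hs0 : 0 < s := by linarith
  have hπ3 := Real.pi_gt_three
  have hπ4 : Real.pi < 3.15 := Real.pi_lt_d2
  -- The phase is stationary only at `0` and `π`. This `δ` balances the trivial bound `δ` on each
  -- end piece against the bound `s⁻¹ / sin δ`, up to a constant, from integration by parts in the
  -- middle.
  set δ : ℝ := s ^ (-(1 / 2) : ℝ) with hδ
  have hδ0 : 0 < δ := Real.rpow_pos_of_pos hs0 _
  have hδ1 : δ ≤ 1 := Real.rpow_le_one_of_one_le_of_nonpos hs (by norm_num)
  have hδs : s * δ * δ = 1 := by
    rw [hδ, mul_assoc, ← Real.rpow_add hs0]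
    norm_num
    rw [Real.rpow_neg_one, mul_inv_cancel₀ hs0.ne']
  have hpc : Continuous p := continuous_iff_continuousAt.2 fun θ => (hp θ).continuousAt
  have hc := continuous_cosPhase s
  have hint : ∀ a b : ℝ, IntervalIntegrable (fun θ => cosPhase s θ * p θ) volume a b :=
    fun a b => Continuous.intervalIntegrable (by fun_prop) _ _
  have hsinδ : δ / 2 ≤ Real.sin δ := by
    have := Real.mul_le_sin hδ0.le (by linarith)
    have h2 : δ / 2 ≤ 2 / Real.pi * δ := by
      rw [div_mul_eq_mul_div, div_le_div_iff₀ (by norm_num) (by linarith)]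
      nlinarith
    linarith
  have hsin0 : 0 < Real.sin δ := by linarith
  have hsinpos : ∀ θ ∈ Set.uIcc δ (Real.pi - δ), 0 < Real.sin θ := by
    intro θ hθ
    rw [Set.uIcc_of_le (by linarith)] at hθ
    exact Real.sin_pos_of_pos_of_lt_pi (by linarith [hθ.1]) (by linarith [hθ.2])
  have hsplit : ∫ θ in (0 : ℝ)..Real.pi, cosPhase s θ * p θ =
      (∫ θ in (0 : ℝ)..δ, cosPhase s θ * p θ) +
      (∫ θ in δ..(Real.pi - δ), cosPhase s θ * p θ) +
      ∫ θ in (Real.pi - δ)..Real.pi, cosPhase s θ * p θ := by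
    rw [intervalIntegral.integral_add_adjacent_intervals (hint _ _) (hint _ _),
      intervalIntegral.integral_add_adjacent_intervals (hint _ _) (hint _ _)]
  have hA := norm_integral_cosPhase_mul_le s hδ0.le fun θ (_ : θ ∈ Set.Icc 0 δ) => h1 θ
  have hB := norm_integral_cosPhase_mul_le s (by linarith)
    fun θ (_ : θ ∈ Set.Icc (Real.pi - δ) Real.pi) => h1 θ
  set r' : ℝ → ℝ := fun θ => (p' θ * Real.sin θ - p θ * Real.cos θ) / Real.sin θ ^ 2 with hr'
  have hr'c : ContinuousOn r' (Set.uIcc δ (Real.pi - δ)) :=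
    ContinuousOn.div (by fun_prop) (by fun_prop) fun θ hθ => (pow_pos (hsinpos θ hθ) 2).ne'
  have hM : ∫ θ in δ..(Real.pi - δ), cosPhase s θ * p θ =
      Complex.I / s * (cosPhase s (Real.pi - δ) * ((p (Real.pi - δ) / Real.sin (Real.pi - δ) : ℝ) : ℂ)
        - cosPhase s δ * ((p δ / Real.sin δ : ℝ) : ℂ)
        - ∫ θ in δ..(Real.pi - δ), cosPhase s θ * r' θ) := by
    rw [← integral_cosPhase_sin_mul hs0.ne' (p := fun θ => p θ / Real.sin θ) (p' := r')
      (fun θ hθ => (hp θ).div (Real.hasDerivAt_sin θ) (hsinpos θ hθ).ne') hr'c]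
    refine intervalIntegral.integral_congr fun θ hθ => ?_
    have := (hsinpos θ hθ).ne'
    rw [mul_div_cancel₀ _ this]
  have hR : ‖∫ θ in δ..(Real.pi - δ), cosPhase s θ * r' θ‖ ≤ 2 / Real.sin δ := by
    -- The numerator of `r'` is at most 1, so its integral is dominated by that of `1 / sin²`, with
    -- primitive `-cot`.
    have hcot : ∀ θ ∈ Set.uIcc δ (Real.pi - δ),
        HasDerivAt (fun θ => -(Real.cos θ / Real.sin θ)) (1 / Real.sin θ ^ 2) θ := by
      intro θ hθ
      have h := ((Real.hasDerivAt_cos θ).div (Real.hasDerivAt_sin θ) (hsinpos θ hθ).ne').neg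
      convert! h using 1
      rw [← neg_div]
      congr 1
      nlinarith [Real.sin_sq_add_cos_sq θ]
    have hic : IntervalIntegrable (fun θ => 1 / Real.sin θ ^ 2) volume δ (Real.pi - δ) :=
      ContinuousOn.intervalIntegrable (ContinuousOn.div (by fun_prop) (by fun_prop)
        fun θ hθ => (pow_pos (hsinpos θ hθ) 2).ne')
    refine (intervalIntegral.norm_integral_le_of_norm_le (by linarith)
      (Filter.Eventually.of_forall fun θ hθ => ?_) hic).trans ?_
    · have hs2 := hsinpos θ (by
        rw [Set.uIcc_of_le (by linarith)]; exact ⟨hθ.1.le, hθ.2⟩)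
      rw [norm_mul, norm_cosPhase, one_mul, Complex.norm_real, hr', Real.norm_eq_abs, abs_div,
        abs_of_pos (pow_pos hs2 2)]
      gcongr
      exact h2 θ
    · rw [intervalIntegral.integral_eq_sub_of_hasDerivAt hcot hic, Real.cos_pi_sub,
        Real.sin_pi_sub]
      have : -(-Real.cos δ / Real.sin δ) - -(Real.cos δ / Real.sin δ) =
        2 * Real.cos δ / Real.sin δ := by ring
      rw [this]
      gcongr
      linarith [Real.cos_le_one δ]
  have hMn : ‖∫ θ in δ..(Real.pi - δ), cosPhase s θ * p θ‖ ≤ s⁻¹ * (4 / Real.sin δ) := by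
    rw [hM, norm_mul, norm_I_div hs0]
    gcongr
    have q1 : ‖cosPhase s (Real.pi - δ) * ((p (Real.pi - δ) / Real.sin (Real.pi - δ) : ℝ) : ℂ)‖ ≤
        1 / Real.sin δ := by
      rw [norm_mul, norm_cosPhase, one_mul, Complex.norm_real, Real.sin_pi_sub, Real.norm_eq_abs,
        abs_div, abs_of_pos hsin0]
      gcongr
      exact h1 _
    have q2 : ‖cosPhase s δ * ((p δ / Real.sin δ : ℝ) : ℂ)‖ ≤ 1 / Real.sin δ := by
      rw [norm_mul, norm_cosPhase, one_mul, Complex.norm_real, Real.norm_eq_abs,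
        abs_div, abs_of_pos hsin0]
      gcongr
      exact h1 _
    refine (norm_sub_le _ _).trans ((add_le_add (norm_sub_le _ _) le_rfl).trans ?_)
    have : 4 / Real.sin δ = 1 / Real.sin δ + 1 / Real.sin δ + 2 / Real.sin δ := by ring
    linarith
  have hfin : s⁻¹ * (4 / Real.sin δ) ≤ 8 * δ := by
    have h5 : 4 / Real.sin δ ≤ 4 / (δ / 2) := by gcongr
    have h6 : s⁻¹ * (4 / (δ / 2)) = 8 * δ := by
      field_simp
      linarith
    have h7 : s⁻¹ * (4 / Real.sin δ) ≤ s⁻¹ * (4 / (δ / 2)) := by gcongr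
    linarith
  rw [hsplit]
  refine (norm_add_le _ _).trans ((add_le_add (norm_add_le _ _) le_rfl).trans ?_)
  linarith

/-- The integral `∫₀^π e^{is cos θ} sin^m θ dθ` (a normalized Bessel function). -/
def sphereOsc (m : ℕ) (s : ℝ) : ℂ :=
  ∫ θ in (0 : ℝ)..Real.pi, cosPhase s θ * (Real.sin θ ^ m : ℝ)

theorem norm_sphereOsc_le_pi (m : ℕ) (s : ℝ) : ‖sphereOsc m s‖ ≤ Real.pi := by
  have := norm_integral_cosPhase_mul_le s Real.pi_pos.le (M := 1) (p := fun θ => Real.sin θ ^ m)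
    fun θ _ => by
      rw [abs_pow]; exact pow_le_one₀ (abs_nonneg _) (Real.abs_sin_le_one θ)
  simpa [sphereOsc] using this

/-- One factor `sin θ` is spent on the derivative of the phase. The boundary terms vanish because a
positive power of the sine remains. -/
theorem sphereOsc_add_two {s : ℝ} (hs : s ≠ 0) (m : ℕ) :
    sphereOsc (m + 2) s = -(Complex.I / s) * (m + 1 : ℝ) *
      ∫ θ in (0 : ℝ)..Real.pi, cosPhase s θ * (Real.sin θ ^ m * Real.cos θ : ℝ) := by
  have h := integral_cosPhase_sin_mul hs (a := 0) (b := Real.pi)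
    (p := fun θ => Real.sin θ ^ (m + 1))
    (p' := fun θ => (m + 1 : ℕ) * Real.sin θ ^ m * Real.cos θ)
    (fun θ _ => (Real.hasDerivAt_sin θ).pow (m + 1)) (by fun_prop)
  simp only [← pow_succ'] at h
  rw [sphereOsc, h]
  have e : ∫ θ in (0 : ℝ)..Real.pi, cosPhase s θ *
      (((m + 1 : ℕ) * Real.sin θ ^ m * Real.cos θ : ℝ) : ℂ) = (m + 1 : ℝ) *
      ∫ θ in (0 : ℝ)..Real.pi, cosPhase s θ * (Real.sin θ ^ m * Real.cos θ : ℝ) := by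
    rw [← intervalIntegral.integral_const_mul]
    congr 1; funext θ; push_cast; ring
  rw [e]
  simp
  ring

/-- A second integration by parts removes the cosine left by the first, through `cos² = 1 - sin²`.
Raising `m` by four gains exactly `s⁻²`, as the decay rate `(m+1)/2` demands. -/
theorem sphereOsc_add_four {s : ℝ} (hs : s ≠ 0) (m : ℕ) :
    sphereOsc (m + 4) s = (Complex.I / s) ^ 2 * (m + 3 : ℝ) *
      ((m + 1 : ℝ) * sphereOsc m s - (m + 2 : ℝ) * sphereOsc (m + 2) s) := by
  have h := integral_cosPhase_sin_mul hs (a := 0) (b := Real.pi)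
    (p := fun θ => Real.sin θ ^ (m + 1) * Real.cos θ)
    (p' := fun θ => (m + 1 : ℝ) * Real.sin θ ^ m - (m + 2 : ℝ) * Real.sin θ ^ (m + 2))
    (fun θ _ => by
      have h1 := ((Real.hasDerivAt_sin θ).pow (m + 1)).mul (Real.hasDerivAt_cos θ)
      convert! h1 using 1
      have : Real.cos θ * Real.cos θ = 1 - Real.sin θ ^ 2 := by
        nlinarith [Real.sin_sq_add_cos_sq θ]
      simp only [Nat.add_sub_cancel, Pi.pow_apply]
      rw [mul_assoc, this]
      push_cast
      ring) (by fun_prop)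
  have e1 : ∫ θ in (0 : ℝ)..Real.pi, cosPhase s θ * (Real.sin θ ^ (m + 2) * Real.cos θ : ℝ) =
      ∫ θ in (0 : ℝ)..Real.pi, cosPhase s θ *
        (Real.sin θ * (Real.sin θ ^ (m + 1) * Real.cos θ) : ℝ) := by
    congr 1; funext θ; congr 2; ring
  have hc := continuous_cosPhase s
  have e2 : ∫ θ in (0 : ℝ)..Real.pi, cosPhase s θ *
      (((m + 1 : ℝ) * Real.sin θ ^ m - (m + 2 : ℝ) * Real.sin θ ^ (m + 2) : ℝ) : ℂ) =
      (m + 1 : ℝ) * sphereOsc m s - (m + 2 : ℝ) * sphereOsc (m + 2) s := by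
    rw [sphereOsc, sphereOsc, ← intervalIntegral.integral_const_mul,
      ← intervalIntegral.integral_const_mul, ← intervalIntegral.integral_sub]
    · congr 1; funext θ; push_cast; ring
    · exact Continuous.intervalIntegrable (by fun_prop) _ _
    · exact Continuous.intervalIntegrable (by fun_prop) _ _
  rw [show m + 4 = (m + 2) + 2 from rfl, sphereOsc_add_two hs, e1, h, e2]
  simp
  ring

/-- For `m = 1` the integrand is an exact derivative and only the two boundary values remain. -/
theorem norm_sphereOsc_one_le {s : ℝ} (hs : 0 < s) : ‖sphereOsc 1 s‖ ≤ 2 * s⁻¹ := by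
  have h := integral_cosPhase_sin_mul hs.ne' (a := 0) (b := Real.pi)
    (p := fun _ => 1) (p' := fun _ => 0) (fun θ _ => hasDerivAt_const _ _) (by fun_prop)
  have e : sphereOsc 1 s = Complex.I / s * (cosPhase s Real.pi - cosPhase s 0) := by
    simpa [sphereOsc] using h
  rw [e, norm_mul, norm_I_div hs, mul_comm]
  gcongr
  refine (norm_sub_le _ _).trans ?_
  rw [norm_cosPhase, norm_cosPhase]
  norm_num

theorem norm_sphereOsc_three_le {s : ℝ} (hs : 0 < s) : ‖sphereOsc 3 s‖ ≤ 12 * s⁻¹ ^ 2 := by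
  have h := integral_cosPhase_sin_mul hs.ne' (a := 0) (b := Real.pi)
    (p := Real.cos) (p' := fun θ => -Real.sin θ) (fun θ _ => Real.hasDerivAt_cos θ) (by fun_prop)
  have e := sphereOsc_add_two hs.ne' 1
  simp only [pow_one] at e
  rw [show 1 + 2 = 3 from rfl] at e
  rw [e, h, norm_mul, norm_mul, norm_neg, norm_mul, norm_I_div hs]
  have h1 : ‖cosPhase s Real.pi * (Real.cos Real.pi : ℝ) - cosPhase s 0 * (Real.cos 0 : ℝ) -
      ∫ θ in (0 : ℝ)..Real.pi, cosPhase s θ * (-Real.sin θ : ℝ)‖ ≤ 1 + 1 + 4 := by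
    refine (norm_sub_le _ _).trans (add_le_add ((norm_sub_le _ _).trans (add_le_add ?_ ?_)) ?_)
    · simp [norm_cosPhase]
    · simp [norm_cosPhase]
    · refine (norm_integral_cosPhase_mul_le s Real.pi_pos.le (M := 1) fun θ _ => ?_).trans ?_
      · rw [abs_neg]; exact Real.abs_sin_le_one θ
      · linarith [Real.pi_le_four]
  have h2 : ‖(((1 : ℕ) + 1 : ℝ) : ℂ)‖ = 2 := by norm_num
  rw [h2]
  calc _ ≤ s⁻¹ * 2 * (s⁻¹ * (1 + 1 + 4)) := by gcongr
    _ = _ := by ring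

/-- Decay of the Fourier transform of the spherical measure, for large frequency. -/
theorem exists_norm_sphereOsc_le_of_one_le (m : ℕ) : ∃ C : ℝ, 0 < C ∧ ∀ s : ℝ, 1 ≤ s →
    ‖sphereOsc m s‖ ≤ C * s ^ (-((m : ℝ) + 1) / 2) := by
  -- The recursion advances by four, so `m = 0, 1, 2, 3` are base cases. The even ones need van der
  -- Corput, the odd ones only integration by parts.
  induction m using Nat.strong_induction_on with
  | _ m ih =>
    match m, ih with
    | 0, _ =>
      refine ⟨10, by norm_num, fun s hs => ?_⟩
      have := norm_integral_cosPhase_le (p := fun _ => 1) (p' := fun _ => 0)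
        (fun θ => hasDerivAt_const _ _) (by fun_prop) (by simp)
        (fun θ => by simpa using Real.abs_cos_le_one θ) hs
      convert this using 2
      · simp [sphereOsc]
      · norm_num
    | 1, _ =>
      refine ⟨2, by norm_num, fun s hs => ?_⟩
      convert norm_sphereOsc_one_le (by linarith : 0 < s) using 2
      rw [← Real.rpow_neg_one]; norm_num
    | 2, _ =>
      refine ⟨10, by norm_num, fun s hs => ?_⟩
      have hs0 : 0 < s := by linarith
      have := norm_integral_cosPhase_le (p := Real.cos) (p' := fun θ => -Real.sin θ)
        (fun θ => Real.hasDerivAt_cos θ) (by fun_prop) Real.abs_cos_le_one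
        (fun θ => by
          rw [abs_le]
          constructor <;> nlinarith [Real.sin_sq_add_cos_sq θ]) hs
      have e := sphereOsc_add_two hs0.ne' 0
      simp only [pow_zero, one_mul, zero_add, Nat.cast_zero, Complex.ofReal_one, mul_one] at e
      rw [e, norm_mul, norm_neg, norm_I_div hs0]
      calc _ ≤ s⁻¹ * (10 * s ^ (-(1 / 2) : ℝ)) := by gcongr
        _ = 10 * (s ^ (-1 : ℝ) * s ^ (-(1 / 2) : ℝ)) := by rw [Real.rpow_neg_one]; ring
        _ = _ := by rw [← Real.rpow_add hs0]; norm_num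
    | 3, _ =>
      refine ⟨12, by norm_num, fun s hs => ?_⟩
      convert norm_sphereOsc_three_le (by linarith : 0 < s) using 2
      rw [← Real.rpow_neg_one, ← Real.rpow_natCast, ← Real.rpow_mul (by linarith)]; norm_num
    | k + 4, ih =>
      obtain ⟨C1, hC1, h1⟩ := ih k (by omega)
      obtain ⟨C2, hC2, h2⟩ := ih (k + 2) (by omega)
      refine ⟨(k + 3) * ((k + 1) * C1 + (k + 2) * C2), by positivity, fun s hs => ?_⟩
      have hs0 : 0 < s := by linarith
      have h1' := h1 s hs
      have h2' : ‖sphereOsc (k + 2) s‖ ≤ C2 * s ^ (-((k : ℝ) + 1) / 2) := by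
        refine (h2 s hs).trans ?_
        refine mul_le_mul_of_nonneg_left (Real.rpow_le_rpow_of_exponent_le hs ?_) hC2.le
        push_cast; linarith
      rw [sphereOsc_add_four hs0.ne', norm_mul, norm_mul, norm_pow, norm_I_div hs0,
        Complex.norm_real, Real.norm_of_nonneg (by positivity : (0 : ℝ) ≤ (k : ℝ) + 3)]
      have h3 : ‖((k + 1 : ℝ) : ℂ) * sphereOsc k s - ((k + 2 : ℝ) : ℂ) * sphereOsc (k + 2) s‖ ≤
          ((k + 1) * C1 + (k + 2) * C2) * s ^ (-((k : ℝ) + 1) / 2) := by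
        refine (norm_sub_le _ _).trans ?_
        rw [norm_mul, norm_mul, Complex.norm_real, Complex.norm_real,
          Real.norm_of_nonneg (by positivity : (0 : ℝ) ≤ (k : ℝ) + 1),
          Real.norm_of_nonneg (by positivity : (0 : ℝ) ≤ (k : ℝ) + 2),
          add_mul _ _ (s ^ (-((k : ℝ) + 1) / 2)), mul_assoc, mul_assoc]
        gcongr
      calc _ ≤ s⁻¹ ^ 2 * (k + 3) *
            (((k + 1) * C1 + (k + 2) * C2) * s ^ (-((k : ℝ) + 1) / 2)) := by gcongr
        _ = (k + 3) * ((k + 1) * C1 + (k + 2) * C2) *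
            (s ^ (-2 : ℝ) * s ^ (-((k : ℝ) + 1) / 2)) := by
              rw [Real.rpow_neg hs0.le, Real.rpow_two, inv_pow]; ring
        _ = _ := by
              rw [← Real.rpow_add hs0]
              congr 2
              push_cast
              ring

/-- For `s < 1` the power on the right is at least 1, so the trivial bound `π` suffices. -/
theorem exists_norm_sphereOsc_le (m : ℕ) : ∃ C : ℝ, 0 < C ∧ ∀ s : ℝ, 0 < s →
    ‖sphereOsc m s‖ ≤ C * s ^ (-((m : ℝ) + 1) / 2) := by
  obtain ⟨C, hC, h⟩ := exists_norm_sphereOsc_le_of_one_le m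
  refine ⟨C + Real.pi, by positivity, fun s hs => ?_⟩
  have h0 : 0 ≤ s ^ (-((m : ℝ) + 1) / 2) := by positivity
  rcases le_or_gt 1 s with h1 | h1
  · refine (h s h1).trans ?_
    gcongr
    linarith [Real.pi_pos]
  · have : 1 ≤ s ^ (-((m : ℝ) + 1) / 2) :=
      Real.one_le_rpow_of_pos_of_le_one_of_nonpos hs h1.le (by
        have : (0 : ℝ) ≤ m := m.cast_nonneg
        linarith)
    nlinarith [norm_sphereOsc_le_pi m s, Real.pi_pos]

end Oscillatory

/-! ### Fourier transforms of radial functions. -/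

section Radial

/-- Polar coordinates in the half plane `{(v, s) | 0 < s}`. -/
theorem integral_halfPlane_polar (g : ℝ × ℝ → ℂ) :
    ∫ p in (Set.univ : Set ℝ) ×ˢ Set.Ioi (0 : ℝ), g p =
      ∫ p in Set.Ioi (0 : ℝ) ×ˢ Set.Ioo 0 Real.pi,
        p.1 • g (p.1 * Real.cos p.2, p.1 * Real.sin p.2) := by
  have hm : MeasurableSet ((Set.univ : Set ℝ) ×ˢ Set.Ioi (0 : ℝ)) :=
    MeasurableSet.univ.prod measurableSet_Ioi
  have hm2 : MeasurableSet (Set.Ioi (0 : ℝ) ×ˢ Set.Ioo 0 Real.pi) :=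
    measurableSet_Ioi.prod measurableSet_Ioo
  have hm3 : MeasurableSet (Set.Ioi (0 : ℝ) ×ˢ Set.Ioo (-Real.pi) Real.pi) :=
    measurableSet_Ioi.prod measurableSet_Ioo
  rw [← integral_indicator hm, ← integral_comp_polarCoord_symm]
  change ∫ p in Set.Ioi (0 : ℝ) ×ˢ Set.Ioo (-Real.pi) Real.pi, _ = _
  symm
  have hsub : Set.Ioi (0 : ℝ) ×ˢ Set.Ioo 0 Real.pi ⊆
      Set.Ioi (0 : ℝ) ×ˢ Set.Ioo (-Real.pi) Real.pi :=
    Set.prod_mono le_rfl (Set.Ioo_subset_Ioo_left (by linarith [Real.pi_pos]))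
  rw [← integral_indicator hm2, ← integral_indicator hm3]
  congr 1
  funext p
  by_cases hp : p ∈ Set.Ioi (0 : ℝ) ×ˢ Set.Ioo (-Real.pi) Real.pi
  · rw [Set.indicator_of_mem hp]
    have h1 : 0 < p.1 := hp.1
    have e : polarCoord.symm p = (p.1 * Real.cos p.2, p.1 * Real.sin p.2) := rfl
    rw [e]
    by_cases h2 : p ∈ Set.Ioi (0 : ℝ) ×ˢ Set.Ioo 0 Real.pi
    · rw [Set.indicator_of_mem h2, Set.indicator_of_mem]
      exact ⟨trivial, mul_pos h1 (Real.sin_pos_of_mem_Ioo h2.2)⟩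
    · rw [Set.indicator_of_notMem h2, Set.indicator_of_notMem, smul_zero]
      rintro ⟨-, h3⟩
      have h3 : 0 < p.1 * Real.sin p.2 := h3
      have h4 : 0 < Real.sin p.2 := (pos_iff_pos_of_mul_pos h3).1 h1
      refine h2 ⟨h1, ?_, hp.2.2⟩
      by_contra h5
      have := Real.sin_nonpos_of_nonpos_of_neg_pi_le (not_lt.1 h5) hp.2.1.le
      linarith
  · rw [Set.indicator_of_notMem hp, Set.indicator_of_notMem fun h => hp (hsub h)]

theorem exists_forall_zero_of_hasCompactSupport {H : ℝ → ℂ} (hc : HasCompactSupport H) :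
    ∃ M : ℝ, 0 < M ∧ ∀ ρ, M < |ρ| → H ρ = 0 := by
  obtain ⟨M, hM, h⟩ := hc.isCompact.isBounded.exists_pos_norm_le
  refine ⟨M, hM, fun ρ hρ => ?_⟩
  by_contra hne
  have := h ρ (subset_tsupport _ hne)
  rw [Real.norm_eq_abs] at this
  linarith

/-- A continuous function vanishing off a ball is integrable. -/
theorem integrable_of_continuous_of_zero {V : Type*} [NormedAddCommGroup V] [ProperSpace V]
    [MeasurableSpace V] [OpensMeasurableSpace V] {μ : Measure V} [IsFiniteMeasureOnCompacts μ]
    {f : V → ℂ} (hf : Continuous f) {M : ℝ} (h : ∀ x, M < ‖x‖ → f x = 0) : Integrable f μ := by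
  refine hf.integrable_of_hasCompactSupport ?_
  refine HasCompactSupport.of_support_subset_isCompact (isCompact_closedBall 0 M) fun x hx => ?_
  rw [mem_closedBall_zero_iff]
  by_contra h'
  exact hx (h x (not_le.1 h'))

/-- The character `e^{2πi x}`. -/
abbrev echar (x : ℝ) : ℂ := Complex.exp (2 * Real.pi * Complex.I * (x : ℝ))

theorem norm_echar (x : ℝ) : ‖echar x‖ = 1 := by
  rw [Complex.norm_exp]; simp

variable {V : Type*} [NormedAddCommGroup V] [InnerProductSpace ℝ V] [FiniteDimensional ℝ V]
  [MeasurableSpace V] [BorelSpace V]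

/-- Rotating `z` onto an axis, a radial Fourier integral becomes one over a product. -/
theorem integral_radial_eq_prod {n : ℕ} (hV : Module.finrank ℝ V = n + 1) (H : ℝ → ℂ) (z : V) :
    ∫ ξ : V, echar (-inner ℝ z ξ) * H ‖ξ‖ =
      ∫ p : ℝ × EuclideanSpace ℝ (Fin n), echar (‖z‖ * p.1) * H (√(p.1 ^ 2 + ‖p.2‖ ^ 2)) := by
  set W := WithLp 2 (ℝ × EuclideanSpace ℝ (Fin n))
  have hWf : Module.finrank ℝ V = Module.finrank ℝ W := by
    rw [hV, (WithLp.linearEquiv 2 ℝ (ℝ × EuclideanSpace ℝ (Fin n))).finrank_eq]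
    simp [add_comm]
  let T0 : V ≃ₗᵢ[ℝ] W := (stdOrthonormalBasis ℝ V).equiv (stdOrthonormalBasis ℝ W) (finCongr hWf)
  -- The sign cancels the minus in the phase. Since `T0 z` and `w` have equal norms, the reflection
  -- in the hyperplane orthogonal to their difference maps one to the other.
  let w : W := WithLp.toLp 2 (-‖z‖, 0)
  have hw : ‖T0 z‖ = ‖w‖ := by
    rw [LinearIsometryEquiv.norm_map, WithLp.prod_norm_eq_of_L2]
    simp [w]
  let T : V ≃ₗᵢ[ℝ] W := T0.trans (Submodule.reflection (ℝ ∙ (T0 z - w))ᗮ)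
  have hT : T z = w := Submodule.reflection_sub hw
  let f : W → ℂ := fun x => echar (‖z‖ * x.fst) * H ‖x‖
  have h1 : ∀ ξ : V, echar (-inner ℝ z ξ) * H ‖ξ‖ = f (T ξ) := by
    intro ξ
    have : ‖z‖ * (T ξ).fst = -inner ℝ z ξ := by
      rw [← T.inner_map_map, hT, WithLp.prod_inner_apply]
      simp [w, mul_comm]
    simp only [f]
    rw [this, T.norm_map]
  simp_rw [h1]
  rw [T.measurePreserving.integral_comp T.toHomeomorph.measurableEmbedding,
    ← (WithLp.volume_preserving_toLp ℝ (EuclideanSpace ℝ (Fin n))).integral_comp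
      (MeasurableEquiv.toLp 2 _).measurableEmbedding]
  refine integral_congr_ae (Filter.Eventually.of_forall fun p => ?_)
  have hp : ‖WithLp.toLp 2 p‖ = √(p.1 ^ 2 + ‖p.2‖ ^ 2) := by
    rw [WithLp.prod_norm_eq_of_L2]
    simp
  simp only [f]
  rw [hp]
  rfl

/-- The Fourier transform of a radial function. -/
theorem exists_integral_radial_eq {n : ℕ} (hn : 1 ≤ n) (hV : Module.finrank ℝ V = n + 1) :
    ∃ c : ℝ, 0 ≤ c ∧ ∀ H : ℝ → ℂ, Continuous H → HasCompactSupport H → ∀ z : V,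
      ∫ ξ : V, echar (-inner ℝ z ξ) * H ‖ξ‖ =
        c * ∫ p in Set.Ioi (0 : ℝ) ×ˢ Set.Ioo 0 Real.pi,
          ((p.1 ^ n : ℝ) * H p.1) *
            (cosPhase (2 * Real.pi * ‖z‖ * p.1) p.2 * (Real.sin p.2 ^ (n - 1) : ℝ)) := by
  -- The constant is the area of the unit sphere in `ℝ^n`, from polar coordinates in the `n`
  -- variables orthogonal to `z`. The axial variable and the remaining radius fill a half plane,
  -- where planar polar coordinates apply.
  refine ⟨n * (volume : Measure (EuclideanSpace ℝ (Fin n))).real (Metric.ball 0 1),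
    by positivity, fun H hH hHc z => ?_⟩
  obtain ⟨M, hM, hz⟩ := exists_forall_zero_of_hasCompactSupport hHc
  rw [integral_radial_eq_prod hV]
  have hint : Integrable fun p : ℝ × EuclideanSpace ℝ (Fin n) =>
      echar (‖z‖ * p.1) * H (√(p.1 ^ 2 + ‖p.2‖ ^ 2)) := by
    refine integrable_of_continuous_of_zero (M := M) (by fun_prop) fun p hp => ?_
    rw [hz, mul_zero]
    rw [abs_of_nonneg (Real.sqrt_nonneg _)]
    refine Real.lt_sqrt_of_sq_lt ?_
    rcases lt_max_iff.1 hp with h | h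
    · rw [Real.norm_eq_abs] at h
      have : M ^ 2 < |p.1| ^ 2 := by gcongr
      rw [sq_abs] at this
      nlinarith [sq_nonneg ‖p.2‖]
    · have : M ^ 2 < ‖p.2‖ ^ 2 := by gcongr
      nlinarith [sq_nonneg p.1]
  rw [Measure.volume_eq_prod, integral_prod _ hint]
  let g : ℝ × ℝ → ℂ := fun p => (p.2 ^ (n - 1) : ℝ) * (echar (‖z‖ * p.1) * H (√(p.1 ^ 2 + p.2 ^ 2)))
  have hg : Integrable g := by
    refine integrable_of_continuous_of_zero (M := M) (by fun_prop) fun p hp => ?_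
    simp only [g]
    rw [hz, mul_zero, mul_zero]
    rw [abs_of_nonneg (Real.sqrt_nonneg _)]
    refine Real.lt_sqrt_of_sq_lt ?_
    rcases lt_max_iff.1 hp with h | h <;> rw [Real.norm_eq_abs] at h
    · have : M ^ 2 < |p.1| ^ 2 := by gcongr
      rw [sq_abs] at this
      nlinarith [sq_nonneg p.2]
    · have : M ^ 2 < |p.2| ^ 2 := by gcongr
      rw [sq_abs] at this
      nlinarith [sq_nonneg p.1]
  have h1 : ∀ v : ℝ, ∫ y : EuclideanSpace ℝ (Fin n), echar (‖z‖ * v) * H (√(v ^ 2 + ‖y‖ ^ 2)) =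
      (n * (volume : Measure (EuclideanSpace ℝ (Fin n))).real (Metric.ball 0 1) : ℝ) *
        ∫ s in Set.Ioi (0 : ℝ), g (v, s) := by
    intro v
    have : Nontrivial (EuclideanSpace ℝ (Fin n)) := by
      have : Nonempty (Fin n) := ⟨⟨0, hn⟩⟩
      infer_instance
    rw [integral_fun_norm_addHaar (volume : Measure (EuclideanSpace ℝ (Fin n)))
      (fun s => echar (‖z‖ * v) * H (√(v ^ 2 + s ^ 2)))]
    simp only [finrank_euclideanSpace, Fintype.card_fin, g, Complex.real_smul, nsmul_eq_mul]
    push_cast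
    ring
  simp only [h1]
  rw [integral_const_mul]
  have h2 : ∫ v : ℝ, ∫ s in Set.Ioi (0 : ℝ), g (v, s) =
      ∫ p in (Set.univ : Set ℝ) ×ˢ Set.Ioi (0 : ℝ), g p := by
    rw [Measure.volume_eq_prod, setIntegral_prod _ (by exact hg.integrableOn)]
    simp
  rw [h2, integral_halfPlane_polar]
  congr 1
  refine setIntegral_congr_fun (measurableSet_Ioi.prod measurableSet_Ioo) fun p hp => ?_
  have hp1 : 0 < p.1 := hp.1
  have e1 : √((p.1 * Real.cos p.2) ^ 2 + (p.1 * Real.sin p.2) ^ 2) = p.1 := by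
    rw [show (p.1 * Real.cos p.2) ^ 2 + (p.1 * Real.sin p.2) ^ 2 = p.1 ^ 2 by
      rw [mul_pow, mul_pow, ← mul_add, Real.cos_sq_add_sin_sq, mul_one]]
    exact Real.sqrt_sq hp1.le
  have e2 : echar (‖z‖ * (p.1 * Real.cos p.2)) = cosPhase (2 * Real.pi * ‖z‖ * p.1) p.2 := by
    unfold cosPhase echar
    congr 1
    push_cast
    ring
  have e3 : (p.1 ^ n : ℝ) = p.1 * p.1 ^ (n - 1) := by
    rw [← pow_succ', Nat.sub_add_cancel hn]
  simp only [g]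
  rw [e1, e2, e3, Complex.real_smul]
  push_cast
  ring

theorem integrableOn_polar_of_zero {f : ℝ × ℝ → ℂ} (hf : Continuous f) {M : ℝ}
    (h : ∀ p : ℝ × ℝ, M < |p.1| → f p = 0) :
    IntegrableOn f (Set.Ioi (0 : ℝ) ×ˢ Set.Ioo 0 Real.pi) := by
  have hc : IsCompact (Set.Icc 0 M ×ˢ Set.Icc 0 Real.pi) := isCompact_Icc.prod isCompact_Icc
  refine (hf.continuousOn.integrableOn_compact hc).of_forall_sdiff_eq_zero
    (measurableSet_Ioi.prod measurableSet_Ioo) fun p hp => h p ?_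
  by_contra h'
  rw [not_lt] at h'
  exact hp.2 ⟨⟨hp.1.1.le, (le_abs_self _).trans h'⟩, hp.1.2.1.le, hp.1.2.2.le⟩

/-- Decay of the Fourier transform of a radial function, in dimension at least two. -/
theorem exists_norm_integral_radial_le_aux {n : ℕ} (hn : 1 ≤ n)
    (hV : Module.finrank ℝ V = n + 1) :
    ∃ C : ℝ, 0 < C ∧ ∀ H : ℝ → ℂ, Continuous H → HasCompactSupport H → ∀ z : V, z ≠ 0 →
      ‖∫ ξ : V, echar (-inner ℝ z ξ) * H ‖ξ‖‖ ≤
        C * ∫ ρ in Set.Ioi (0 : ℝ), ρ ^ n * (‖z‖ * ρ) ^ (-(n : ℝ) / 2) * ‖H ρ‖ := by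
  obtain ⟨c, hc, hform⟩ := exists_integral_radial_eq (V := V) hn hV
  obtain ⟨C, hC, hosc⟩ := exists_norm_sphereOsc_le (n - 1)
  have hn' : ((n - 1 : ℕ) : ℝ) + 1 = n := by
    rw [Nat.cast_sub hn]; simp
  rw [hn'] at hosc
  refine ⟨(c + 1) * C, by positivity, fun H hH hHc z hz0 => ?_⟩
  have hzn : 0 < ‖z‖ := norm_pos_iff.2 hz0
  obtain ⟨M, hM, hz⟩ := exists_forall_zero_of_hasCompactSupport hHc
  rw [hform H hH hHc, norm_mul, Complex.norm_real, Real.norm_of_nonneg hc]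
  have hint := integrableOn_polar_of_zero (M := M) (f := fun p : ℝ × ℝ => ((p.1 ^ n : ℝ) * H p.1) *
      (cosPhase (2 * Real.pi * ‖z‖ * p.1) p.2 * (Real.sin p.2 ^ (n - 1) : ℝ)))
      (by unfold cosPhase; fun_prop) (fun p hp => by simp [hz _ hp])
  rw [Measure.volume_eq_prod] at hint ⊢
  rw [setIntegral_prod _ hint]
  have h1 : ∀ ρ : ℝ, ∫ θ in Set.Ioo 0 Real.pi, ((ρ ^ n : ℝ) * H ρ) *
      (cosPhase (2 * Real.pi * ‖z‖ * ρ) θ * (Real.sin θ ^ (n - 1) : ℝ)) =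
      ((ρ ^ n : ℝ) * H ρ) * sphereOsc (n - 1) (2 * Real.pi * ‖z‖ * ρ) := by
    intro ρ
    rw [integral_const_mul, sphereOsc, intervalIntegral.integral_of_le Real.pi_pos.le,
      ← integral_Ioc_eq_integral_Ioo]
  have h2 : ‖∫ ρ in Set.Ioi (0 : ℝ), ((ρ ^ n : ℝ) * H ρ) *
      sphereOsc (n - 1) (2 * Real.pi * ‖z‖ * ρ)‖ ≤
      ∫ ρ in Set.Ioi (0 : ℝ), C * (ρ ^ n * (‖z‖ * ρ) ^ (-(n : ℝ) / 2) * ‖H ρ‖) := by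
    refine norm_integral_le_of_norm_le ?_ ?_
    · refine Integrable.const_mul ?_ _
      have hcont : Continuous fun ρ : ℝ => ρ ^ (n / 2 : ℝ) * ‖z‖ ^ (-(n : ℝ) / 2) * ‖H ρ‖ := by
        have : Continuous fun ρ : ℝ => ρ ^ (n / 2 : ℝ) :=
          Real.continuous_rpow_const (by positivity)
        fun_prop
      have hI : IntegrableOn (fun ρ : ℝ => ρ ^ (n / 2 : ℝ) * ‖z‖ ^ (-(n : ℝ) / 2) * ‖H ρ‖)
          (Set.Ioi 0) :=
        (hcont.integrable_of_hasCompactSupport (hHc.norm.mul_left)).integrableOn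
      refine hI.congr_fun (fun ρ hρ => ?_) measurableSet_Ioi
      have hρ : 0 < ρ := hρ
      simp only
      rw [Real.mul_rpow hzn.le hρ.le, ← Real.rpow_natCast ρ n]
      have : ρ ^ (n / 2 : ℝ) = ρ ^ (n : ℝ) * ρ ^ (-(n : ℝ) / 2) := by
        rw [← Real.rpow_add hρ]; congr 1; ring
      rw [this]
      ring
    · refine (ae_restrict_iff' measurableSet_Ioi).2 (Filter.Eventually.of_forall fun ρ hρ => ?_)
      have hρ : 0 < ρ := hρ
      have hs : 0 < 2 * Real.pi * ‖z‖ * ρ := by positivity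
      rw [norm_mul, norm_mul, Complex.norm_real, Real.norm_of_nonneg (by positivity)]
      have h3 : (2 * Real.pi * ‖z‖ * ρ) ^ (-(n : ℝ) / 2) ≤ (‖z‖ * ρ) ^ (-(n : ℝ) / 2) := by
        refine Real.rpow_le_rpow_of_nonpos (by positivity) ?_ (by
          have : (0 : ℝ) ≤ n := n.cast_nonneg
          linarith)
        have : 0 < ‖z‖ * ρ := by positivity
        nlinarith [Real.pi_gt_three]
      calc _ ≤ ρ ^ n * ‖H ρ‖ * (C * (‖z‖ * ρ) ^ (-(n : ℝ) / 2)) := by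
            gcongr
            exact (hosc _ hs).trans (by gcongr)
        _ = _ := by ring
  simp_rw [h1]
  rw [integral_const_mul] at h2
  have h4 : 0 ≤ ∫ ρ in Set.Ioi (0 : ℝ), ρ ^ n * (‖z‖ * ρ) ^ (-(n : ℝ) / 2) * ‖H ρ‖ :=
    setIntegral_nonneg measurableSet_Ioi fun ρ hρ => by
      have : 0 < ρ := hρ
      positivity
  calc _ ≤ c * (C * ∫ ρ in Set.Ioi (0 : ℝ), ρ ^ n * (‖z‖ * ρ) ^ (-(n : ℝ) / 2) * ‖H ρ‖) := by
        gcongr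
    _ ≤ (c + 1) * (C * ∫ ρ in Set.Ioi (0 : ℝ), ρ ^ n * (‖z‖ * ρ) ^ (-(n : ℝ) / 2) * ‖H ρ‖) := by
        gcongr
        linarith
    _ = _ := by ring

/-- The trivial bound for the Fourier transform of a radial function. -/
theorem exists_norm_integral_radial_le_trivial {n : ℕ} (hV : Module.finrank ℝ V = n + 1) :
    ∃ C : ℝ, 0 < C ∧ ∀ H : ℝ → ℂ, ∀ z : V,
      ‖∫ ξ : V, echar (-inner ℝ z ξ) * H ‖ξ‖‖ ≤ C * ∫ ρ in Set.Ioi (0 : ℝ), ρ ^ n * ‖H ρ‖ := by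
  have : Nontrivial V := Module.nontrivial_of_finrank_pos (R := ℝ) (by omega)
  refine ⟨(n + 1) * (volume : Measure V).real (Metric.ball 0 1) + 1, by positivity, fun H z => ?_⟩
  refine (norm_integral_le_integral_norm _).trans ?_
  simp only [norm_mul, norm_echar, one_mul]
  rw [integral_fun_norm_addHaar (volume : Measure V) (fun ρ => ‖H ρ‖), hV]
  simp only [nsmul_eq_mul, smul_eq_mul, Nat.add_sub_cancel, ← mul_assoc]
  have h4 : 0 ≤ ∫ ρ in Set.Ioi (0 : ℝ), ρ ^ n * ‖H ρ‖ :=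
    setIntegral_nonneg measurableSet_Ioi fun ρ hρ => by
      have : 0 < ρ := hρ
      positivity
  refine mul_le_mul_of_nonneg_right ?_ h4
  push_cast
  linarith

/-- Decay of the Fourier transform of a radial function. -/
theorem exists_norm_integral_radial_le {n : ℕ} (hV : Module.finrank ℝ V = n + 1) :
    ∃ C : ℝ, 0 < C ∧ ∀ H : ℝ → ℂ, Continuous H → HasCompactSupport H → ∀ z : V, z ≠ 0 →
      ‖∫ ξ : V, echar (-inner ℝ z ξ) * H ‖ξ‖‖ ≤
        C * ∫ ρ in Set.Ioi (0 : ℝ), ρ ^ n * (‖z‖ * ρ) ^ (-(n : ℝ) / 2) * ‖H ρ‖ := by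
  rcases Nat.eq_zero_or_pos n with rfl | hn
  · obtain ⟨C, hC, h⟩ := exists_norm_integral_radial_le_trivial (V := V) hV
    refine ⟨C, hC, fun H _ _ z _ => ?_⟩
    simpa using h H z
  · exact exists_norm_integral_radial_le_aux hn hV

end Radial

/-! ### Truncation of bilinear forms away from the diagonal. -/

section Blocks

/-- Removing from a matrix the blocks near the diagonal costs a constant factor. -/
theorem norm_sum_far_le (F : Finset ℝ) (b : ℝ → ℤ) (a : ℝ → ℝ → ℂ) (u u' : ℝ → ℝ)
    (hu' : ∀ t, 0 ≤ u' t) {B : ℝ} (hB : 0 ≤ B)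
    (h : ∀ S ⊆ F, ∀ S' ⊆ F, ‖∑ t ∈ S, ∑ t' ∈ S', a t t'‖ ≤ B * (∑ t ∈ S, u t + ∑ t ∈ S', u' t)) :
    ‖∑ t ∈ F, ∑ t' ∈ F, if 2 ≤ |b t - b t'| then a t t' else 0‖ ≤
      4 * B * (∑ t ∈ F, u t + ∑ t ∈ F, u' t) := by
  -- The far part is the full form minus the three block diagonals `b t' = b t + e`, `e ∈ {-1, 0,
  -- 1}`, which gives the factor `4 = 1 + 3`.
  have hpt : ∀ t t', (if 2 ≤ |b t - b t'| then a t t' else 0) =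
      a t t' - ∑ e ∈ ({-1, 0, 1} : Finset ℤ), if b t' = b t + e then a t t' else 0 := by
    intro t t'
    have hs : ∑ e ∈ ({-1, 0, 1} : Finset ℤ), (if b t' = b t + e then a t t' else 0) =
        if b t' - b t ∈ ({-1, 0, 1} : Finset ℤ) then a t t' else 0 := by
      rw [← Finset.sum_ite_eq' ({-1, 0, 1} : Finset ℤ) (b t' - b t) fun _ => a t t']
      refine Finset.sum_congr rfl fun e _ => ?_
      have : b t' = b t + e ↔ e = b t' - b t := by omega
      simp only [this]
    rw [hs]
    by_cases hf : 2 ≤ |b t - b t'|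
    · rw [if_pos hf, if_neg, sub_zero]
      simp only [Finset.mem_insert, Finset.mem_singleton]
      rcases abs_cases (b t - b t') with ⟨h1, h2⟩ | ⟨h1, h2⟩ <;> omega
    · rw [if_neg hf, if_pos, sub_self]
      simp only [Finset.mem_insert, Finset.mem_singleton]
      rcases abs_cases (b t - b t') with ⟨h1, h2⟩ | ⟨h1, h2⟩ <;> omega
  -- For fixed `e`, different blocks use disjoint rows and disjoint columns. The bounds for the
  -- blocks therefore add up without loss.
  have hblock : ∀ e : ℤ, ‖∑ t ∈ F, ∑ t' ∈ F, if b t' = b t + e then a t t' else 0‖ ≤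
      B * (∑ t ∈ F, u t + ∑ t ∈ F, u' t) := by
    intro e
    have e1 : ∑ t ∈ F, ∑ t' ∈ F, (if b t' = b t + e then a t t' else 0) =
        ∑ m ∈ F.image b, ∑ t ∈ F with b t = m, ∑ t' ∈ F with b t' = m + e, a t t' := by
      rw [← Finset.sum_fiberwise_of_maps_to (g := b) (t := F.image b)
        fun t ht => Finset.mem_image_of_mem b ht]
      refine Finset.sum_congr rfl fun m _ => Finset.sum_congr rfl fun t ht => ?_
      rw [Finset.sum_filter, (Finset.mem_filter.1 ht).2]
    have e2 : ∑ m ∈ F.image b, ∑ t ∈ F with b t = m, u t = ∑ t ∈ F, u t :=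
      Finset.sum_fiberwise_of_maps_to (fun t ht => Finset.mem_image_of_mem b ht) _
    have e3 : ∑ m ∈ F.image b, ∑ t' ∈ F with b t' = m + e, u' t' ≤ ∑ t ∈ F, u' t := by
      simp only [Finset.sum_filter]
      rw [Finset.sum_comm]
      refine Finset.sum_le_sum fun t _ => ?_
      have : ∀ m, b t = m + e ↔ m = b t - e := fun m => by omega
      simp only [this, Finset.sum_ite_eq']
      split_ifs
      · exact le_rfl
      · exact hu' t
    rw [e1]
    calc _ ≤ ∑ m ∈ F.image b, B * (∑ t ∈ F with b t = m, u t + ∑ t' ∈ F with b t' = m + e, u' t') :=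
          (norm_sum_le _ _).trans (Finset.sum_le_sum fun m _ =>
            h _ (Finset.filter_subset _ _) _ (Finset.filter_subset _ _))
      _ = B * (∑ m ∈ F.image b, ∑ t ∈ F with b t = m, u t +
            ∑ m ∈ F.image b, ∑ t' ∈ F with b t' = m + e, u' t') := by
          rw [← Finset.mul_sum, Finset.sum_add_distrib]
      _ ≤ _ := by rw [e2]; gcongr
  have e4 : ∑ t ∈ F, ∑ t' ∈ F, (if 2 ≤ |b t - b t'| then a t t' else 0) =
      ∑ t ∈ F, ∑ t' ∈ F, a t t' - ∑ e ∈ ({-1, 0, 1} : Finset ℤ),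
        ∑ t ∈ F, ∑ t' ∈ F, if b t' = b t + e then a t t' else 0 := by
    simp_rw [hpt, Finset.sum_sub_distrib]
    congr 1
    rw [Finset.sum_comm (s := ({-1, 0, 1} : Finset ℤ))]
    refine Finset.sum_congr rfl fun t _ => ?_
    rw [Finset.sum_comm]
  rw [e4]
  refine (norm_sub_le _ _).trans ?_
  have e5 := h F subset_rfl F subset_rfl
  have e6 : ‖∑ e ∈ ({-1, 0, 1} : Finset ℤ),
      ∑ t ∈ F, ∑ t' ∈ F, if b t' = b t + e then a t t' else 0‖ ≤
      3 * (B * (∑ t ∈ F, u t + ∑ t ∈ F, u' t)) := by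
    refine (norm_sum_le_of_le _ fun e _ => hblock e).trans (le_of_eq ?_)
    simp
  linarith

end Blocks

/-! ### Wave kernels as a bilinear form over separated times. -/

section Kernel

variable {V : Type*} [NormedAddCommGroup V] [InnerProductSpace ℝ V] [FiniteDimensional ℝ V]
  [MeasurableSpace V] [BorelSpace V]

/-- The frequency cutoff at scale `δ⁻¹`. -/
def cutoff (φ : ℝ → ℝ) (δ ρ : ℝ) : ℝ := φ (δ * (2 * Real.pi * ρ))

/-- The kernel of the wave propagator at time `τ`, localized by the square of the cutoff. -/
def waveKernel (φ : ℝ → ℝ) (δ τ : ℝ) (z : V) : ℂ :=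
  ∫ ξ : V, echar (-inner ℝ z ξ) * (((cutoff φ δ ‖ξ‖ ^ 2 : ℝ) : ℂ) * echar (τ * ‖ξ‖))

variable {φ : ℝ → ℝ}

theorem continuous_cutoff (hφ : Continuous φ) (δ : ℝ) : Continuous (cutoff φ δ) := by
  unfold cutoff; fun_prop

/-- The support forces `1/(8π) < δρ < 2/π`, and `8π < 26` while `2/π < 1`. -/
theorem mem_of_cutoff_ne_zero (hs : Function.support φ ⊆ Set.Ioo (1 / 4) 4) {δ ρ : ℝ}
    (hδ : 0 < δ) (h : cutoff φ δ ρ ≠ 0) : δ⁻¹ / 26 ≤ ρ ∧ ρ ≤ δ⁻¹ := by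
  have h1 : δ * (2 * Real.pi * ρ) ∈ Set.Ioo (1 / 4) 4 := hs h
  have h2 := Real.pi_gt_three
  have h3 : Real.pi < 3.15 := Real.pi_lt_d2
  obtain ⟨ha, hb⟩ := h1
  have hpos : 0 < δ * ρ := by
    by_contra hc
    nlinarith
  constructor
  · rw [div_le_iff₀ (by norm_num), inv_le_iff_one_le_mul₀' hδ]
    nlinarith
  · rw [← one_div, le_div_iff₀ hδ]
    nlinarith

theorem cutoff_eq_zero (hs : Function.support φ ⊆ Set.Ioo (1 / 4) 4) {δ ρ : ℝ}
    (hδ : 0 < δ) (h : δ⁻¹ < |ρ|) : cutoff φ δ ρ = 0 := by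
  by_contra hne
  have h1 := mem_of_cutoff_ne_zero hs hδ hne
  have h2 : 0 < δ⁻¹ := inv_pos.2 hδ
  rw [abs_of_nonneg (by linarith)] at h
  linarith

theorem exists_abs_le_of_support (hφ : Continuous φ)
    (hs : Function.support φ ⊆ Set.Ioo (1 / 4) 4) : ∃ Φ : ℝ, 0 < Φ ∧ ∀ x, |φ x| ≤ Φ := by
  have hc : HasCompactSupport φ :=
    HasCompactSupport.of_support_subset_isCompact isCompact_Icc
      (hs.trans Set.Ioo_subset_Icc_self)
  obtain ⟨C, hC⟩ := hφ.bounded_above_of_compact_support hc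
  exact ⟨|C| + 1, by positivity, fun x => (hC x).trans (by linarith [le_abs_self C])⟩

/-- The profile whose radial Fourier transform is the bilinear form of the kernels. -/
def bilinProfile (φ : ℝ → ℝ) (δ : ℝ) (S S' : Finset ℝ) (c c' : ℝ → ℂ) (ρ : ℝ) : ℂ :=
  ((cutoff φ δ ρ ^ 2 : ℝ) : ℂ) * (expSum S c ρ * (starRingEnd ℂ) (expSum S' c' ρ))

theorem continuous_bilinProfile (hφ : Continuous φ) (δ : ℝ) (S S' : Finset ℝ) (c c' : ℝ → ℂ) :
    Continuous (bilinProfile φ δ S S' c c') := by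
  have h1 := continuous_cutoff hφ δ
  have h2 := continuous_expSum S c
  have h3 := continuous_expSum S' c'
  have h4 := Complex.continuous_conj
  unfold bilinProfile
  fun_prop

theorem hasCompactSupport_bilinProfile (hs : Function.support φ ⊆ Set.Ioo (1 / 4) 4) {δ : ℝ}
    (hδ : 0 < δ) (S S' : Finset ℝ) (c c' : ℝ → ℂ) :
    HasCompactSupport (bilinProfile φ δ S S' c c') := by
  refine HasCompactSupport.of_support_subset_isCompact
    (isCompact_Icc (a := -δ⁻¹) (b := δ⁻¹)) fun ρ hρ => ?_
  refine abs_le.1 ?_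
  by_contra h
  exact hρ (by simp [bilinProfile, cutoff_eq_zero hs hδ (not_le.1 h)])

/-- The time dependence `echar ((t - t')|ξ|)` factors, so the double sum collapses under the
integral into a product of two exponential sums. This is what makes the large sieve applicable. -/
theorem sum_waveKernel_eq (hφ : Continuous φ) (hs : Function.support φ ⊆ Set.Ioo (1 / 4) 4)
    {δ : ℝ} (hδ : 0 < δ) (S S' : Finset ℝ) (c c' : ℝ → ℂ) (z : V) :
    ∑ t ∈ S, ∑ t' ∈ S', c t * (starRingEnd ℂ) (c' t') * waveKernel φ δ (t - t') z =
      ∫ ξ : V, echar (-inner ℝ z ξ) * bilinProfile φ δ S S' c c' ‖ξ‖ := by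
  have hcut := continuous_cutoff hφ δ
  have hterm : ∀ t t' : ℝ, Integrable fun ξ : V => c t * (starRingEnd ℂ) (c' t') *
      (echar (-inner ℝ z ξ) * (((cutoff φ δ ‖ξ‖ ^ 2 : ℝ) : ℂ) * echar ((t - t') * ‖ξ‖))) := by
    intro t t'
    refine integrable_of_continuous_of_zero (M := δ⁻¹) (by fun_prop) fun ξ hξ => ?_
    rw [cutoff_eq_zero hs hδ (by rwa [abs_of_nonneg (norm_nonneg _)])]
    simp
  have hexp : ∀ ξ : V, echar (-inner ℝ z ξ) * bilinProfile φ δ S S' c c' ‖ξ‖ =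
      ∑ t ∈ S, ∑ t' ∈ S', c t * (starRingEnd ℂ) (c' t') *
      (echar (-inner ℝ z ξ) * (((cutoff φ δ ‖ξ‖ ^ 2 : ℝ) : ℂ) * echar ((t - t') * ‖ξ‖))) := by
    intro ξ
    rw [bilinProfile, expSum_mul_conj, Finset.mul_sum, Finset.mul_sum]
    refine Finset.sum_congr rfl fun t _ => ?_
    rw [Finset.mul_sum, Finset.mul_sum]
    exact Finset.sum_congr rfl fun t' _ => by ring
  simp_rw [hexp]
  rw [integral_finsetSum _ fun t _ => integrable_finsetSum _ fun t' _ => hterm t t']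
  refine Finset.sum_congr rfl fun t _ => ?_
  rw [integral_finsetSum _ fun t' _ => hterm t t']
  exact Finset.sum_congr rfl fun t' _ => by rw [integral_const_mul, waveKernel]

/-- Weighted `L¹` bound for the bilinear profile, from the large sieve. -/
theorem exists_integral_bilinProfile_le (hφ : Continuous φ)
    (hs : Function.support φ ⊆ Set.Ioo (1 / 4) 4) :
    ∃ C : ℝ, 0 < C ∧ ∀ δ : ℝ, 0 < δ → ∀ S S' : Finset ℝ, IsSep δ S → IsSep δ S' →
      ∀ (c c' : ℝ → ℂ) (w : ℝ → ℝ) (w₀ : ℝ), 0 ≤ w₀ → (∀ ρ, 0 < ρ → 0 ≤ w ρ) →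
      (∀ ρ, δ⁻¹ / 26 ≤ ρ → ρ ≤ δ⁻¹ → w ρ ≤ w₀) →
      ∫ ρ in Set.Ioi (0 : ℝ), w ρ * ‖bilinProfile φ δ S S' c c' ρ‖ ≤
        C * w₀ * δ⁻¹ * (∑ t ∈ S, ‖c t‖ ^ 2 + ∑ t ∈ S', ‖c' t‖ ^ 2) := by
  obtain ⟨C, hC, hls⟩ := exists_large_sieve
  obtain ⟨Φ, hΦ, hb⟩ := exists_abs_le_of_support hφ hs
  refine ⟨Φ ^ 2 * C, by positivity, fun δ hδ S S' hS hS' c c' w w₀ hw0 hw hw' => ?_⟩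
  have hP := continuous_expSum S c
  have hP' := continuous_expSum S' c'
  -- The cutoff is bounded by its supremum and the product of exponential sums by the sum of their
  -- squares. The weight only matters where the cutoff lives.
  let g : ℝ → ℝ := (Set.Icc 0 δ⁻¹).indicator fun ρ =>
    w₀ * Φ ^ 2 * (‖expSum S c ρ‖ ^ 2 + ‖expSum S' c' ρ‖ ^ 2)
  have hgi : Integrable g := by
    rw [integrable_indicator_iff measurableSet_Icc]
    exact Continuous.integrableOn_Icc (by fun_prop)
  have hle : ∀ ρ ∈ Set.Ioi (0 : ℝ), w ρ * ‖bilinProfile φ δ S S' c c' ρ‖ ≤ g ρ := by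
    intro ρ hρ
    have hρ : 0 < ρ := hρ
    by_cases hcut : cutoff φ δ ρ = 0
    · have h0 : bilinProfile φ δ S S' c c' ρ = 0 := by simp [bilinProfile, hcut]
      rw [h0, norm_zero, mul_zero]
      exact Set.indicator_nonneg (fun x _ => by positivity) _
    · have h1 := mem_of_cutoff_ne_zero hs hδ hcut
      have h2 : g ρ = w₀ * Φ ^ 2 * (‖expSum S c ρ‖ ^ 2 + ‖expSum S' c' ρ‖ ^ 2) :=
        Set.indicator_of_mem (show ρ ∈ Set.Icc 0 δ⁻¹ from ⟨hρ.le, h1.2⟩) _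
      rw [h2, bilinProfile, norm_mul, norm_mul, RCLike.norm_conj, Complex.norm_real,
        Real.norm_of_nonneg (by positivity), mul_assoc w₀]
      have h3 : cutoff φ δ ρ ^ 2 ≤ Φ ^ 2 := by
        rw [← sq_abs]
        have := hb (δ * (2 * Real.pi * ρ))
        exact pow_le_pow_left₀ (abs_nonneg _) this 2
      have h4 : ‖expSum S c ρ‖ * ‖expSum S' c' ρ‖ ≤ ‖expSum S c ρ‖ ^ 2 + ‖expSum S' c' ρ‖ ^ 2 := by
        nlinarith [sq_nonneg (‖expSum S c ρ‖ - ‖expSum S' c' ρ‖), sq_nonneg ‖expSum S c ρ‖,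
          sq_nonneg ‖expSum S' c' ρ‖]
      have h5 := hw' ρ h1.1 h1.2
      gcongr
  have hgn : ∀ ρ, 0 ≤ g ρ := fun ρ => Set.indicator_nonneg (fun x _ => by positivity) _
  calc ∫ ρ in Set.Ioi (0 : ℝ), w ρ * ‖bilinProfile φ δ S S' c c' ρ‖
      ≤ ∫ ρ in Set.Ioi (0 : ℝ), g ρ := by
        refine integral_mono_of_nonneg ?_ hgi.integrableOn ?_
        · refine (ae_restrict_iff' measurableSet_Ioi).2 (Filter.Eventually.of_forall fun ρ hρ => ?_)
          exact mul_nonneg (hw ρ hρ) (norm_nonneg _)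
        · exact (ae_restrict_iff' measurableSet_Ioi).2 (Filter.Eventually.of_forall hle)
    _ ≤ ∫ ρ, g ρ := setIntegral_le_integral hgi (Filter.Eventually.of_forall hgn)
    _ = w₀ * Φ ^ 2 * ((∫ ρ in Set.Icc 0 δ⁻¹, ‖expSum S c ρ‖ ^ 2) +
          ∫ ρ in Set.Icc 0 δ⁻¹, ‖expSum S' c' ρ‖ ^ 2) := by
        rw [integral_indicator measurableSet_Icc, integral_const_mul, integral_add]
        · exact Continuous.integrableOn_Icc (by fun_prop)
        · exact Continuous.integrableOn_Icc (by fun_prop)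
    _ ≤ w₀ * Φ ^ 2 * (C * δ⁻¹ * (∑ t ∈ S, ‖c t‖ ^ 2) + C * δ⁻¹ * ∑ t ∈ S', ‖c' t‖ ^ 2) := by
        gcongr
        · exact hls δ hδ S hS c
        · exact hls δ hδ S' hS' c'
    _ = _ := by ring

/-- Bound for the full bilinear form of the kernels at a fixed point. -/
theorem exists_norm_sum_waveKernel_le {n : ℕ} (hV : Module.finrank ℝ V = n + 1)
    (hφ : Continuous φ) (hs : Function.support φ ⊆ Set.Ioo (1 / 4) 4) :
    ∃ C : ℝ, 0 < C ∧ ∀ δ : ℝ, 0 < δ → ∀ S S' : Finset ℝ, IsSep δ S → IsSep δ S' →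
      ∀ (c c' : ℝ → ℂ) (z : V),
      ‖∑ t ∈ S, ∑ t' ∈ S', c t * (starRingEnd ℂ) (c' t') * waveKernel φ δ (t - t') z‖ ≤
        C * δ⁻¹ ^ (n + 1) * (∑ t ∈ S, ‖c t‖ ^ 2 + ∑ t ∈ S', ‖c' t‖ ^ 2) := by
  obtain ⟨C, hC, h⟩ := exists_integral_bilinProfile_le hφ hs
  obtain ⟨C', hC', h'⟩ := exists_norm_integral_radial_le_trivial (V := V) hV
  refine ⟨C' * C, by positivity, fun δ hδ S S' hS hS' c c' z => ?_⟩
  rw [sum_waveKernel_eq hφ hs hδ]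
  have h1 := h δ hδ S S' hS hS' c c' (fun ρ => ρ ^ n) (δ⁻¹ ^ n) (by positivity)
    (fun ρ hρ => by positivity) (fun ρ h1 h2 => by
      have : 0 < δ⁻¹ := inv_pos.2 hδ
      have : 0 ≤ ρ := le_trans (by positivity) h1
      gcongr)
  refine (h' _ z).trans ?_
  calc _ ≤ C' * (C * δ⁻¹ ^ n * δ⁻¹ * (∑ t ∈ S, ‖c t‖ ^ 2 + ∑ t ∈ S', ‖c' t‖ ^ 2)) := by gcongr
    _ = _ := by ring

/-- Bound for the full bilinear form of the kernels, with decay in space. -/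
theorem exists_norm_sum_waveKernel_le_decay {n : ℕ} (hV : Module.finrank ℝ V = n + 1)
    (hφ : Continuous φ) (hs : Function.support φ ⊆ Set.Ioo (1 / 4) 4) :
    ∃ C : ℝ, 0 < C ∧ ∀ δ : ℝ, 0 < δ → ∀ S S' : Finset ℝ, IsSep δ S → IsSep δ S' →
      ∀ (c c' : ℝ → ℂ) (z : V), z ≠ 0 →
      ‖∑ t ∈ S, ∑ t' ∈ S', c t * (starRingEnd ℂ) (c' t') * waveKernel φ δ (t - t') z‖ ≤
        C * δ⁻¹ ^ (n + 1) * (‖z‖ / δ) ^ (-(n : ℝ) / 2) *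
          (∑ t ∈ S, ‖c t‖ ^ 2 + ∑ t ∈ S', ‖c' t‖ ^ 2) := by
  obtain ⟨C, hC, h⟩ := exists_integral_bilinProfile_le hφ hs
  obtain ⟨C', hC', h'⟩ := exists_norm_integral_radial_le (V := V) hV
  have hn : -(n : ℝ) / 2 ≤ 0 := by
    have : (0 : ℝ) ≤ n := n.cast_nonneg
    linarith
  refine ⟨C' * C * (26 : ℝ)⁻¹ ^ (-(n : ℝ) / 2), by positivity, fun δ hδ S S' hS hS' c c' z hz => ?_⟩
  have hzn : 0 < ‖z‖ := norm_pos_iff.2 hz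
  rw [sum_waveKernel_eq hφ hs hδ]
  have hd : 0 < δ⁻¹ := inv_pos.2 hδ
  -- The factor with nonpositive exponent is bounded by its value at the bottom `δ⁻¹/26` of the
  -- frequency shell, the factor `ρ ^ n` by its value at the top.
  have h1 := h δ hδ S S' hS hS' c c' (fun ρ => ρ ^ n * (‖z‖ * ρ) ^ (-(n : ℝ) / 2))
    (δ⁻¹ ^ n * (‖z‖ * (δ⁻¹ / 26)) ^ (-(n : ℝ) / 2)) (by positivity)
    (fun ρ hρ => by positivity) (fun ρ h1 h2 => by
      have : 0 < ρ := lt_of_lt_of_le (by positivity) h1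
      have h3 : (‖z‖ * ρ) ^ (-(n : ℝ) / 2) ≤ (‖z‖ * (δ⁻¹ / 26)) ^ (-(n : ℝ) / 2) :=
        Real.rpow_le_rpow_of_nonpos (by positivity) (by gcongr) hn
      gcongr)
  refine (h' _ (continuous_bilinProfile hφ δ S S' c c')
    (hasCompactSupport_bilinProfile hs hδ S S' c c') z hz).trans ?_
  have e : (‖z‖ * (δ⁻¹ / 26)) ^ (-(n : ℝ) / 2) =
      (26 : ℝ)⁻¹ ^ (-(n : ℝ) / 2) * (‖z‖ / δ) ^ (-(n : ℝ) / 2) := by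
    rw [← Real.mul_rpow (by positivity) (by positivity)]
    congr 1
    field_simp
  rw [e] at h1
  calc _ ≤ C' * (C * (δ⁻¹ ^ n * ((26 : ℝ)⁻¹ ^ (-(n : ℝ) / 2) * (‖z‖ / δ) ^ (-(n : ℝ) / 2))) * δ⁻¹ *
        (∑ t ∈ S, ‖c t‖ ^ 2 + ∑ t ∈ S', ‖c' t‖ ^ 2)) := by gcongr
    _ = _ := by ring

end Kernel

/-! ### Non-stationary phase and the far part of the kernel form. -/

section NonStationary

variable {V : Type*} [NormedAddCommGroup V] [InnerProductSpace ℝ V] [FiniteDimensional ℝ V]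
  [MeasurableSpace V] [BorelSpace V] {φ : ℝ → ℝ}

/-- Rescaling by `δ` turns the integral into `δ^{-(n+1)}` times the Fourier transform of one fixed
Schwartz function at `-σ/δ`. The constant is thus independent of `δ`. -/
theorem exists_norm_integral_cutoff_echar_le (hφ : ContDiff ℝ (⊤ : ℕ∞) φ)
    (hs : Function.support φ ⊆ Set.Ioo (1 / 4) 4) (n M : ℕ) :
    ∃ C : ℝ, 0 < C ∧ ∀ δ : ℝ, 0 < δ → ∀ σ : ℝ,
      ‖∫ ρ : ℝ, ((ρ ^ n * cutoff φ δ ρ ^ 2 : ℝ) : ℂ) * echar (σ * ρ)‖ * (|σ| / δ) ^ M ≤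
        C * δ⁻¹ ^ (n + 1) := by
  let Ψ : ℝ → ℂ := fun x => ((x ^ n * cutoff φ 1 x ^ 2 : ℝ) : ℂ)
  have hΨ : ContDiff ℝ (⊤ : ℕ∞) Ψ := by
    have h : ContDiff ℝ (⊤ : ℕ∞) fun x : ℝ => x ^ n * cutoff φ 1 x ^ 2 := by
      have : ContDiff ℝ (⊤ : ℕ∞) (cutoff φ 1) := by
        unfold cutoff
        exact hφ.comp (by fun_prop)
      exact (contDiff_id.pow n).mul (this.pow 2)
    exact Complex.ofRealCLM.contDiff.comp h
  have hΨc : HasCompactSupport Ψ := by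
    refine HasCompactSupport.of_support_subset_isCompact
      (isCompact_Icc (a := -(1 : ℝ)⁻¹) (b := (1 : ℝ)⁻¹)) fun ρ hρ => ?_
    refine abs_le.1 ?_
    by_contra h
    exact hρ (by simp [Ψ, cutoff_eq_zero hs one_pos (not_le.1 h)])
  obtain ⟨C, hC, hdec⟩ := (𝓕 (hΨc.toSchwartzMap hΨ)).decay M 0
  refine ⟨C, hC, fun δ hδ σ => ?_⟩
  have e1 : ∫ ρ : ℝ, ((ρ ^ n * cutoff φ δ ρ ^ 2 : ℝ) : ℂ) * echar (σ * ρ) =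
      ((δ⁻¹ ^ (n + 1) : ℝ) : ℂ) * 𝓕 Ψ (-(σ / δ)) := by
    have h1 : ∀ ρ : ℝ, ((ρ ^ n * cutoff φ δ ρ ^ 2 : ℝ) : ℂ) * echar (σ * ρ) =
        ((δ⁻¹ ^ n : ℝ) : ℂ) * (fun x => Ψ x * echar (σ / δ * x)) (δ * ρ) := by
      intro ρ
      have hc : cutoff φ 1 (δ * ρ) = cutoff φ δ ρ := by
        unfold cutoff; congr 1; ring
      have he : σ / δ * (δ * ρ) = σ * ρ := by field_simp
      simp only [Ψ]
      rw [hc, he, ← mul_assoc, ← Complex.ofReal_mul]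
      congr 2
      rw [mul_pow, ← mul_assoc, ← mul_assoc, ← mul_pow, inv_mul_cancel₀ hδ.ne', one_pow, one_mul]
    simp_rw [h1]
    rw [integral_const_mul, Measure.integral_comp_mul_left (fun x => Ψ x * echar (σ / δ * x)) δ,
      Real.fourier_real_eq_integral_exp_smul, abs_of_pos (inv_pos.2 hδ), Complex.real_smul,
      ← mul_assoc, ← Complex.ofReal_mul, pow_succ]
    congr 2
    funext x
    rw [smul_eq_mul, mul_comm]
    congr 1
    unfold echar
    congr 1
    push_cast
    ring
  have h2 := hdec (-(σ / δ))
  rw [norm_iteratedFDeriv_zero, SchwartzMap.fourier_coe] at h2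
  have h3 : ‖-(σ / δ)‖ = |σ| / δ := by
    rw [norm_neg, Real.norm_eq_abs, abs_div, abs_of_pos hδ]
  rw [h3] at h2
  have h4 : ((hΨc.toSchwartzMap hΨ : SchwartzMap ℝ ℂ) : ℝ → ℂ) = Ψ := rfl
  rw [h4] at h2
  have hd : 0 < δ⁻¹ := inv_pos.2 hδ
  rw [e1, norm_mul, Complex.norm_real, Real.norm_of_nonneg (by positivity)]
  calc _ = δ⁻¹ ^ (n + 1) * ((|σ| / δ) ^ M * ‖𝓕 Ψ (-(σ / δ))‖) := by ring
    _ ≤ δ⁻¹ ^ (n + 1) * C := by gcongr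
    _ = _ := by ring

/-- Rapid decay of the wave kernel away from the light cone, inside `‖z‖ ≤ |τ| / 2`. -/
theorem exists_norm_waveKernel_le {n : ℕ} (hn : 1 ≤ n) (hV : Module.finrank ℝ V = n + 1)
    (hφ : ContDiff ℝ (⊤ : ℕ∞) φ) (hs : Function.support φ ⊆ Set.Ioo (1 / 4) 4) (M : ℕ) :
    ∃ C : ℝ, 0 < C ∧ ∀ δ : ℝ, 0 < δ → ∀ (τ : ℝ) (z : V), ‖z‖ ≤ |τ| / 2 →
      ‖waveKernel φ δ τ z‖ * (|τ| / δ) ^ M ≤ C * δ⁻¹ ^ (n + 1) := by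
  obtain ⟨c, hc, hform⟩ := exists_integral_radial_eq (V := V) hn hV
  obtain ⟨C, hC, hosc⟩ := exists_norm_integral_cutoff_echar_le hφ hs n M
  refine ⟨(c + 1) * (2 ^ M * C * Real.pi), by positivity, fun δ hδ τ z hz => ?_⟩
  have hcut := continuous_cutoff hφ.continuous δ
  have hd : 0 < δ⁻¹ := inv_pos.2 hδ
  let H : ℝ → ℂ := fun ρ => ((cutoff φ δ ρ ^ 2 : ℝ) : ℂ) * echar (τ * ρ)
  have hH : Continuous H := by fun_prop
  have hz0 : ∀ ρ, δ⁻¹ < |ρ| → H ρ = 0 := fun ρ hρ => by simp [H, cutoff_eq_zero hs hδ hρ]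
  have hHc : HasCompactSupport H := by
    refine HasCompactSupport.of_support_subset_isCompact
      (isCompact_Icc (a := -δ⁻¹) (b := δ⁻¹)) fun ρ hρ => ?_
    refine abs_le.1 ?_
    by_contra h
    exact hρ (hz0 ρ (not_le.1 h))
  have e0 : waveKernel φ δ τ z = ∫ ξ : V, echar (-inner ℝ z ξ) * H ‖ξ‖ := rfl
  rw [e0, hform H hH hHc]
  have hint := integrableOn_polar_of_zero (M := δ⁻¹)
      (f := fun p : ℝ × ℝ => ((p.1 ^ n : ℝ) * H p.1) *
      (cosPhase (2 * Real.pi * ‖z‖ * p.1) p.2 * (Real.sin p.2 ^ (n - 1) : ℝ)))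
      (by unfold cosPhase; fun_prop) (fun p hp => by simp [hz0 _ hp])
  rw [Measure.volume_eq_prod] at hint ⊢
  rw [setIntegral_prod _ hint]
  rw [IntegrableOn, ← Measure.prod_restrict] at hint
  -- The radial integral is taken first: for fixed `θ` its phase is linear in `ρ` with slope `τ +
  -- ‖z‖ cos θ`, which is at least `|τ|/2` in size.
  rw [integral_integral_swap hint]
  have hin : ∀ θ : ℝ, ∫ ρ in Set.Ioi (0 : ℝ), ((ρ ^ n : ℝ) * H ρ) *
      (cosPhase (2 * Real.pi * ‖z‖ * ρ) θ * (Real.sin θ ^ (n - 1) : ℝ)) =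
      (Real.sin θ ^ (n - 1) : ℝ) * ∫ ρ : ℝ, ((ρ ^ n * cutoff φ δ ρ ^ 2 : ℝ) : ℂ) *
        echar ((τ + ‖z‖ * Real.cos θ) * ρ) := by
    intro θ
    rw [← integral_const_mul]
    have hpt : ∀ ρ : ℝ, ((ρ ^ n : ℝ) * H ρ) *
        (cosPhase (2 * Real.pi * ‖z‖ * ρ) θ * (Real.sin θ ^ (n - 1) : ℝ)) =
        (Real.sin θ ^ (n - 1) : ℝ) * (((ρ ^ n * cutoff φ δ ρ ^ 2 : ℝ) : ℂ) *
        echar ((τ + ‖z‖ * Real.cos θ) * ρ)) := by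
      intro ρ
      have : echar ((τ + ‖z‖ * Real.cos θ) * ρ) =
          echar (τ * ρ) * cosPhase (2 * Real.pi * ‖z‖ * ρ) θ := by
        unfold echar cosPhase
        rw [← Complex.exp_add]
        congr 1
        push_cast
        ring
      rw [this]
      simp only [H]
      push_cast
      ring
    simp_rw [hpt]
    refine setIntegral_eq_integral_of_forall_compl_eq_zero fun ρ hρ => ?_
    have : cutoff φ δ ρ = 0 := by
      by_contra hne
      have h1 := (mem_of_cutoff_ne_zero hs hδ hne).1
      exact hρ (lt_of_lt_of_le (by positivity) h1)
    simp [this]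
  have hbd : ‖∫ θ in Set.Ioo 0 Real.pi, ∫ ρ in Set.Ioi (0 : ℝ), ((ρ ^ n : ℝ) * H ρ) *
      (cosPhase (2 * Real.pi * ‖z‖ * ρ) θ * (Real.sin θ ^ (n - 1) : ℝ))‖ * (|τ| / δ) ^ M ≤
      2 ^ M * C * δ⁻¹ ^ (n + 1) * Real.pi := by
    have hM : (0 : ℝ) ≤ (|τ| / δ) ^ M := by positivity
    rw [← Real.norm_of_nonneg hM, ← Complex.norm_real, ← norm_mul, ← integral_mul_const]
    refine (norm_setIntegral_le_of_norm_le_const (C := 2 ^ M * C * δ⁻¹ ^ (n + 1))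
      (by simp) fun θ _ => ?_).trans ?_
    · rw [hin, norm_mul, norm_mul, Complex.norm_real, Complex.norm_real, Real.norm_of_nonneg hM,
        Real.norm_eq_abs, abs_pow]
      set σ := τ + ‖z‖ * Real.cos θ with hσ
      have h1 : |τ| ≤ 2 * |σ| := by
        have h2 : |‖z‖ * Real.cos θ| ≤ |τ| / 2 := by
          rw [abs_mul, abs_of_nonneg (norm_nonneg z)]
          nlinarith [Real.abs_cos_le_one θ, norm_nonneg z, abs_nonneg (Real.cos θ)]
        have h3 : |τ| ≤ |σ| + |‖z‖ * Real.cos θ| := by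
          have := abs_sub σ (‖z‖ * Real.cos θ)
          simpa [hσ] using this
        linarith
      have h4 : (|τ| / δ) ^ M ≤ 2 ^ M * (|σ| / δ) ^ M := by
        rw [← mul_pow]
        have : |τ| / δ ≤ 2 * (|σ| / δ) := by
          rw [← mul_div_assoc]; gcongr
        gcongr
      have h5 : |Real.sin θ| ^ (n - 1) ≤ 1 := pow_le_one₀ (abs_nonneg _) (Real.abs_sin_le_one θ)
      have h6 := hosc δ hδ σ
      set X := ‖∫ ρ : ℝ, ((ρ ^ n * cutoff φ δ ρ ^ 2 : ℝ) : ℂ) * echar (σ * ρ)‖ with hX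
      calc |Real.sin θ| ^ (n - 1) * X * (|τ| / δ) ^ M ≤ 1 * X * (2 ^ M * (|σ| / δ) ^ M) := by
            gcongr
        _ = 2 ^ M * (X * (|σ| / δ) ^ M) := by ring
        _ ≤ 2 ^ M * (C * δ⁻¹ ^ (n + 1)) := by gcongr
        _ = _ := by ring
    · rw [Measure.real, Real.volume_Ioo, sub_zero, ENNReal.toReal_ofReal Real.pi_pos.le]
  rw [norm_mul, Complex.norm_real, Real.norm_of_nonneg hc, mul_assoc]
  calc _ ≤ c * (2 ^ M * C * δ⁻¹ ^ (n + 1) * Real.pi) := by gcongr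
    _ ≤ (c + 1) * (2 ^ M * C * δ⁻¹ ^ (n + 1) * Real.pi) := by gcongr; linarith
    _ = _ := by ring

theorem le_abs_sub_of_two_le_floor {ℓ t t' : ℝ} (hℓ : 0 < ℓ)
    (h : 2 ≤ |⌊t / ℓ⌋ - ⌊t' / ℓ⌋|) : ℓ ≤ |t - t'| := by
  have a1 := Int.floor_le (t / ℓ)
  have a2 := Int.lt_floor_add_one (t / ℓ)
  have b1 := Int.floor_le (t' / ℓ)
  have b2 := Int.lt_floor_add_one (t' / ℓ)
  have key : 1 ≤ |t / ℓ - t' / ℓ| := by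
    rcases abs_cases (⌊t / ℓ⌋ - ⌊t' / ℓ⌋) with ⟨h1, -⟩ | ⟨h1, -⟩ <;> rw [h1] at h
    · have : (2 : ℝ) ≤ ⌊t / ℓ⌋ - ⌊t' / ℓ⌋ := by exact_mod_cast h
      exact le_trans (by linarith) (le_abs_self _)
    · have : (2 : ℝ) ≤ -((⌊t / ℓ⌋ : ℝ) - ⌊t' / ℓ⌋) := by exact_mod_cast h
      exact le_trans (by linarith) (neg_le_abs _)
  rwa [← sub_div, abs_div, abs_of_pos hℓ, le_div_iff₀ hℓ, one_mul] at key

/-- Bound for the part of the bilinear form of the kernels away from the diagonal. -/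
theorem exists_norm_sum_far_waveKernel_le {n : ℕ} (hn : 1 ≤ n) (hV : Module.finrank ℝ V = n + 1)
    (hφ : ContDiff ℝ (⊤ : ℕ∞) φ) (hs : Function.support φ ⊆ Set.Ioo (1 / 4) 4) :
    ∃ C : ℝ, 0 < C ∧ ∀ δ ℓ : ℝ, 0 < δ → δ ≤ ℓ → ∀ F : Finset ℝ, IsSep δ F →
      ∀ (c c' : ℝ → ℂ) (z : V),
      ‖∑ t ∈ F, ∑ t' ∈ F, if 2 ≤ |⌊t / ℓ⌋ - ⌊t' / ℓ⌋| then
          c t * (starRingEnd ℂ) (c' t') * waveKernel φ δ (t - t') z else 0‖ ≤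
        C * δ⁻¹ ^ (n + 1) * (ℓ / δ) ^ (-(n : ℝ) / 2) *
          (∑ t ∈ F, ‖c t‖ ^ 2 + ∑ t ∈ F, ‖c' t‖ ^ 2) := by
  obtain ⟨C₁, hC₁, hdec⟩ := exists_norm_sum_waveKernel_le_decay (V := V) hV hφ.continuous hs
  -- Of the `n + 2` powers of decay, two make the kernel summable over separated times and `n` more
  -- than cover the factor `(ℓ/δ)^{-n/2}`.
  obtain ⟨C₂, hC₂, hns⟩ := exists_norm_waveKernel_le (V := V) hn hV hφ hs (n + 2)
  obtain ⟨C₃, hC₃, hsum⟩ := exists_sum_sep_le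
  have hn0 : (0 : ℝ) ≤ n := n.cast_nonneg
  have hn2 : -(n : ℝ) / 2 ≤ 0 := by linarith
  refine ⟨4 * (C₁ * (1 / 2 : ℝ) ^ (-(n : ℝ) / 2)) + C₂ * C₃, by positivity,
    fun δ ℓ hδ hℓ F hF c c' z => ?_⟩
  have hℓ0 : 0 < ℓ := hδ.trans_le hℓ
  have hd : 0 < δ⁻¹ := inv_pos.2 hδ
  set Sc := ∑ t ∈ F, ‖c t‖ ^ 2 + ∑ t ∈ F, ‖c' t‖ ^ 2 with hSc
  have hSc0 : 0 ≤ Sc := by positivity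
  have hr1 : 1 ≤ ℓ / δ := (one_le_div hδ).2 hℓ
  -- Far pairs satisfy `|t - t'| ≥ ℓ`. For `‖z‖ ≤ ℓ/2` every one of them lies well inside the light
  -- cone, and entrywise decay with Schur's test suffices. For larger `‖z‖` the spatial decay of the
  -- complete form has the right size, and the near blocks are removed from it.
  rcases le_or_gt ‖z‖ (ℓ / 2) with hz | hz
  · have hentry : ∀ t t' : ℝ, ‖if 2 ≤ |⌊t / ℓ⌋ - ⌊t' / ℓ⌋| then
        c t * (starRingEnd ℂ) (c' t') * waveKernel φ δ (t - t') z else 0‖ ≤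
        ‖c t‖ * ‖c' t'‖ * (2 * C₂ * δ⁻¹ ^ (n + 1) * (ℓ / δ) ^ (-(n : ℝ) / 2) *
          (1 + ((t - t') / δ) ^ 2)⁻¹) := by
      intro t t'
      split_ifs with hfar
      · rw [norm_mul, norm_mul, RCLike.norm_conj]
        gcongr
        have h1 := le_abs_sub_of_two_le_floor hℓ0 hfar
        have h2 := hns δ hδ (t - t') z (hz.trans (by linarith))
        set x := |t - t'| / δ with hx
        have hx1 : ℓ / δ ≤ x := by rw [hx]; gcongr
        have hx0 : 0 < x := by linarith
        have e1 : ((t - t') / δ) ^ 2 = x ^ 2 := by rw [hx, div_pow, div_pow, sq_abs]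
        have h3 : x ^ (n + 2) = x ^ n * x ^ 2 := pow_add _ _ _
        have h4 : (ℓ / δ) ^ ((n : ℝ) / 2) ≤ x ^ n := by
          calc (ℓ / δ) ^ ((n : ℝ) / 2) ≤ (ℓ / δ) ^ (n : ℝ) :=
                Real.rpow_le_rpow_of_exponent_le hr1 (by linarith)
            _ = (ℓ / δ) ^ n := Real.rpow_natCast _ _
            _ ≤ x ^ n := by gcongr
        have e2 : (ℓ / δ) ^ (-(n : ℝ) / 2) = ((ℓ / δ) ^ ((n : ℝ) / 2))⁻¹ := by
          rw [← Real.rpow_neg (by positivity), neg_div]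
        have h5 : 1 + x ^ 2 ≤ 2 * x ^ 2 := by nlinarith
        rw [e1, e2, ← div_eq_mul_inv, ← div_eq_mul_inv, le_div_iff₀ (by positivity),
          le_div_iff₀ (by positivity)]
        calc ‖waveKernel φ δ (t - t') z‖ * (1 + x ^ 2) * (ℓ / δ) ^ ((n : ℝ) / 2)
            ≤ ‖waveKernel φ δ (t - t') z‖ * (2 * x ^ 2) * x ^ n := by gcongr
          _ = 2 * (‖waveKernel φ δ (t - t') z‖ * x ^ (n + 2)) := by rw [h3]; ring
          _ ≤ 2 * (C₂ * δ⁻¹ ^ (n + 1)) := by gcongr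
          _ = _ := by ring
      · rw [norm_zero]; positivity
    have hS := schur_sum_le F (fun t t' => 2 * C₂ * δ⁻¹ ^ (n + 1) * (ℓ / δ) ^ (-(n : ℝ) / 2) *
          (1 + ((t - t') / δ) ^ 2)⁻¹) (fun t => ‖c t‖) (fun t => ‖c' t‖)
          (C := 2 * C₂ * δ⁻¹ ^ (n + 1) * (ℓ / δ) ^ (-(n : ℝ) / 2) * C₃)
          (fun t t' => by positivity) (fun t _ => by
            rw [← Finset.mul_sum]
            gcongr
            exact hsum δ hδ F hF t) (fun t' _ => by
            rw [← Finset.mul_sum]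
            gcongr
            refine le_trans (le_of_eq ?_) (hsum δ hδ F hF t')
            refine Finset.sum_congr rfl fun t _ => ?_
            rw [← neg_sub, neg_div, neg_sq])
    refine (norm_sum_le_of_le _ fun t _ => norm_sum_le_of_le _ fun t' _ => hentry t t').trans
      (hS.trans ?_)
    rw [← hSc]
    have h7 : 0 ≤ 4 * (C₁ * (1 / 2 : ℝ) ^ (-(n : ℝ) / 2)) * δ⁻¹ ^ (n + 1) *
      (ℓ / δ) ^ (-(n : ℝ) / 2) * Sc := by positivity
    nlinarith
  · have hz0 : z ≠ 0 := norm_pos_iff.1 (lt_trans (by positivity) hz)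
    have h1 := norm_sum_far_le F (fun t => ⌊t / ℓ⌋)
      (fun t t' => c t * (starRingEnd ℂ) (c' t') * waveKernel φ δ (t - t') z)
      (fun t => ‖c t‖ ^ 2) (fun t => ‖c' t‖ ^ 2) (fun t => by positivity)
      (B := C₁ * δ⁻¹ ^ (n + 1) * (‖z‖ / δ) ^ (-(n : ℝ) / 2)) (by positivity)
      (fun S hS S' hS' => hdec δ hδ S S' (hF.mono (by exact_mod_cast hS))
        (hF.mono (by exact_mod_cast hS')) c c' z hz0)
    refine h1.trans ?_
    rw [← hSc]
    have h2 : (‖z‖ / δ) ^ (-(n : ℝ) / 2) ≤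
        (1 / 2 : ℝ) ^ (-(n : ℝ) / 2) * (ℓ / δ) ^ (-(n : ℝ) / 2) := by
      rw [← Real.mul_rpow (by positivity) (by positivity)]
      refine Real.rpow_le_rpow_of_nonpos (by positivity) ?_ hn2
      rw [← mul_div_assoc]
      gcongr
      linarith
    have h3 : 0 ≤ C₂ * C₃ * δ⁻¹ ^ (n + 1) * (ℓ / δ) ^ (-(n : ℝ) / 2) * Sc := by positivity
    calc _ ≤ 4 * (C₁ * δ⁻¹ ^ (n + 1) *
          ((1 / 2 : ℝ) ^ (-(n : ℝ) / 2) * (ℓ / δ) ^ (-(n : ℝ) / 2))) * Sc := by gcongr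
      _ ≤ _ := by nlinarith

end NonStationary

/-! ### The `TT*` estimate. -/

section TTStar

variable {V : Type*} [NormedAddCommGroup V] [InnerProductSpace ℝ V] [FiniteDimensional ℝ V]
  [MeasurableSpace V] [BorelSpace V] {φ : ℝ → ℝ}

theorem fourier_eq_integral_echar (g : V → ℂ) (ξ : V) :
    𝓕 g ξ = ∫ x, echar (-inner ℝ x ξ) * g x := by
  rw [Real.fourier_eq']
  congr 1
  funext x
  rw [smul_eq_mul]
  congr 2
  push_cast
  ring

theorem fourierInv_eq_integral_echar (g : V → ℂ) (x : V) :
    𝓕⁻ g x = ∫ ξ, echar (inner ℝ ξ x) * g ξ := by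
  rw [Real.fourierInv_eq']
  congr 1
  funext x
  rw [smul_eq_mul]
  congr 2
  push_cast
  ring

theorem conj_echar (x : ℝ) : (starRingEnd ℂ) (echar x) = echar (-x) := by
  unfold echar
  rw [← Complex.exp_conj]
  simp only [map_mul, Complex.conj_I, Complex.conj_ofReal, map_ofNat]
  push_cast
  ring_nf

theorem echar_add (x y : ℝ) : echar (x + y) = echar x * echar y := by
  unfold echar
  rw [← Complex.exp_add]
  push_cast
  ring_nf

theorem conj_fourier_eq (g : V → ℂ) (ξ : V) :
    (starRingEnd ℂ) (𝓕 g ξ) = ∫ y, echar (inner ℝ y ξ) * (starRingEnd ℂ) (g y) := by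
  rw [fourier_eq_integral_echar, ← integral_conj]
  congr 1
  funext y
  rw [map_mul, conj_echar, neg_neg]

/-- Absolute convergence in `(x, y, ξ)` jointly, which justifies Fubini between the frequency and
the space form of the pairing. -/
theorem integrable_kernel_triple (hφ : Continuous φ) (hs : Function.support φ ⊆ Set.Ioo (1 / 4) 4)
    {δ : ℝ} (hδ : 0 < δ) {g g' : V → ℂ} (hg : Integrable g) (hg' : Integrable g') (τ : ℝ) :
    Integrable (fun q : (V × V) × V =>
      echar (-inner ℝ (q.1.1 - q.1.2) q.2) *
        ((g q.1.1 * (starRingEnd ℂ) (g' q.1.2)) *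
          (((cutoff φ δ ‖q.2‖ ^ 2 : ℝ) : ℂ) * echar (τ * ‖q.2‖))))
      ((volume.prod volume).prod volume) := by
  have hcut := continuous_cutoff hφ δ
  have h1 : Integrable fun ξ : V => ((cutoff φ δ ‖ξ‖ ^ 2 : ℝ) : ℂ) * echar (τ * ‖ξ‖) := by
    refine integrable_of_continuous_of_zero (M := δ⁻¹) (by fun_prop) fun ξ hξ => ?_
    rw [cutoff_eq_zero hs hδ (by rwa [abs_of_nonneg (norm_nonneg _)])]
    simp
  have hg'' : Integrable fun y => (starRingEnd ℂ) (g' y) := by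
    refine (hg'.norm).mono' (Complex.continuous_conj.comp_aestronglyMeasurable hg'.1)
      (Filter.Eventually.of_forall fun y => by simp)
  refine ((hg.mul_prod hg'').mul_prod h1).bdd_mul (c := 1) ?_
    (Filter.Eventually.of_forall fun q => (norm_echar _).le)
  exact Continuous.aestronglyMeasurable (by fun_prop)

theorem integrable_mul_waveKernel (hφ : Continuous φ)
    (hs : Function.support φ ⊆ Set.Ioo (1 / 4) 4) {δ : ℝ} (hδ : 0 < δ) {g g' : V → ℂ}
    (hg : Integrable g) (hg' : Integrable g') (τ : ℝ) :
    Integrable (fun p : V × V =>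
      g p.1 * (starRingEnd ℂ) (g' p.2) * waveKernel φ δ τ (p.1 - p.2))
      (volume.prod volume) := by
  refine (integrable_kernel_triple hφ hs hδ hg hg' τ).integral_prod_left.congr
    (Filter.Eventually.of_forall fun p => ?_)
  simp only
  rw [waveKernel, ← integral_const_mul]
  congr 1
  funext ξ
  ring

/-- Frequency-side and space-side expressions of the localized wave pairing. -/
theorem integral_fourier_mul_conj_eq (hφ : Continuous φ)
    (hs : Function.support φ ⊆ Set.Ioo (1 / 4) 4) {δ : ℝ} (hδ : 0 < δ) {g g' : V → ℂ}
    (hg : Integrable g) (hg' : Integrable g') (τ : ℝ) :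
    ∫ ξ : V, (((cutoff φ δ ‖ξ‖ ^ 2 : ℝ) : ℂ) * echar (τ * ‖ξ‖)) *
        (𝓕 g ξ * (starRingEnd ℂ) (𝓕 g' ξ)) =
      ∫ p : V × V, g p.1 * (starRingEnd ℂ) (g' p.2) * waveKernel φ δ τ (p.1 - p.2)
        ∂(volume.prod volume) := by
  have hint := integrable_kernel_triple hφ hs hδ hg hg' τ
  have h1 : ∀ ξ : V, (((cutoff φ δ ‖ξ‖ ^ 2 : ℝ) : ℂ) * echar (τ * ‖ξ‖)) *
        (𝓕 g ξ * (starRingEnd ℂ) (𝓕 g' ξ)) = ∫ p : V × V, echar (-inner ℝ (p.1 - p.2) ξ) *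
        ((g p.1 * (starRingEnd ℂ) (g' p.2)) *
          (((cutoff φ δ ‖ξ‖ ^ 2 : ℝ) : ℂ) * echar (τ * ‖ξ‖))) ∂(volume.prod volume) := by
    intro ξ
    rw [conj_fourier_eq, fourier_eq_integral_echar, ← integral_prod_mul, ← integral_const_mul]
    congr 1
    funext p
    have : echar (-inner ℝ (p.1 - p.2) ξ) = echar (-inner ℝ p.1 ξ) * echar (inner ℝ p.2 ξ) := by
      rw [← echar_add, inner_sub_left]
      congr 1
      ring
    rw [this]
    ring
  simp_rw [h1]
  rw [← integral_integral_swap hint]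
  congr 1
  funext p
  rw [waveKernel, ← integral_const_mul]
  congr 1
  funext ξ
  ring

/-- The summand of the dual operator at time `t`. -/
def dualTerm (φ : ℝ → ℝ) (δ : ℝ) (g : ℝ → V → ℂ) (t : ℝ) (ξ : V) : ℂ :=
  (cutoff φ δ ‖ξ‖ : ℂ) * echar (t * ‖ξ‖) * 𝓕 (g t) ξ

theorem continuous_dualTerm (hφ : Continuous φ) (δ : ℝ) {g : ℝ → V → ℂ} {t : ℝ}
    (hg : Integrable (g t)) : Continuous (dualTerm φ δ g t) := by
  have h1 := continuous_cutoff hφ δ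
  have h2 := continuous_fourier_of_integrable hg
  unfold dualTerm
  fun_prop

theorem dualTerm_eq_zero (hs : Function.support φ ⊆ Set.Ioo (1 / 4) 4) {δ : ℝ}
    (hδ : 0 < δ) (g : ℝ → V → ℂ) (t : ℝ) {ξ : V} (h : δ⁻¹ < ‖ξ‖) : dualTerm φ δ g t ξ = 0 := by
  unfold dualTerm
  rw [cutoff_eq_zero hs hδ (by rwa [abs_of_nonneg (norm_nonneg _)])]
  simp

theorem norm_dualTerm_sq_le {Φ : ℝ} (hb : ∀ x, |φ x| ≤ Φ) (δ : ℝ) (g : ℝ → V → ℂ) (t : ℝ)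
    (ξ : V) : ‖dualTerm φ δ g t ξ‖ ^ 2 ≤ Φ ^ 2 * ‖𝓕 (g t) ξ‖ ^ 2 := by
  unfold dualTerm
  rw [norm_mul, norm_mul, norm_echar, mul_one, Complex.norm_real, mul_pow]
  gcongr
  exact hb _

/-- The entries of the `TT*` matrix: the two time phases combine to depend on `t - t'` only, and the
two cutoffs give the square in `waveKernel`. -/
theorem integral_dualTerm_mul_conj (hφ : Continuous φ)
    (hs : Function.support φ ⊆ Set.Ioo (1 / 4) 4) {δ : ℝ} (hδ : 0 < δ) {g : ℝ → V → ℂ} {t t' : ℝ}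
    (hg : Integrable (g t)) (hg' : Integrable (g t')) :
    ∫ ξ : V, dualTerm φ δ g t ξ * (starRingEnd ℂ) (dualTerm φ δ g t' ξ) =
      ∫ p : V × V, g t p.1 * (starRingEnd ℂ) (g t' p.2) * waveKernel φ δ (t - t') (p.1 - p.2)
        ∂(volume.prod volume) := by
  rw [← integral_fourier_mul_conj_eq hφ hs hδ hg hg']
  congr 1
  funext ξ
  unfold dualTerm
  rw [map_mul, map_mul, conj_echar, Complex.conj_ofReal,
    show (t - t') * ‖ξ‖ = t * ‖ξ‖ + -(t' * ‖ξ‖) by ring, echar_add]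
  push_cast
  ring

/-- The off-diagonal part of the `TT*` form. -/
theorem norm_integral_dualTerm_far_le (hφ : Continuous φ)
    (hs : Function.support φ ⊆ Set.Ioo (1 / 4) 4) {δ : ℝ} (hδ : 0 < δ) (F : Finset ℝ)
    {g : ℝ → V → ℂ} (hg : ∀ t ∈ F, Integrable (g t)) {A : Set V} (hA : MeasurableSet A)
    (hAf : volume A ≠ ∞) (hgA : ∀ x, ∑ t ∈ F, ‖g t x‖ ^ 2 ≤ A.indicator 1 x)
    (R : ℝ → ℝ → Prop) [DecidableRel R] {B : ℝ}
    (hR : ∀ (c c' : ℝ → ℂ) (z : V), ‖∑ t ∈ F, ∑ t' ∈ F, if R t t' then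
      c t * (starRingEnd ℂ) (c' t') * waveKernel φ δ (t - t') z else 0‖ ≤
        B * (∑ t ∈ F, ‖c t‖ ^ 2 + ∑ t ∈ F, ‖c' t‖ ^ 2)) (hB : 0 ≤ B) :
    ‖∫ ξ : V, ∑ t ∈ F, ∑ t' ∈ F, if R t t' then
      dualTerm φ δ g t ξ * (starRingEnd ℂ) (dualTerm φ δ g t' ξ) else 0‖ ≤
      2 * B * volume.real A ^ 2 := by
  have hd : ∀ t ∈ F, ∀ t' ∈ F, Integrable fun ξ : V =>
      if R t t' then dualTerm φ δ g t ξ * (starRingEnd ℂ) (dualTerm φ δ g t' ξ) else 0 := by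
    intro t ht t' ht'
    split_ifs
    · have h1 := continuous_dualTerm hφ δ (hg t ht)
      have h2 := Complex.continuous_conj.comp (continuous_dualTerm hφ δ (hg t' ht'))
      refine integrable_of_continuous_of_zero (M := δ⁻¹) (h1.mul h2) fun ξ hξ => ?_
      rw [dualTerm_eq_zero hs hδ _ _ hξ, zero_mul]
    · exact integrable_zero _ _ _
  have hk : ∀ t ∈ F, ∀ t' ∈ F, Integrable (fun p : V × V => if R t t' then
      g t p.1 * (starRingEnd ℂ) (g t' p.2) * waveKernel φ δ (t - t') (p.1 - p.2) else 0)
      (volume.prod volume) := by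
    intro t ht t' ht'
    split_ifs
    · exact integrable_mul_waveKernel hφ hs hδ (hg t ht) (hg t' ht') _
    · exact integrable_zero _ _ _
  have e : ∫ ξ : V, ∑ t ∈ F, ∑ t' ∈ F, (if R t t' then
      dualTerm φ δ g t ξ * (starRingEnd ℂ) (dualTerm φ δ g t' ξ) else 0) =
      ∫ p : V × V, ∑ t ∈ F, ∑ t' ∈ F, (if R t t' then
      g t p.1 * (starRingEnd ℂ) (g t' p.2) * waveKernel φ δ (t - t') (p.1 - p.2) else 0)
      ∂(volume.prod volume) := by
    rw [integral_finsetSum _ fun t ht => integrable_finsetSum _ fun t' ht' => hd t ht t' ht',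
      integral_finsetSum _ fun t ht => integrable_finsetSum _ fun t' ht' => hk t ht t' ht']
    refine Finset.sum_congr rfl fun t ht => ?_
    rw [integral_finsetSum _ fun t' ht' => hd t ht t' ht',
      integral_finsetSum _ fun t' ht' => hk t ht t' ht']
    refine Finset.sum_congr rfl fun t' ht' => ?_
    split_ifs
    · exact integral_dualTerm_mul_conj hφ hs hδ (hg t ht) (hg t' ht')
    · simp
  rw [e]
  have hind : Integrable (A.indicator (1 : V → ℝ)) :=
    (integrable_indicator_iff hA).2 (integrableOn_const hAf)
  have hprod := (hind.mul_prod hind).const_mul (2 * B)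
  refine (norm_integral_le_of_norm_le hprod (Filter.Eventually.of_forall fun p => ?_)).trans ?_
  · by_cases h1 : p.1 ∈ A
    · by_cases h2 : p.2 ∈ A
      -- At each pair of points the values of `g` are the coefficients of the form. Both `ℓ²` sums
      -- are at most 1, which gives `2B` on `A × A`.
      · refine (hR (fun t => g t p.1) (fun t => g t p.2) (p.1 - p.2)).trans ?_
        have q1 := hgA p.1
        have q2 := hgA p.2
        rw [Set.indicator_of_mem h1] at q1 ⊢
        rw [Set.indicator_of_mem h2] at q2 ⊢
        simp only [Pi.one_apply] at q1 q2 ⊢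
        nlinarith
      · have q2 := hgA p.2
        rw [Set.indicator_of_notMem h2] at q2
        have h0 : ∀ t ∈ F, g t p.2 = 0 := by
          intro t ht
          have := (Finset.sum_eq_zero_iff_of_nonneg fun t _ => by positivity).1
            (le_antisymm q2 (by positivity)) t ht
          simpa using this
        rw [Finset.sum_eq_zero fun t _ => Finset.sum_eq_zero fun t' ht' => by simp [h0 t' ht']]
        simp [h2]
    · have q1 := hgA p.1
      rw [Set.indicator_of_notMem h1] at q1
      have h0 : ∀ t ∈ F, g t p.1 = 0 := by
        intro t ht
        have := (Finset.sum_eq_zero_iff_of_nonneg fun t _ => by positivity).1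
          (le_antisymm q1 (by positivity)) t ht
        simpa using this
      rw [Finset.sum_eq_zero fun t ht => Finset.sum_eq_zero fun t' _ => by simp [h0 t ht]]
      simp [h1]
  · rw [integral_const_mul, integral_prod_mul, integral_indicator_one hA, sq]

/-- The near-diagonal part of the `TT*` form. -/
theorem integral_dualTerm_near_le (hφ : Continuous φ)
    {Φ : ℝ} (hb : ∀ x, |φ x| ≤ Φ) {δ : ℝ} (F : Finset ℝ)
    {g : ℝ → V → ℂ} (hg : ∀ t ∈ F, Integrable (g t)) (hg2 : ∀ t ∈ F, MemLp (g t) 2)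
    {A : Set V} (hA : MeasurableSet A)
    (hAf : volume A ≠ ∞) (hgA : ∀ x, ∑ t ∈ F, ‖g t x‖ ^ 2 ≤ A.indicator 1 x) :
    Integrable (fun ξ => ∑ t ∈ F, ‖dualTerm φ δ g t ξ‖ ^ 2) ∧
    ∫ ξ : V, ∑ t ∈ F, ‖dualTerm φ δ g t ξ‖ ^ 2 ≤ Φ ^ 2 * volume.real A := by
  have hsq : ∀ t ∈ F, Integrable fun ξ => ‖𝓕 (g t) ξ‖ ^ 2 := fun t ht =>
    (memLp_fourier (hg t ht) (hg2 t ht)).integrable_norm_pow (by norm_num)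
  have hsq' : ∀ t ∈ F, Integrable fun x => ‖g t x‖ ^ 2 := fun t ht =>
    (hg2 t ht).integrable_norm_pow (by norm_num)
  have hsum : Integrable fun ξ => ∑ t ∈ F, Φ ^ 2 * ‖𝓕 (g t) ξ‖ ^ 2 :=
    integrable_finsetSum _ fun t ht => (hsq t ht).const_mul _
  have hle : ∀ ξ, ∑ t ∈ F, ‖dualTerm φ δ g t ξ‖ ^ 2 ≤ ∑ t ∈ F, Φ ^ 2 * ‖𝓕 (g t) ξ‖ ^ 2 :=
    fun ξ => Finset.sum_le_sum fun t _ => norm_dualTerm_sq_le hb δ g t ξ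
  have hint : Integrable (fun ξ => ∑ t ∈ F, ‖dualTerm φ δ g t ξ‖ ^ 2) := by
    refine hsum.mono' ?_ (Filter.Eventually.of_forall fun ξ => ?_)
    · refine Continuous.aestronglyMeasurable (continuous_finsetSum _ fun t ht => ?_)
      exact (continuous_dualTerm hφ δ (hg t ht)).norm.pow 2
    · rw [Real.norm_of_nonneg (by positivity)]
      exact hle ξ
  refine ⟨hint, (integral_mono hint hsum hle).trans ?_⟩
  rw [integral_finsetSum _ fun t ht => (hsq t ht).const_mul _]
  have hind : Integrable (A.indicator (1 : V → ℝ)) :=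
    (integrable_indicator_iff hA).2 (integrableOn_const hAf)
  calc ∑ t ∈ F, ∫ ξ, Φ ^ 2 * ‖𝓕 (g t) ξ‖ ^ 2 = Φ ^ 2 * ∑ t ∈ F, ∫ x, ‖g t x‖ ^ 2 := by
        rw [Finset.mul_sum]
        refine Finset.sum_congr rfl fun t ht => ?_
        rw [integral_const_mul, integral_norm_sq_fourier (hg t ht) (hg2 t ht)]
    _ = Φ ^ 2 * ∫ x, ∑ t ∈ F, ‖g t x‖ ^ 2 := by rw [integral_finsetSum _ hsq']
    _ ≤ Φ ^ 2 * ∫ x, A.indicator 1 x := by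
        exact mul_le_mul_of_nonneg_left
          (integral_mono (integrable_finsetSum _ hsq') hind hgA) (sq_nonneg _)
    _ = _ := by rw [integral_indicator_one hA]

/-- `TT*` bound: near-diagonal terms by Plancherel, the others by the kernel bound. -/
theorem integral_norm_sum_dualTerm_sq_le (hφ : Continuous φ)
    (hs : Function.support φ ⊆ Set.Ioo (1 / 4) 4) {Φ : ℝ} (hb : ∀ x, |φ x| ≤ Φ)
    {δ : ℝ} (hδ : 0 < δ) (F : Finset ℝ)
    {g : ℝ → V → ℂ} (hg : ∀ t ∈ F, Integrable (g t)) (hg2 : ∀ t ∈ F, MemLp (g t) 2)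
    {A : Set V} (hA : MeasurableSet A)
    (hAf : volume A ≠ ∞) (hgA : ∀ x, ∑ t ∈ F, ‖g t x‖ ^ 2 ≤ A.indicator 1 x)
    (R : ℝ → ℝ → Prop) [DecidableRel R] (hsymm : ∀ t t', R t t' → R t' t) {B N : ℝ}
    (hN : ∀ t ∈ F, (({t' ∈ F | ¬ R t t'} : Finset ℝ).card : ℝ) ≤ N) (hN0 : 0 ≤ N)
    (hR : ∀ (c c' : ℝ → ℂ) (z : V), ‖∑ t ∈ F, ∑ t' ∈ F, if R t t' then
      c t * (starRingEnd ℂ) (c' t') * waveKernel φ δ (t - t') z else 0‖ ≤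
        B * (∑ t ∈ F, ‖c t‖ ^ 2 + ∑ t ∈ F, ‖c' t‖ ^ 2)) (hB : 0 ≤ B) :
    ∫ ξ : V, ‖∑ t ∈ F, dualTerm φ δ g t ξ‖ ^ 2 ≤
      N * (Φ ^ 2 * volume.real A) + 2 * B * volume.real A ^ 2 := by
  have hnear := integral_dualTerm_near_le (δ := δ) hφ hb F hg hg2 hA hAf hgA
  have hfar := norm_integral_dualTerm_far_le hφ hs hδ F hg hA hAf hgA R hR hB
  set far : V → ℂ := fun ξ => ∑ t ∈ F, ∑ t' ∈ F, if R t t' then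
      dualTerm φ δ g t ξ * (starRingEnd ℂ) (dualTerm φ δ g t' ξ) else 0 with hfardef
  have hcont : ∀ t ∈ F, Continuous (dualTerm φ δ g t) := fun t ht =>
    continuous_dualTerm hφ δ (hg t ht)
  have hfarc : Continuous far := by
    refine continuous_finsetSum _ fun t ht => continuous_finsetSum _ fun t' ht' => ?_
    split_ifs
    · exact (hcont t ht).mul (Complex.continuous_conj.comp (hcont t' ht'))
    · exact continuous_const
  have hfari : Integrable far := by
    refine integrable_of_continuous_of_zero (M := δ⁻¹) hfarc fun ξ hξ => ?_
    refine Finset.sum_eq_zero fun t _ => Finset.sum_eq_zero fun t' _ => ?_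
    rw [dualTerm_eq_zero hs hδ _ _ hξ]
    simp
  have hpt : ∀ ξ, ‖∑ t ∈ F, dualTerm φ δ g t ξ‖ ^ 2 ≤
      N * ∑ t ∈ F, ‖dualTerm φ δ g t ξ‖ ^ 2 + (far ξ).re := by
    intro ξ
    have e1 : ((‖∑ t ∈ F, dualTerm φ δ g t ξ‖ ^ 2 : ℝ) : ℂ) = ∑ t ∈ F, ∑ t' ∈ F,
        dualTerm φ δ g t ξ * (starRingEnd ℂ) (dualTerm φ δ g t' ξ) := by
      rw [← Complex.normSq_eq_norm_sq, ← Complex.mul_conj, map_sum, Finset.sum_mul_sum]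
    have e2 : ((‖∑ t ∈ F, dualTerm φ δ g t ξ‖ ^ 2 : ℝ) : ℂ) - far ξ = ∑ t ∈ F, ∑ t' ∈ F,
        if ¬ R t t' then dualTerm φ δ g t ξ * (starRingEnd ℂ) (dualTerm φ δ g t' ξ) else 0 := by
      rw [e1, hfardef]
      simp only [← Finset.sum_sub_distrib]
      refine Finset.sum_congr rfl fun t _ => Finset.sum_congr rfl fun t' _ => ?_
      by_cases h : R t t' <;> simp [h]
    have e3 : ‖((‖∑ t ∈ F, dualTerm φ δ g t ξ‖ ^ 2 : ℝ) : ℂ) - far ξ‖ ≤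
        ∑ t ∈ F, ∑ t' ∈ F, ‖dualTerm φ δ g t ξ‖ * ‖dualTerm φ δ g t' ξ‖ *
          (if ¬ R t t' then 1 else 0) := by
      rw [e2]
      refine norm_sum_le_of_le _ fun t _ => norm_sum_le_of_le _ fun t' _ => ?_
      split_ifs <;> simp
    -- The near pairs form a symmetric 0-1 matrix with row sums at most `N`, so Schur's test reduces
    -- them to `N` times the diagonal.
    have e4 := schur_sum_le F (fun t t' => if ¬ R t t' then (1 : ℝ) else 0)
      (fun t => ‖dualTerm φ δ g t ξ‖) (fun t => ‖dualTerm φ δ g t ξ‖) (C := N)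
      (fun t t' => by split_ifs <;> norm_num)
      (fun t ht => by
        rw [← Finset.sum_filter, Finset.sum_const, nsmul_eq_mul, mul_one]
        exact hN t ht)
      (fun t' ht' => by
        rw [← Finset.sum_filter, Finset.sum_const, nsmul_eq_mul, mul_one]
        refine le_trans (le_of_eq ?_) (hN t' ht')
        congr 2
        refine Finset.filter_congr fun t _ => ?_
        exact not_congr ⟨hsymm _ _, hsymm _ _⟩)
    have e5 := (Complex.re_le_norm _).trans (e3.trans e4)
    rw [Complex.sub_re, Complex.ofReal_re] at e5
    linarith
  have hsqi : Integrable fun ξ => ‖∑ t ∈ F, dualTerm φ δ g t ξ‖ ^ 2 := by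
    have : Integrable fun ξ => ((‖∑ t ∈ F, dualTerm φ δ g t ξ‖ ^ 2 : ℝ) : ℂ) := by
      refine integrable_of_continuous_of_zero (M := δ⁻¹) ?_ fun ξ hξ => ?_
      · exact Complex.continuous_ofReal.comp
          ((continuous_finsetSum _ fun t ht => hcont t ht).norm.pow 2)
      · rw [Finset.sum_eq_zero fun t _ => dualTerm_eq_zero hs hδ _ _ hξ]
        simp
    simpa only [RCLike.re_to_complex, Complex.ofReal_re] using this.re
  have hfarre : Integrable fun ξ => (far ξ).re := hfari.re
  have hre : ∫ ξ, (far ξ).re = (∫ ξ, far ξ).re := integral_re hfari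
  calc ∫ ξ : V, ‖∑ t ∈ F, dualTerm φ δ g t ξ‖ ^ 2
      ≤ ∫ ξ, (N * ∑ t ∈ F, ‖dualTerm φ δ g t ξ‖ ^ 2 + (far ξ).re) :=
        integral_mono hsqi ((hnear.1.const_mul N).add hfarre) hpt
    _ = N * (∫ ξ, ∑ t ∈ F, ‖dualTerm φ δ g t ξ‖ ^ 2) + (∫ ξ, far ξ).re := by
        rw [integral_add (hnear.1.const_mul N) hfarre, integral_const_mul, hre]
    _ ≤ _ := by
        have := (Complex.re_le_norm _).trans hfar
        have h2 := mul_le_mul_of_nonneg_left hnear.2 hN0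
        linarith

end TTStar

/-! ### The localized wave: energy bound, Bernstein bound, duality. -/

section WaveBasic

theorem norm_integral_mul_sq_le {X : Type*} [MeasurableSpace X] {μ : Measure X} {f g : X → ℂ}
    (hf : MemLp f 2 μ) (hg : MemLp g 2 μ) :
    ‖∫ x, f x * g x ∂μ‖ ^ 2 ≤ (∫ x, ‖f x‖ ^ 2 ∂μ) * ∫ x, ‖g x‖ ^ 2 ∂μ := by
  have h := integral_mul_norm_le_Lp_mul_Lq (μ := μ) (f := f) (g := g) (p := 2) (q := 2)
    Real.HolderConjugate.two_two (by simpa using hf) (by simpa using hg)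
  have h1 : ‖∫ x, f x * g x ∂μ‖ ≤ ∫ x, ‖f x‖ * ‖g x‖ ∂μ := by
    refine (norm_integral_le_integral_norm _).trans (le_of_eq ?_)
    simp only [norm_mul]
  have e : ∀ {F : X → ℂ}, 0 ≤ ∫ x, ‖F x‖ ^ (2 : ℝ) ∂μ := fun {F} =>
    integral_nonneg fun x => by positivity
  calc _ ≤ ((∫ x, ‖f x‖ ^ (2 : ℝ) ∂μ) ^ (1 / 2 : ℝ) *
        (∫ x, ‖g x‖ ^ (2 : ℝ) ∂μ) ^ (1 / 2 : ℝ)) ^ 2 := by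
        gcongr
        exact h1.trans h
    _ = _ := by
        rw [mul_pow, ← Real.sqrt_eq_rpow, ← Real.sqrt_eq_rpow, Real.sq_sqrt e, Real.sq_sqrt e]
        simp only [Real.rpow_two]

variable {d : ℕ} {φ : ℝ → ℝ}

/-- The dyadic scale `2^{-j}`. -/
abbrev scale (j : ℕ) : ℝ := (2 : ℝ) ^ (-(j : ℝ))

theorem scale_pos (j : ℕ) : 0 < scale j := Real.rpow_pos_of_pos two_pos _

theorem waveSymbol_eq (φ : ℝ → ℝ) (j : ℕ) (t : ℝ) (ξ : EuclideanSpace ℝ (Fin d)) :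
    waveSymbol φ j t ξ = echar (-(t * ‖ξ‖)) * (cutoff φ (scale j) ‖ξ‖ : ℂ) := by
  unfold waveSymbol echar cutoff
  congr 2
  push_cast
  ring

theorem norm_waveSymbol (φ : ℝ → ℝ) (j : ℕ) (t : ℝ) (ξ : EuclideanSpace ℝ (Fin d)) :
    ‖waveSymbol φ j t ξ‖ = |cutoff φ (scale j) ‖ξ‖| := by
  rw [waveSymbol_eq, norm_mul, norm_echar, one_mul, Complex.norm_real, Real.norm_eq_abs]

theorem continuous_waveSymbol (hφ : Continuous φ) (j : ℕ) (t : ℝ) :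
    Continuous (waveSymbol φ j t : EuclideanSpace ℝ (Fin d) → ℂ) := by
  unfold waveSymbol
  fun_prop

theorem memLp_waveSymbol (hφ : Continuous φ) (hs : Function.support φ ⊆ Set.Ioo (1 / 4) 4)
    (j : ℕ) (t : ℝ) (p : ℝ≥0∞) :
    MemLp (waveSymbol φ j t : EuclideanSpace ℝ (Fin d) → ℂ) p := by
  refine (continuous_waveSymbol hφ j t).memLp_of_hasCompactSupport ?_
  refine HasCompactSupport.of_support_subset_isCompact
    (isCompact_closedBall 0 (scale j)⁻¹) fun x hx => ?_
  rw [mem_closedBall_zero_iff]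
  by_contra h
  refine hx ?_
  rw [waveSymbol_eq, cutoff_eq_zero hs (scale_pos j)
    (by rw [abs_of_nonneg (norm_nonneg _)]; exact not_le.1 h)]
  simp

theorem integral_norm_sq_fourier_Lp (f : Lp ℂ 2 (volume : Measure (EuclideanSpace ℝ (Fin d)))) :
    ∫ ξ, ‖(𝓕 f : Lp ℂ 2 (volume : Measure (EuclideanSpace ℝ (Fin d)))) ξ‖ ^ 2 = ‖f‖ ^ 2 := by
  rw [integral_norm_sq_eq_toReal (Lp.memLp _), ← Lp.norm_def, Lp.norm_fourier_eq]

/-- The frequency side of the localized wave. -/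
def waveFreq (φ : ℝ → ℝ) (j : ℕ) (t : ℝ)
    (f : Lp ℂ 2 (volume : Measure (EuclideanSpace ℝ (Fin d)))) (ξ : EuclideanSpace ℝ (Fin d)) :
    ℂ :=
  waveSymbol φ j t ξ * (𝓕 f : Lp ℂ 2 (volume : Measure (EuclideanSpace ℝ (Fin d)))) ξ

theorem wave_eq (φ : ℝ → ℝ) (j : ℕ) (t : ℝ)
    (f : Lp ℂ 2 (volume : Measure (EuclideanSpace ℝ (Fin d)))) :
    wave φ j t f = 𝓕⁻ (waveFreq φ j t f) := rfl

variable (f : Lp ℂ 2 (volume : Measure (EuclideanSpace ℝ (Fin d))))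

theorem integrable_waveFreq (hφ : Continuous φ) (hs : Function.support φ ⊆ Set.Ioo (1 / 4) 4)
    (j : ℕ) (t : ℝ) : Integrable (waveFreq φ j t f) :=
  (memLp_waveSymbol hφ hs j t 2).integrable_mul (Lp.memLp _)

theorem norm_waveFreq_le {Φ : ℝ} (hb : ∀ x, |φ x| ≤ Φ) (j : ℕ) (t : ℝ)
    (ξ : EuclideanSpace ℝ (Fin d)) : ‖waveFreq φ j t f ξ‖ ≤
      Φ * ‖(𝓕 f : Lp ℂ 2 (volume : Measure (EuclideanSpace ℝ (Fin d)))) ξ‖ := by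
  rw [waveFreq, norm_mul, norm_waveSymbol]
  gcongr
  exact hb _

theorem memLp_waveFreq (hφ : Continuous φ) (hs : Function.support φ ⊆ Set.Ioo (1 / 4) 4)
    (j : ℕ) (t : ℝ) : MemLp (waveFreq φ j t f) 2 := by
  obtain ⟨Φ, hΦ, hb⟩ := exists_abs_le_of_support hφ hs
  exact (Lp.memLp (𝓕 f : Lp ℂ 2 (volume : Measure (EuclideanSpace ℝ (Fin d))))).of_le_mul
    (integrable_waveFreq f hφ hs j t).1
    (Filter.Eventually.of_forall fun ξ => norm_waveFreq_le f hb j t ξ)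

theorem wave_eq_fourier_neg (φ : ℝ → ℝ) (j : ℕ) (t : ℝ) (x : EuclideanSpace ℝ (Fin d)) :
    wave φ j t f x = 𝓕 (waveFreq φ j t f) (-x) := by
  rw [wave_eq, Real.fourierInv_eq_fourier_neg]

theorem continuous_wave (hφ : Continuous φ) (hs : Function.support φ ⊆ Set.Ioo (1 / 4) 4)
    (j : ℕ) (t : ℝ) : Continuous (wave φ j t f) := by
  have : wave φ j t f = fun x => 𝓕 (waveFreq φ j t f) (-x) :=
    funext (wave_eq_fourier_neg f φ j t)
  rw [this]
  exact (continuous_fourier_of_integrable (integrable_waveFreq f hφ hs j t)).comp continuous_neg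

theorem integrable_norm_wave_sq (hφ : Continuous φ) (hs : Function.support φ ⊆ Set.Ioo (1 / 4) 4)
    (j : ℕ) (t : ℝ) : Integrable fun x => ‖wave φ j t f x‖ ^ 2 := by
  simp_rw [wave_eq_fourier_neg]
  have h : Integrable fun x => ‖𝓕 (waveFreq φ j t f) x‖ ^ 2 :=
    (memLp_fourier (integrable_waveFreq f hφ hs j t) (memLp_waveFreq f hφ hs j t)).integrable_norm_pow
      (by norm_num)
  exact h.comp_neg

theorem integral_norm_wave_sq_le (hφ : Continuous φ)
    (hs : Function.support φ ⊆ Set.Ioo (1 / 4) 4) {Φ : ℝ} (hb : ∀ x, |φ x| ≤ Φ) (j : ℕ) (t : ℝ) :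
    ∫ x, ‖wave φ j t f x‖ ^ 2 ≤ Φ ^ 2 * ‖f‖ ^ 2 := by
  simp_rw [wave_eq_fourier_neg]
  rw [integral_neg_eq_self (fun x => ‖𝓕 (waveFreq φ j t f) x‖ ^ 2) volume,
    integral_norm_sq_fourier (integrable_waveFreq f hφ hs j t) (memLp_waveFreq f hφ hs j t),
    ← integral_norm_sq_fourier_Lp, ← integral_const_mul]
  refine integral_mono ((memLp_waveFreq f hφ hs j t).integrable_norm_pow (by norm_num))
    (((Lp.memLp _).integrable_norm_pow (by norm_num)).const_mul _) fun ξ => ?_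
  rw [← mul_pow]
  have := norm_waveFreq_le f hb j t ξ
  gcongr

/-- Bernstein bound for the localized wave. -/
theorem norm_wave_sq_le (hφ : Continuous φ)
    (hs : Function.support φ ⊆ Set.Ioo (1 / 4) 4) {Φ : ℝ} (hb : ∀ x, |φ x| ≤ Φ) (j : ℕ) (t : ℝ)
    (x : EuclideanSpace ℝ (Fin d)) :
    ‖wave φ j t f x‖ ^ 2 ≤ Φ ^ 2 * (volume : Measure (EuclideanSpace ℝ (Fin d))).real
      (Metric.closedBall 0 1) * (scale j)⁻¹ ^ d * ‖f‖ ^ 2 := by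
  have hδ := scale_pos j
  rw [wave_eq, fourierInv_eq_integral_echar]
  have e1 : ∀ ξ, echar (inner ℝ ξ x) * waveFreq φ j t f ξ = (echar (inner ℝ ξ x) *
      waveSymbol φ j t ξ) * (𝓕 f : Lp ℂ 2 (volume : Measure (EuclideanSpace ℝ (Fin d)))) ξ :=
    fun ξ => by rw [waveFreq, mul_assoc]
  simp_rw [e1]
  have hm : MemLp (fun ξ => echar (inner ℝ ξ x) * waveSymbol φ j t ξ) 2
      (volume : Measure (EuclideanSpace ℝ (Fin d))) := by
    refine (memLp_waveSymbol hφ hs j t 2).mono ?_ (Filter.Eventually.of_forall fun ξ => ?_)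
    · have := continuous_waveSymbol (d := d) hφ j t
      exact Continuous.aestronglyMeasurable (by fun_prop)
    · rw [norm_mul, norm_echar, one_mul]
  refine (norm_integral_mul_sq_le hm (Lp.memLp _)).trans ?_
  rw [integral_norm_sq_fourier_Lp]
  gcongr
  have hball : (volume : Measure (EuclideanSpace ℝ (Fin d))).real
      (Metric.closedBall 0 (scale j)⁻¹) = (scale j)⁻¹ ^ d *
      (volume : Measure (EuclideanSpace ℝ (Fin d))).real (Metric.closedBall 0 1) := by
    have := Measure.addHaar_real_closedBall' (volume : Measure (EuclideanSpace ℝ (Fin d))) 0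
      (inv_pos.2 hδ).le
    rw [this, finrank_euclideanSpace, Fintype.card_fin]
  calc ∫ ξ : EuclideanSpace ℝ (Fin d), ‖echar (inner ℝ ξ x) * waveSymbol φ j t ξ‖ ^ 2
      ≤ ∫ ξ, (Metric.closedBall (0 : EuclideanSpace ℝ (Fin d)) (scale j)⁻¹).indicator
          (fun _ => Φ ^ 2) ξ := by
        refine integral_mono (hm.integrable_norm_pow (by norm_num)) ?_ fun ξ => ?_
        · exact (integrable_indicator_iff measurableSet_closedBall).2
            (integrableOn_const measure_closedBall_lt_top.ne)
        · simp only
          rw [norm_mul, norm_echar, one_mul, norm_waveSymbol]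
          by_cases hξ : ξ ∈ Metric.closedBall (0 : EuclideanSpace ℝ (Fin d)) (scale j)⁻¹
          · rw [Set.indicator_of_mem hξ]
            exact pow_le_pow_left₀ (abs_nonneg _) (hb _) 2
          · rw [Set.indicator_of_notMem hξ]
            rw [mem_closedBall_zero_iff, not_le] at hξ
            rw [cutoff_eq_zero hs hδ (by rwa [abs_of_nonneg (norm_nonneg _)])]
            simp
    _ = _ := by
        rw [integral_indicator_const _ measurableSet_closedBall, hball, smul_eq_mul]
        ring

/-- Duality between the wave operator and `dualTerm`. -/
theorem integral_wave_mul_conj (hφ : Continuous φ) (hs : Function.support φ ⊆ Set.Ioo (1 / 4) 4)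
    (j : ℕ) {g : ℝ → EuclideanSpace ℝ (Fin d) → ℂ} {t : ℝ} (hg : Integrable (g t)) :
    ∫ x, wave φ j t f x * (starRingEnd ℂ) (g t x) =
      ∫ ξ, (𝓕 f : Lp ℂ 2 (volume : Measure (EuclideanSpace ℝ (Fin d)))) ξ *
        (starRingEnd ℂ) (dualTerm φ (scale j) g t ξ) := by
  have hk := integrable_waveFreq f hφ hs j t
  have hconj : Integrable fun x => (starRingEnd ℂ) (g t x) :=
    hg.norm.mono' (Complex.continuous_conj.comp_aestronglyMeasurable hg.1)
      (Filter.Eventually.of_forall fun y => by simp)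
  have hint : Integrable (fun p : EuclideanSpace ℝ (Fin d) × EuclideanSpace ℝ (Fin d) =>
      echar (inner ℝ p.2 p.1) * ((starRingEnd ℂ) (g t p.1) * waveFreq φ j t f p.2))
      (volume.prod volume) :=
    (hconj.mul_prod hk).bdd_mul (c := 1) (Continuous.aestronglyMeasurable (by fun_prop))
      (Filter.Eventually.of_forall fun p => (norm_echar _).le)
  calc ∫ x, wave φ j t f x * (starRingEnd ℂ) (g t x)
      = ∫ x, ∫ ξ, echar (inner ℝ ξ x) * ((starRingEnd ℂ) (g t x) * waveFreq φ j t f ξ) := by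
        congr 1
        funext x
        rw [wave_eq, fourierInv_eq_integral_echar, ← integral_mul_const]
        congr 1
        funext ξ
        ring
    _ = ∫ ξ, ∫ x, echar (inner ℝ ξ x) * ((starRingEnd ℂ) (g t x) * waveFreq φ j t f ξ) :=
        integral_integral_swap hint
    _ = _ := by
        congr 1
        funext ξ
        rw [dualTerm, map_mul, map_mul, conj_echar, Complex.conj_ofReal, conj_fourier_eq]
        have : ∀ x, echar (inner ℝ ξ x) * ((starRingEnd ℂ) (g t x) * waveFreq φ j t f ξ) =
            waveFreq φ j t f ξ * (echar (inner ℝ x ξ) * (starRingEnd ℂ) (g t x)) := by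
          intro x
          rw [real_inner_comm]
          ring
        simp_rw [this]
        rw [integral_const_mul, waveFreq, waveSymbol_eq]
        ring

end WaveBasic

/-! ### Level sets of the square function. -/

section LevelSets

variable {d : ℕ} {φ : ℝ → ℝ}

/-- The square of the `ℓ²` square function of the waves at the times in `F`. -/
def squareFn (φ : ℝ → ℝ) (j : ℕ) (F : Finset ℝ)
    (f : Lp ℂ 2 (volume : Measure (EuclideanSpace ℝ (Fin d)))) (x : EuclideanSpace ℝ (Fin d)) : ℝ :=
  ∑ t ∈ F, ‖wave φ j t f x‖ ^ 2

variable (f : Lp ℂ 2 (volume : Measure (EuclideanSpace ℝ (Fin d))))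

theorem squareFn_nonneg (φ : ℝ → ℝ) (j : ℕ) (F : Finset ℝ) (x : EuclideanSpace ℝ (Fin d)) :
    0 ≤ squareFn φ j F f x := by
  unfold squareFn; positivity

theorem continuous_squareFn (hφ : Continuous φ) (hs : Function.support φ ⊆ Set.Ioo (1 / 4) 4)
    (j : ℕ) (F : Finset ℝ) : Continuous (squareFn φ j F f) :=
  continuous_finsetSum _ fun t _ => (continuous_wave f hφ hs j t).norm.pow 2

theorem integrable_squareFn (hφ : Continuous φ) (hs : Function.support φ ⊆ Set.Ioo (1 / 4) 4)
    (j : ℕ) (F : Finset ℝ) : Integrable (squareFn φ j F f) :=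
  integrable_finsetSum _ fun t _ => integrable_norm_wave_sq f hφ hs j t

theorem integral_squareFn_le (hφ : Continuous φ) (hs : Function.support φ ⊆ Set.Ioo (1 / 4) 4)
    {Φ : ℝ} (hb : ∀ x, |φ x| ≤ Φ) (j : ℕ) (F : Finset ℝ) :
    ∫ x, squareFn φ j F f x ≤ F.card * (Φ ^ 2 * ‖f‖ ^ 2) := by
  unfold squareFn
  rw [integral_finsetSum _ fun t _ => integrable_norm_wave_sq f hφ hs j t, ← nsmul_eq_mul]
  exact Finset.sum_le_card_nsmul _ _ _ fun t _ => integral_norm_wave_sq_le f hφ hs hb j t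

theorem measure_squareFn_lt_top (hφ : Continuous φ)
    (hs : Function.support φ ⊆ Set.Ioo (1 / 4) 4) (j : ℕ) (F : Finset ℝ) {μ : ℝ} (hμ : 0 < μ) :
    volume {x | μ < squareFn φ j F f x} < ∞ :=
  (integrable_squareFn f hφ hs j F).measure_gt_lt_top hμ

/-- The basic level set estimate, from duality and the `TT*` bound. -/
theorem level_set_bound (hφ : Continuous φ)
    (hs : Function.support φ ⊆ Set.Ioo (1 / 4) 4) {Φ : ℝ} (hb : ∀ x, |φ x| ≤ Φ)
    (j : ℕ) (F : Finset ℝ) (R : ℝ → ℝ → Prop) [DecidableRel R] (hsymm : ∀ t t', R t t' → R t' t)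
    {B N : ℝ} (hN : ∀ t ∈ F, (({t' ∈ F | ¬ R t t'} : Finset ℝ).card : ℝ) ≤ N) (hN0 : 0 ≤ N)
    (hR : ∀ (c c' : ℝ → ℂ) (z : EuclideanSpace ℝ (Fin d)), ‖∑ t ∈ F, ∑ t' ∈ F, if R t t' then
      c t * (starRingEnd ℂ) (c' t') * waveKernel φ (scale j) (t - t') z else 0‖ ≤
        B * (∑ t ∈ F, ‖c t‖ ^ 2 + ∑ t ∈ F, ‖c' t‖ ^ 2)) (hB : 0 ≤ B) {l : ℝ} (hl : 0 < l) :
    (l * volume.real {x | l ^ 2 < squareFn φ j F f x}) ^ 2 ≤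
      ‖f‖ ^ 2 * (N * (Φ ^ 2 * volume.real {x | l ^ 2 < squareFn φ j F f x}) +
        2 * B * volume.real {x | l ^ 2 < squareFn φ j F f x} ^ 2) := by
  set A : Set (EuclideanSpace ℝ (Fin d)) := {x | l ^ 2 < squareFn φ j F f x} with hAdef
  have hcont := continuous_squareFn f hφ hs j F
  have hA : MeasurableSet A := measurableSet_lt measurable_const hcont.measurable
  have hAf : volume A ≠ ∞ := (measure_squareFn_lt_top f hφ hs j F (by positivity)).ne
  -- The extremal dual family: on `A` it is a unit vector in `ℓ²` over the times, aligned with the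
  -- waves, so that pairing with them recovers the square root of `squareFn`.
  let g : ℝ → EuclideanSpace ℝ (Fin d) → ℂ := fun t =>
    A.indicator fun x => wave φ j t f x / (√(squareFn φ j F f x) : ℝ)
  have hpos : ∀ x ∈ A, 0 < squareFn φ j F f x := fun x hx => lt_trans (by positivity) hx
  have hgA : ∀ x, ∑ t ∈ F, ‖g t x‖ ^ 2 = A.indicator 1 x := by
    intro x
    by_cases hx : x ∈ A
    · simp only [g, Set.indicator_of_mem hx, norm_div, Complex.norm_real, div_pow, Pi.one_apply,
        Real.norm_eq_abs, sq_abs, Real.sq_sqrt (squareFn_nonneg f φ j F x)]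
      rw [← Finset.sum_div]
      exact div_self (hpos x hx).ne'
    · simp [g, Set.indicator_of_notMem hx]
  have hgm : ∀ t, AEStronglyMeasurable (g t) volume := fun t =>
    AEStronglyMeasurable.indicator (Measurable.aestronglyMeasurable
      ((continuous_wave f hφ hs j t).measurable.div
        (Complex.measurable_ofReal.comp hcont.measurable.sqrt))) hA
  have hgb : ∀ t ∈ F, ∀ x, ‖g t x‖ ≤ ‖A.indicator (fun _ => (1 : ℝ)) x‖ := by
    intro t ht x
    have h1 : ‖g t x‖ ^ 2 ≤ A.indicator 1 x := by
      rw [← hgA x]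
      exact Finset.single_le_sum (f := fun t => ‖g t x‖ ^ 2) (fun t _ => by positivity) ht
    by_cases hx : x ∈ A
    · rw [Set.indicator_of_mem hx] at h1 ⊢
      simp only [Pi.one_apply, norm_one] at h1 ⊢
      nlinarith [norm_nonneg (g t x)]
    · simp [g, Set.indicator_of_notMem hx]
  have hLp : ∀ t ∈ F, ∀ p, MemLp (g t) p := fun t ht p =>
    (memLp_indicator_const p hA (1 : ℝ) (Or.inr hAf)).mono (hgm t)
      (Filter.Eventually.of_forall (hgb t ht))
  have hg1 : ∀ t ∈ F, Integrable (g t) := fun t ht => memLp_one_iff_integrable.1 (hLp t ht 1)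
  have hQ := integral_norm_sum_dualTerm_sq_le hφ hs hb (scale_pos j) F hg1
    (fun t ht => hLp t ht 2) hA hAf (fun x => (hgA x).le) R hsymm hN hN0 hR hB
  have hdual : MemLp (fun ξ => (starRingEnd ℂ) (∑ t ∈ F, dualTerm φ (scale j) g t ξ)) 2
      (volume : Measure (EuclideanSpace ℝ (Fin d))) := by
    have hc : Continuous fun ξ => (starRingEnd ℂ) (∑ t ∈ F, dualTerm φ (scale j) g t ξ) :=
      Complex.continuous_conj.comp
        (continuous_finsetSum _ fun t ht => continuous_dualTerm hφ _ (hg1 t ht))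
    refine hc.memLp_of_hasCompactSupport ?_
    refine HasCompactSupport.of_support_subset_isCompact
      (isCompact_closedBall 0 (scale j)⁻¹) fun x hx => ?_
    rw [mem_closedBall_zero_iff]
    by_contra h
    refine hx ?_
    beta_reduce
    rw [Finset.sum_eq_zero fun t _ => dualTerm_eq_zero hs (scale_pos j) g t (not_le.1 h), map_zero]
  have hwg : ∀ t ∈ F, Integrable fun x => wave φ j t f x * (starRingEnd ℂ) (g t x) := by
    intro t ht
    have hconj : Integrable fun x => (starRingEnd ℂ) (g t x) :=
      (hg1 t ht).norm.mono' (Complex.continuous_conj.comp_aestronglyMeasurable (hg1 t ht).1)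
        (Filter.Eventually.of_forall fun y => by simp)
    refine hconj.bdd_mul
      (c := √(Φ ^ 2 * (volume : Measure (EuclideanSpace ℝ (Fin d))).real
      (Metric.closedBall 0 1) * (scale j)⁻¹ ^ d * ‖f‖ ^ 2))
      (continuous_wave f hφ hs j t).aestronglyMeasurable (Filter.Eventually.of_forall fun x => ?_)
    exact Real.le_sqrt_of_sq_le (norm_wave_sq_le f hφ hs hb j t x)
  have hdt : ∀ t ∈ F, Integrable fun ξ =>
      (𝓕 f : Lp ℂ 2 (volume : Measure (EuclideanSpace ℝ (Fin d)))) ξ *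
        (starRingEnd ℂ) (dualTerm φ (scale j) g t ξ) := by
    intro t ht
    refine (Lp.memLp _).integrable_mul (q := 2) ?_
    have hc : Continuous fun ξ => (starRingEnd ℂ) (dualTerm φ (scale j) g t ξ) :=
      Complex.continuous_conj.comp (continuous_dualTerm hφ _ (hg1 t ht))
    refine hc.memLp_of_hasCompactSupport ?_
    refine HasCompactSupport.of_support_subset_isCompact
      (isCompact_closedBall 0 (scale j)⁻¹) fun x hx => ?_
    rw [mem_closedBall_zero_iff]
    by_contra h
    refine hx ?_
    beta_reduce
    rw [dualTerm_eq_zero hs (scale_pos j) g t (not_le.1 h), map_zero]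
  have hid : ((∫ x, A.indicator (fun x => √(squareFn φ j F f x)) x : ℝ) : ℂ) =
      ∫ ξ, (𝓕 f : Lp ℂ 2 (volume : Measure (EuclideanSpace ℝ (Fin d)))) ξ *
        (starRingEnd ℂ) (∑ t ∈ F, dualTerm φ (scale j) g t ξ) := by
    have h1 : ∀ x, ((A.indicator (fun x => √(squareFn φ j F f x)) x : ℝ) : ℂ) =
        ∑ t ∈ F, wave φ j t f x * (starRingEnd ℂ) (g t x) := by
      intro x
      by_cases hx : x ∈ A
      · have hs0 : (√(squareFn φ j F f x) : ℂ) ≠ 0 := by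
          exact_mod_cast (Real.sqrt_pos.2 (hpos x hx)).ne'
        simp only [g, Set.indicator_of_mem hx, map_div₀, Complex.conj_ofReal, ← mul_div_assoc,
          Complex.mul_conj, Complex.normSq_eq_norm_sq]
        rw [← Finset.sum_div, eq_div_iff hs0, ← Complex.ofReal_mul, Real.mul_self_sqrt
          (squareFn_nonneg f φ j F x), squareFn, Complex.ofReal_sum]
      · simp [g, Set.indicator_of_notMem hx]
    rw [← integral_complex_ofReal]
    simp_rw [h1]
    rw [integral_finsetSum _ hwg]
    simp_rw [map_sum, Finset.mul_sum]
    rw [integral_finsetSum _ hdt]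
    exact Finset.sum_congr rfl fun t ht => integral_wave_mul_conj f hφ hs j (hg1 t ht)
  have hint : Integrable (A.indicator fun x => √(squareFn φ j F f x)) := by
    have h1 : IntegrableOn (fun x => squareFn φ j F f x + 1) A :=
      (integrable_squareFn f hφ hs j F).integrableOn.add (integrableOn_const hAf)
    rw [integrable_indicator_iff hA]
    refine h1.mono' hcont.sqrt.aestronglyMeasurable (Filter.Eventually.of_forall fun x => ?_)
    rw [Real.norm_of_nonneg (Real.sqrt_nonneg _)]
    have := squareFn_nonneg f φ j F x
    nlinarith [Real.sq_sqrt this, sq_nonneg (√(squareFn φ j F f x) - 1)]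
  -- Chebyshev from below. The pairing is bounded from above by Cauchy–Schwarz and the `TT*`
  -- estimate.
  have hlow : l * volume.real A ≤ ∫ x, A.indicator (fun x => √(squareFn φ j F f x)) x := by
    have h1 : ∫ x, A.indicator (fun _ => l) x = l * volume.real A := by
      rw [integral_indicator_const _ hA, smul_eq_mul, mul_comm]
    rw [← h1]
    refine integral_mono ((integrable_indicator_iff hA).2 (integrableOn_const hAf)) hint
      fun x => ?_
    refine Set.indicator_le_indicator' fun hx => ?_
    exact Real.le_sqrt_of_sq_le (le_of_lt hx)
  have hup := norm_integral_mul_sq_le (Lp.memLp (𝓕 f : Lp ℂ 2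
    (volume : Measure (EuclideanSpace ℝ (Fin d))))) hdual
  rw [← hid, integral_norm_sq_fourier_Lp] at hup
  simp only [RCLike.norm_conj] at hup
  rw [Complex.norm_real, Real.norm_eq_abs, sq_abs] at hup
  calc (l * volume.real A) ^ 2 ≤ (∫ x, A.indicator (fun x => √(squareFn φ j F f x)) x) ^ 2 := by
        have : 0 ≤ l * volume.real A := by positivity
        gcongr
    _ ≤ _ := hup
    _ ≤ _ := by gcongr

end LevelSets

/-! ### Covering numbers and discretizations. -/

section Covering

theorem exists_cover_Icc {δ : ℝ} (hδ : 0 < δ) :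
    ∃ S : Finset ℝ, (S.card : ℝ) ≤ 1 / δ + 2 ∧ Set.Icc (1 : ℝ) 2 ⊆ ⋃ a ∈ S, Set.Icc a (a + δ) := by
  refine ⟨(Finset.range (⌊1 / δ⌋₊ + 1)).image fun k : ℕ => 1 + k * δ, ?_, fun x hx => ?_⟩
  · have h1 : ((Finset.range (⌊1 / δ⌋₊ + 1)).image fun k : ℕ => 1 + (k : ℝ) * δ).card ≤
        ⌊1 / δ⌋₊ + 1 := Finset.card_image_le.trans (by simp)
    have h2 : (⌊1 / δ⌋₊ : ℝ) ≤ 1 / δ := Nat.floor_le (by positivity)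
    calc _ ≤ ((⌊1 / δ⌋₊ + 1 : ℕ) : ℝ) := by exact_mod_cast h1
      _ ≤ _ := by push_cast; linarith
  · have hx0 : 0 ≤ (x - 1) / δ := div_nonneg (by linarith [hx.1]) hδ.le
    have h1 := Nat.floor_le hx0
    have h2 := Nat.lt_floor_add_one ((x - 1) / δ)
    rw [le_div_iff₀ hδ] at h1
    rw [div_lt_iff₀ hδ] at h2
    simp only [Set.mem_iUnion]
    refine ⟨1 + ⌊(x - 1) / δ⌋₊ * δ, Finset.mem_image.2 ⟨_, ?_, rfl⟩, by linarith, by linarith⟩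
    rw [Finset.mem_range, Nat.lt_succ_iff]
    refine Nat.floor_mono ?_
    gcongr
    linarith [hx.2]

variable {E : Set ℝ}

theorem coverNum_le_of_cover {A : Set ℝ} {δ : ℝ} {S : Finset ℝ}
    (h : A ⊆ ⋃ a ∈ S, Set.Icc a (a + δ)) : coverNum A δ ≤ S.card :=
  Nat.sInf_le ⟨S, rfl, h⟩

/-- The infimum of an empty set of naturals would be the default 0. A finite cover of `[1, 2]` shows
that the set is nonempty, so the minimum is attained. -/
theorem exists_card_eq_coverNum {A : Set ℝ} (hA : A ⊆ Set.Icc 1 2) {δ : ℝ} (hδ : 0 < δ) :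
    ∃ S : Finset ℝ, S.card = coverNum A δ ∧ A ⊆ ⋃ a ∈ S, Set.Icc a (a + δ) := by
  obtain ⟨S, -, hS⟩ := exists_cover_Icc hδ
  exact Nat.sInf_mem (s := {n : ℕ | ∃ S : Finset ℝ, S.card = n ∧ A ⊆ ⋃ a ∈ S, Set.Icc a (a + δ)})
    ⟨_, S, rfl, hA.trans hS⟩

theorem coverNum_le {A : Set ℝ} (hA : A ⊆ Set.Icc 1 2) {δ : ℝ} (hδ : 0 < δ) :
    (coverNum A δ : ℝ) ≤ 1 / δ + 2 := by
  obtain ⟨S, hc, hS⟩ := exists_cover_Icc hδ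
  refine le_trans ?_ hc
  exact_mod_cast coverNum_le_of_cover (hA.trans hS)

theorem one_le_coverNum {A : Set ℝ} (hA : A ⊆ Set.Icc 1 2) (hne : A.Nonempty) {δ : ℝ}
    (hδ : 0 < δ) : 1 ≤ coverNum A δ := by
  obtain ⟨S, hc, hS⟩ := exists_card_eq_coverNum hA hδ
  obtain ⟨x, hx⟩ := hne
  rw [← hc, Nat.one_le_iff_ne_zero, Finset.card_ne_zero]
  have := hS hx
  simp only [Set.mem_iUnion] at this
  obtain ⟨a, ha, -⟩ := this
  exact ⟨a, ha⟩

theorem coverNum_anti {A : Set ℝ} (hA : A ⊆ Set.Icc 1 2) {δ δ' : ℝ} (hδ' : 0 < δ')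
    (h : δ' ≤ δ) : coverNum A δ ≤ coverNum A δ' := by
  obtain ⟨S, hc, hS⟩ := exists_card_eq_coverNum hA hδ'
  rw [← hc]
  refine coverNum_le_of_cover (hS.trans ?_)
  refine Set.iUnion₂_mono fun a _ => Set.Icc_subset_Icc_right (by linarith)

/-- The bound is two rather than one because a closed interval of length `δ` may contain both of its
end points. -/
theorem card_le_two_of_isSep {δ a : ℝ} (hδ : 0 < δ) {T : Finset ℝ} (hT : IsSep δ T)
    (h : ∀ t ∈ T, t ∈ Set.Icc a (a + δ)) : T.card ≤ 2 := by
  by_contra hc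
  obtain ⟨x, hx, y, hy, z, hz, hxy, hxz, hyz⟩ := Finset.two_lt_card.1 (not_le.1 hc)
  have h1 := hT hx hy hxy
  have h2 := hT hx hz hxz
  have h3 := hT hy hz hyz
  obtain ⟨a1, a2⟩ := h x hx
  obtain ⟨b1, b2⟩ := h y hy
  obtain ⟨c1, c2⟩ := h z hz
  rcases le_abs.1 h1 with h1 | h1 <;> rcases le_abs.1 h2 with h2 | h2 <;>
    rcases le_abs.1 h3 with h3 | h3 <;> linarith

theorem card_sep_le_coverNum {δ : ℝ} (hδ : 0 < δ) {A : Set ℝ} (hA : A ⊆ Set.Icc 1 2)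
    {T : Finset ℝ} (hT : IsSep δ T) (hTA : (T : Set ℝ) ⊆ A) : T.card ≤ 2 * coverNum A δ := by
  obtain ⟨S, hc, hS⟩ := exists_card_eq_coverNum hA hδ
  have hsub : T ⊆ S.biUnion fun a => {t ∈ T | t ∈ Set.Icc a (a + δ)} := by
    intro t ht
    have := hS (hTA ht)
    simp only [Set.mem_iUnion] at this
    obtain ⟨a, ha, hta⟩ := this
    exact Finset.mem_biUnion.2 ⟨a, ha, Finset.mem_filter.2 ⟨ht, hta⟩⟩
  refine (Finset.card_le_card hsub).trans ?_
  rw [mul_comm, ← hc]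
  refine Finset.card_biUnion_le_card_mul _ _ _ fun a _ => ?_
  refine card_le_two_of_isSep (a := a) hδ (hT.mono ?_) fun t ht => (Finset.mem_filter.1 ht).2
  exact_mod_cast Finset.filter_subset _ _

theorem IsDiscretization.isSep {δ : ℝ} {F : Finset ℝ} (h : IsDiscretization E δ F) : IsSep δ F :=
  h.1.2

theorem IsDiscretization.subset {δ : ℝ} {F : Finset ℝ} (h : IsDiscretization E δ F) :
    (F : Set ℝ) ⊆ E :=
  h.1.1

/-- Otherwise `x` could be added to `F`, against maximality. -/
theorem IsDiscretization.exists_near {δ : ℝ} (hδ : 0 < δ) {F : Finset ℝ}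
    (h : IsDiscretization E δ F) {x : ℝ} (hx : x ∈ E) : ∃ t ∈ F, |x - t| < δ := by
  by_contra hcon
  push Not at hcon
  have hins : insert x (F : Set ℝ) ⊆ E ∧ (insert x (F : Set ℝ)).Pairwise fun t t' => δ ≤ |t - t'| := by
    refine ⟨Set.insert_subset hx h.1.1, ?_⟩
    refine h.1.2.insert fun b hb _ => ⟨hcon b hb, ?_⟩
    rw [abs_sub_comm]
    exact hcon b hb
  have hxF : x ∈ F := by
    have := h.2 hins (Set.subset_insert _ _) (Set.mem_insert x _)
    exact_mod_cast this
  have := hcon x hxF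
  simp at this
  linarith

/-- Each `t` contributes the two intervals `[t - δ, t]` and `[t, t + δ]`. The window is widened by
`δ` because the point of `F` near an end point may lie outside `[a, b]`. -/
theorem coverNum_le_card_discretization {δ : ℝ} (hδ : 0 < δ) {F : Finset ℝ}
    (h : IsDiscretization E δ F) (a b : ℝ) :
    coverNum (E ∩ Set.Icc a b) δ ≤
      2 * ({t ∈ F | t ∈ Set.Icc (a - δ) (b + δ)} : Finset ℝ).card := by
  set T := ({t ∈ F | t ∈ Set.Icc (a - δ) (b + δ)} : Finset ℝ) with hT
  have hcov : E ∩ Set.Icc a b ⊆ ⋃ s ∈ T ∪ T.image (fun t => t - δ), Set.Icc s (s + δ) := by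
    rintro x ⟨hxE, hxa, hxb⟩
    obtain ⟨t, ht, hxt⟩ := h.exists_near hδ hxE
    rw [abs_lt] at hxt
    have htT : t ∈ T := Finset.mem_filter.2 ⟨ht, by linarith, by linarith⟩
    simp only [Set.mem_iUnion]
    rcases le_total t x with h1 | h1
    · exact ⟨t, Finset.mem_union_left _ htT, h1, by linarith⟩
    · exact ⟨t - δ, Finset.mem_union_right _ (Finset.mem_image_of_mem _ htT), by linarith,
        by linarith⟩
  refine (coverNum_le_of_cover hcov).trans ((Finset.card_union_le _ _).trans ?_)
  have : (T.image fun t => t - δ).card ≤ T.card := Finset.card_image_le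
  omega

end Covering

/-! ### The Legendre–Assouad function and power bounds. -/

section Assouad

variable {E : Set ℝ} {α : ℝ}

/-- A crude bound that makes the set in `assouadSup` bounded above, so that its real supremum is
genuine. -/
theorem assouad_term_le (hE : E ⊆ Set.Icc 1 2) (hα : 0 ≤ α) {δ : ℝ} (hδ : 0 < δ) {a b : ℝ}
    (h1 : δ ≤ b - a) (h2 : b - a ≤ 1) :
    (b - a) ^ (-α) * (coverNum (E ∩ Set.Icc a b) δ : ℝ) ≤ 3 * δ ^ (-(α + 1)) := by
  have hδ1 : δ ≤ 1 := h1.trans h2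
  have e1 : (b - a) ^ (-α) ≤ δ ^ (-α) := Real.rpow_le_rpow_of_nonpos hδ h1 (by linarith)
  have e2 : (coverNum (E ∩ Set.Icc a b) δ : ℝ) ≤ 3 * δ⁻¹ := by
    refine (coverNum_le (Set.inter_subset_left.trans hE) hδ).trans ?_
    have : 1 ≤ δ⁻¹ := (one_le_inv₀ hδ).2 hδ1
    rw [one_div]
    linarith
  calc _ ≤ δ ^ (-α) * (3 * δ⁻¹) := by gcongr
    _ = 3 * (δ ^ (-α) * δ ^ (-1 : ℝ)) := by rw [Real.rpow_neg_one]; ring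
    _ = _ := by rw [← Real.rpow_add hδ]; ring_nf

theorem le_assouadSup (hE : E ⊆ Set.Icc 1 2) (hα : 0 ≤ α) {δ : ℝ} (hδ : 0 < δ) {a b : ℝ}
    (h1 : δ ≤ b - a) (h2 : b - a ≤ 1) :
    (b - a) ^ (-α) * (coverNum (E ∩ Set.Icc a b) δ : ℝ) ≤ assouadSup E α δ := by
  refine le_csSup ⟨3 * δ ^ (-(α + 1)), ?_⟩ ⟨a, b, h1, h2, rfl⟩
  rintro y ⟨a, b, h1, h2, rfl⟩
  exact assouad_term_le hE hα hδ h1 h2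

theorem assouadSup_le_of_forall {δ : ℝ} (hδ1 : δ ≤ 1) {K : ℝ}
    (h : ∀ a b : ℝ, δ ≤ b - a → b - a ≤ 1 →
      (b - a) ^ (-α) * (coverNum (E ∩ Set.Icc a b) δ : ℝ) ≤ K) : assouadSup E α δ ≤ K := by
  refine csSup_le ⟨_, 0, 1, by simpa using hδ1, by simp, rfl⟩ ?_
  rintro y ⟨a, b, h1, h2, rfl⟩
  exact h a b h1 h2

theorem assouadSup_le (hE : E ⊆ Set.Icc 1 2) (hα : 0 ≤ α) {δ : ℝ} (hδ : 0 < δ) (hδ1 : δ ≤ 1) :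
    assouadSup E α δ ≤ 3 * δ ^ (-(α + 1)) :=
  assouadSup_le_of_forall hδ1 fun _ _ h1 h2 => assouad_term_le hE hα hδ h1 h2

theorem one_le_assouadSup (hE : E ⊆ Set.Icc 1 2) (hne : E.Nonempty) (hα : 0 ≤ α) {δ : ℝ}
    (hδ : 0 < δ) (hδ1 : δ ≤ 1) : 1 ≤ assouadSup E α δ := by
  obtain ⟨x, hx⟩ := hne
  have h := le_assouadSup hE hα hδ (a := x) (b := x + 1) (by linarith) (by linarith)
  rw [add_sub_cancel_left, Real.one_rpow, one_mul] at h
  refine le_trans ?_ h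
  exact_mod_cast one_le_coverNum (Set.inter_subset_left.trans hE)
    ⟨x, hx, by simp⟩ hδ

theorem assouadSup_anti (hE : E ⊆ Set.Icc 1 2) (hα : 0 ≤ α) {δ δ' : ℝ} (hδ' : 0 < δ')
    (h : δ' ≤ δ) (hδ1 : δ ≤ 1) : assouadSup E α δ ≤ assouadSup E α δ' := by
  refine assouadSup_le_of_forall hδ1 fun a b h1 h2 => ?_
  refine le_trans ?_ (le_assouadSup hE hα hδ' (h.trans h1) h2)
  have h3 : 0 ≤ b - a := by linarith
  gcongr
  exact coverNum_anti (Set.inter_subset_left.trans hE) hδ' h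

theorem log_one_div_pos {δ : ℝ} (hδ : 0 < δ) (hδ1 : δ < 1) : 0 < Real.log (1 / δ) :=
  Real.log_pos ((one_lt_div hδ).2 hδ1)

/-- Needed for the real `limsup` to carry information. The extra power in `α + 2` absorbs the
constant 3 once `δ < 1/3`. -/
theorem isBoundedUnder_assouad (hE : E ⊆ Set.Icc 1 2) (hne : E.Nonempty) (hα : 0 ≤ α) :
    Filter.IsBoundedUnder (· ≤ ·) (𝓝[>] (0 : ℝ))
      (fun δ : ℝ => Real.log (assouadSup E α δ) / Real.log (1 / δ)) := by
  refine ⟨α + 2, ?_⟩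
  rw [Filter.eventually_map]
  have hmem : Set.Ioo (0 : ℝ) (1 / 3) ∈ 𝓝[>] (0 : ℝ) := Ioo_mem_nhdsGT (by norm_num)
  filter_upwards [hmem] with δ hδ
  have hδ0 : 0 < δ := hδ.1
  have hδ1 : δ < 1 := by linarith [hδ.2]
  have hδ3 : δ < 1 / 3 := hδ.2
  rw [div_le_iff₀ (log_one_div_pos hδ0 hδ1)]
  have h0 := one_le_assouadSup hE hne hα hδ0 hδ1.le
  have h1 : assouadSup E α δ ≤ δ ^ (-(α + 2)) := by
    refine (assouadSup_le hE hα hδ0 hδ1.le).trans ?_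
    have : δ ^ (-(α + 2)) = δ⁻¹ * δ ^ (-(α + 1)) := by
      rw [← Real.rpow_neg_one, ← Real.rpow_add hδ0]; ring_nf
    rw [this]
    gcongr
    rw [le_inv_comm₀ (by norm_num) hδ0]
    linarith
  calc Real.log (assouadSup E α δ) ≤ Real.log (δ ^ (-(α + 2))) :=
        Real.log_le_log (by linarith) h1
    _ = _ := by rw [Real.log_rpow hδ0, one_div, Real.log_inv]; ring

theorem isCoboundedUnder_assouad (hE : E ⊆ Set.Icc 1 2) (hne : E.Nonempty) (hα : 0 ≤ α) :
    Filter.IsCoboundedUnder (· ≤ ·) (𝓝[>] (0 : ℝ))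
      (fun δ : ℝ => Real.log (assouadSup E α δ) / Real.log (1 / δ)) := by
  have : Filter.IsBoundedUnder (· ≥ ·) (𝓝[>] (0 : ℝ))
      (fun δ : ℝ => Real.log (assouadSup E α δ) / Real.log (1 / δ)) := by
    refine ⟨0, ?_⟩
    rw [Filter.eventually_map]
    have hmem : Set.Ioo (0 : ℝ) 1 ∈ 𝓝[>] (0 : ℝ) := Ioo_mem_nhdsGT (by norm_num)
    filter_upwards [hmem] with δ hδ
    exact div_nonneg (Real.log_nonneg (one_le_assouadSup hE hne hα hδ.1 hδ.2.le))
      (log_one_div_pos hδ.1 hδ.2).le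
  exact this.isCoboundedUnder_le

/-- Above the Legendre–Assouad value, `assouadSup` obeys a power bound at every scale. -/
theorem exists_assouadSup_le_rpow (hE : E ⊆ Set.Icc 1 2) (hne : E.Nonempty) (hα : 0 ≤ α) {κ : ℝ}
    (hκ : legendreAssouad E α < κ) :
    ∃ C : ℝ, 0 < C ∧ ∀ δ : ℝ, 0 < δ → δ ≤ 1 → assouadSup E α δ ≤ C * δ ^ (-κ) := by
  have h := Filter.eventually_lt_of_limsup_lt hκ (isBoundedUnder_assouad hE hne hα)
  obtain ⟨ε, hε, hlt⟩ := mem_nhdsGT_iff_exists_Ioo_subset.1 h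
  have hε : 0 < ε := hε
  set η := min ε 1 / 2 with hη
  have hη0 : 0 < η := by positivity
  have hηε : η < ε := by
    have := min_le_left ε 1
    have : 0 < min ε 1 := by positivity
    linarith
  have hη1 : η < 1 := by
    have := min_le_right ε 1
    linarith
  -- Below `η` the `limsup` gives the bound with constant 1. On `[η, 1]` the crude bound is used,
  -- and `1 + η^{κ-(α+1)}` dominates `δ^{κ-(α+1)}` for either sign of the exponent.
  refine ⟨1 + 3 * (1 + η ^ (κ - (α + 1))), by positivity, fun δ hδ hδ1 => ?_⟩
  have hp : 0 < δ ^ (-κ) := Real.rpow_pos_of_pos hδ _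
  have hq : 0 < η ^ (κ - (α + 1)) := Real.rpow_pos_of_pos hη0 _
  rcases lt_or_ge δ η with h1 | h1
  · have h2 : Real.log (assouadSup E α δ) / Real.log (1 / δ) < κ := hlt ⟨hδ, h1.trans hηε⟩
    rw [div_lt_iff₀ (log_one_div_pos hδ (h1.trans hη1))] at h2
    have h0 := one_le_assouadSup hE hne hα hδ hδ1
    have h3 : κ * Real.log (1 / δ) = Real.log (δ ^ (-κ)) := by
      rw [Real.log_rpow hδ, one_div, Real.log_inv]; ring
    rw [h3] at h2
    have h4 := (Real.log_lt_log_iff (by linarith) hp).1 h2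
    nlinarith
  · have h2 := assouadSup_le hE hα hδ hδ1
    have e : δ ^ (-(α + 1)) = δ ^ (κ - (α + 1)) * δ ^ (-κ) := by
      rw [← Real.rpow_add hδ]; ring_nf
    have h3 : δ ^ (κ - (α + 1)) ≤ 1 + η ^ (κ - (α + 1)) := by
      rcases le_or_gt 0 (κ - (α + 1)) with h4 | h4
      · have := Real.rpow_le_one hδ.le hδ1 h4
        linarith
      · have := Real.rpow_le_rpow_of_nonpos hη0 h1 h4.le
        linarith
    rw [e] at h2
    have h5 := mul_le_mul_of_nonneg_right h3 hp.le
    nlinarith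

theorem scale_eq_pow (j : ℕ) : scale j = (1 / 2 : ℝ) ^ j := by
  rw [scale, Real.rpow_neg two_pos.le, Real.rpow_natCast, one_div, inv_pow]

theorem scale_le_one (j : ℕ) : scale j ≤ 1 := by
  rw [scale_eq_pow]
  exact pow_le_one₀ (by norm_num) (by norm_num)

/-- Power bounds at dyadic scales bound the Legendre–Assouad function. -/
theorem legendreAssouad_le_of_forall_scale (hE : E ⊆ Set.Icc 1 2) (hne : E.Nonempty) (hα : 0 ≤ α)
    {κ C : ℝ} (hC : 0 < C)
    (h : ∀ j : ℕ, 1 ≤ j → assouadSup E α (scale j) ≤ C * (scale j) ^ (-κ)) :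
    legendreAssouad E α ≤ κ := by
  -- Monotonicity in `δ` passes to the next smaller dyadic scale. The two scales differ by at most a
  -- factor 2, and the sign of `κ` is free, hence `2 ^ |κ|`.
  have key : ∀ δ : ℝ, 0 < δ → δ < 1 → assouadSup E α δ ≤ C * 2 ^ |κ| * δ ^ (-κ) := by
    intro δ hδ hδ1
    obtain ⟨n, hn1, hn2⟩ := exists_nat_pow_near_of_lt_one hδ hδ1.le
      (by norm_num : (0 : ℝ) < 1 / 2) (by norm_num)
    rw [← scale_eq_pow] at hn1
    have hs := scale_pos (n + 1)
    have h2 : δ ≤ 2 * scale (n + 1) := by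
      rw [scale_eq_pow, pow_succ]
      linarith
    refine (assouadSup_anti hE hα hs hn1.le hδ1.le).trans ((h (n + 1) (by omega)).trans ?_)
    rw [mul_assoc]
    gcongr
    have e : scale (n + 1) ^ (-κ) = (δ / scale (n + 1)) ^ κ * δ ^ (-κ) := by
      rw [Real.div_rpow hδ.le hs.le, Real.rpow_neg hs.le, Real.rpow_neg hδ.le]
      have := (Real.rpow_pos_of_pos hδ κ).ne'
      field_simp
    rw [e]
    gcongr
    have r1 : 1 ≤ δ / scale (n + 1) := (one_le_div hs).2 hn1.le
    have r2 : δ / scale (n + 1) ≤ 2 := (div_le_iff₀ hs).2 h2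
    calc (δ / scale (n + 1)) ^ κ ≤ (δ / scale (n + 1)) ^ |κ| :=
          Real.rpow_le_rpow_of_exponent_le r1 (le_abs_self κ)
      _ ≤ 2 ^ |κ| := by gcongr
  set K := C * 2 ^ |κ| with hK
  have hK0 : 0 < K := by positivity
  have htend : Filter.Tendsto (fun δ : ℝ => Real.log K / Real.log (1 / δ) + κ) (𝓝[>] 0) (𝓝 κ) := by
    have h1 : Filter.Tendsto (fun δ : ℝ => Real.log (1 / δ)) (𝓝[>] 0) Filter.atTop := by
      simp_rw [one_div]
      exact Real.tendsto_log_atTop.comp tendsto_inv_nhdsGT_zero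
    have h2 : Filter.Tendsto (fun δ : ℝ => Real.log K / Real.log (1 / δ)) (𝓝[>] 0) (𝓝 0) :=
      h1.const_div_atTop _
    simpa using h2.add_const κ
  rw [legendreAssouad, ← htend.limsup_eq]
  refine Filter.limsup_le_limsup ?_ (isCoboundedUnder_assouad hE hne hα)
    htend.isBoundedUnder_le
  have hmem : Set.Ioo (0 : ℝ) 1 ∈ 𝓝[>] (0 : ℝ) := Ioo_mem_nhdsGT (by norm_num)
  filter_upwards [hmem] with δ hδ
  have hl := log_one_div_pos hδ.1 hδ.2
  have h0 := one_le_assouadSup hE hne hα hδ.1 hδ.2.le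
  rw [div_le_iff₀ hl, add_mul, div_mul_cancel₀ _ hl.ne']
  calc Real.log (assouadSup E α δ) ≤ Real.log (K * δ ^ (-κ)) :=
        Real.log_le_log (by linarith) (key δ hδ.1 hδ.2)
    _ = _ := by
        rw [Real.log_mul hK0.ne' (Real.rpow_pos_of_pos hδ.1 _).ne', Real.log_rpow hδ.1, one_div,
          Real.log_inv]
        ring

end Assouad

/-! ### The weak type estimate. -/

section WeakType

/-- Optimization over the time localization `ℓ`. -/
theorem rpow_mul_le_of_optimize {γ p δ a S L Y : ℝ} (hγ : 0 ≤ γ) (hp : 1 ≤ p) (hδ : 0 < δ)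
    (ha : 0 < a) (hS : 0 < S) (hL : 0 < L)
    (hA : L ≤ Y * δ ^ (-(2 * γ + 1))) (hB : L * a ≤ Y * S)
    (hC : 0 < γ → ∀ ℓ, δ ≤ ℓ → ℓ ≤ 1 →
      L * a ≤ Y * (S * ℓ ^ (γ * (p - 1)) + δ ^ (-(γ + 1)) * ℓ ^ (-γ) * a)) :
    L ^ p * a ≤ (2 * Y) ^ p * (S * (δ ^ (-(γ + 1))) ^ (p - 1)) := by
  have hY : 0 < Y := by
    have : 0 < Y * δ ^ (-(2 * γ + 1)) := hL.trans_le hA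
    exact pos_of_mul_pos_left this (Real.rpow_pos_of_pos hδ _).le
  set D := δ ^ (-(γ + 1)) with hD
  have hD0 : 0 < D := Real.rpow_pos_of_pos hδ _
  have hYY : Y ^ p ≤ (2 * Y) ^ p := by gcongr; linarith
  have hSD : 0 ≤ S * D ^ (p - 1) := by positivity
  have hap : a ^ p = a ^ (p - 1) * a := by
    rw [← Real.rpow_add_one ha.ne']; congr 1; ring
  have hSp : S ^ p = S ^ (p - 1) * S := by
    rw [← Real.rpow_add_one hS.ne']; congr 1; ring
  have hap0 : 0 < a ^ (p - 1) := Real.rpow_pos_of_pos ha _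
  have hSp0 : 0 < S ^ (p - 1) := Real.rpow_pos_of_pos hS _
  -- The two terms of `hC` are equal when `ℓ^{γp} = Da/S`. In this case that value is at most
  -- `δ^{γp}`, and `hA` already suffices.
  rcases le_or_gt a (S * δ ^ (γ * (p - 1) + 2 * γ + 1)) with h1 | h1
  · calc L ^ p * a ≤ (Y * δ ^ (-(2 * γ + 1))) ^ p * (S * δ ^ (γ * (p - 1) + 2 * γ + 1)) := by
          gcongr
      _ = Y ^ p * (S * (δ ^ (-(2 * γ + 1) * p) * δ ^ (γ * (p - 1) + 2 * γ + 1))) := by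
          rw [Real.mul_rpow hY.le (Real.rpow_nonneg hδ.le _), ← Real.rpow_mul hδ.le]
          ring
      _ = Y ^ p * (S * D ^ (p - 1)) := by
          rw [hD, ← Real.rpow_add hδ, ← Real.rpow_mul hδ.le]
          congr 3
          ring
      _ ≤ _ := by gcongr
  -- Here `Da/S ≥ 1`, so the balancing length would not be below 1, and `hB` takes over.
  rcases le_or_gt S (D * a) with h2 | h2
  · refine le_trans ?_ (mul_le_mul_of_nonneg_right hYY hSD)
    have h3 : L ^ p * a ^ p ≤ Y ^ p * S ^ p := by
      rw [← Real.mul_rpow hL.le ha.le, ← Real.mul_rpow hY.le hS.le]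
      gcongr
    have h4 : S ^ (p - 1) ≤ D ^ (p - 1) * a ^ (p - 1) := by
      rw [← Real.mul_rpow hD0.le ha.le]
      exact Real.rpow_le_rpow hS.le h2 (by linarith)
    have h5 : L ^ p * a * a ^ (p - 1) ≤ Y ^ p * (S * D ^ (p - 1)) * a ^ (p - 1) := by
      calc L ^ p * a * a ^ (p - 1) = L ^ p * a ^ p := by rw [hap]; ring
        _ ≤ Y ^ p * S ^ p := h3
        _ = Y ^ p * S * S ^ (p - 1) := by rw [hSp]; ring
        _ ≤ Y ^ p * S * (D ^ (p - 1) * a ^ (p - 1)) := by gcongr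
        _ = _ := by ring
    exact le_of_mul_le_mul_right h5 hap0
  · have hDa : 0 < D * a / S := by positivity
    have hlow : δ ^ (γ * p) < D * a / S := by
      rw [lt_div_iff₀ hS]
      calc δ ^ (γ * p) * S = D * (S * δ ^ (γ * (p - 1) + 2 * γ + 1)) := by
            have : δ ^ (γ * p) = D * δ ^ (γ * (p - 1) + 2 * γ + 1) := by
              rw [hD, ← Real.rpow_add hδ]; congr 1; ring
            rw [this]; ring
        _ < D * a := by gcongr
    have hup : D * a / S < 1 := (div_lt_one hS).2 h2
    -- For `γ = 0` the two boundary cases already exhaust everything, which is why `hC` is only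
    -- required for positive `γ`.
    have hγ0 : 0 < γ := by
      rcases hγ.eq_or_lt with h | h
      · rw [← h, zero_mul, Real.rpow_zero] at hlow
        linarith
      · exact h
    have hγp : 0 < γ * p := by positivity
    set ℓ := (D * a / S) ^ (γ * p)⁻¹ with hℓ
    have hℓ0 : 0 < ℓ := Real.rpow_pos_of_pos hDa _
    have hℓp : ℓ ^ (γ * p) = D * a / S := by
      rw [hℓ, ← Real.rpow_mul hDa.le, inv_mul_cancel₀ hγp.ne', Real.rpow_one]
    have hℓδ : δ ≤ ℓ := by
      rw [← Real.rpow_le_rpow_iff hδ.le hℓ0.le hγp, hℓp]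
      exact hlow.le
    have hℓ1 : ℓ ≤ 1 := Real.rpow_le_one hDa.le hup.le (by positivity)
    have h3 := hC hγ0 ℓ hℓδ hℓ1
    have h4 : D * ℓ ^ (-γ) * a = S * ℓ ^ (γ * (p - 1)) := by
      have : ℓ ^ (γ * (p - 1)) = ℓ ^ (γ * p) * ℓ ^ (-γ) := by
        rw [← Real.rpow_add hℓ0]; congr 1; ring
      rw [this, hℓp]
      field_simp
    rw [h4] at h3
    have h5 : L * a ≤ 2 * Y * (S * ℓ ^ (γ * (p - 1))) := by linarith
    have h6 : L ^ p * a ^ p ≤ (2 * Y) ^ p * (S ^ p * (D * a / S) ^ (p - 1)) := by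
      have e : (D * a / S) ^ (p - 1) = (ℓ ^ (γ * (p - 1))) ^ p := by
        rw [← hℓp, ← Real.rpow_mul hℓ0.le, ← Real.rpow_mul hℓ0.le]
        congr 1
        ring
      rw [e, ← Real.mul_rpow hL.le ha.le, ← Real.mul_rpow hS.le (by positivity),
        ← Real.mul_rpow (by positivity) (by positivity)]
      gcongr
    rw [Real.div_rpow (by positivity) hS.le, Real.mul_rpow hD0.le ha.le] at h6
    have h7 : L ^ p * a * a ^ (p - 1) ≤ (2 * Y) ^ p * (S * D ^ (p - 1)) * a ^ (p - 1) := by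
      calc L ^ p * a * a ^ (p - 1) = L ^ p * a ^ p := by rw [hap]; ring
        _ ≤ _ := h6
        _ = _ := by
          rw [hSp]
          field_simp
    exact le_of_mul_le_mul_right h7 hap0

variable {φ : ℝ → ℝ} {E : Set ℝ} {α : ℝ}

theorem card_interval_le (hE : E ⊆ Set.Icc 1 2) (hα : 0 ≤ α) {δ ℓ : ℝ} (hδ : 0 < δ) (hℓ : δ ≤ ℓ)
    (hℓ1 : ℓ ≤ 1) {F : Finset ℝ} (hF : IsDiscretization E δ F) (a : ℝ) :
    (({t ∈ F | t ∈ Set.Icc a (a + ℓ)} : Finset ℝ).card : ℝ) ≤ 2 * (assouadSup E α δ * ℓ ^ α) := by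
  have hℓ0 : 0 < ℓ := hδ.trans_le hℓ
  have h1 : ({t ∈ F | t ∈ Set.Icc a (a + ℓ)} : Finset ℝ).card ≤
      2 * coverNum (E ∩ Set.Icc a (a + ℓ)) δ := by
    refine card_sep_le_coverNum hδ (Set.inter_subset_left.trans hE) (hF.isSep.mono ?_) ?_
    · exact_mod_cast Finset.filter_subset _ _
    · intro t ht
      have ht := Finset.mem_filter.1 (Finset.mem_coe.1 ht)
      exact ⟨hF.subset ht.1, ht.2⟩
  have h2 := le_assouadSup (E := E) hE hα hδ (a := a) (b := a + ℓ) (by linarith) (by linarith)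
  rw [add_sub_cancel_left, Real.rpow_neg hℓ0.le, inv_mul_le_iff₀ (Real.rpow_pos_of_pos hℓ0 _)] at h2
  calc _ ≤ ((2 * coverNum (E ∩ Set.Icc a (a + ℓ)) δ : ℕ) : ℝ) := by exact_mod_cast h1
    _ ≤ _ := by push_cast; linarith

theorem card_discretization_le (hE : E ⊆ Set.Icc 1 2) (hα : 0 ≤ α) {δ : ℝ} (hδ : 0 < δ)
    (hδ1 : δ ≤ 1) {F : Finset ℝ} (hF : IsDiscretization E δ F) :
    (F.card : ℝ) ≤ 2 * assouadSup E α δ := by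
  have h := card_interval_le hE hα hδ hδ1 le_rfl hF 1
  rw [Real.one_rpow, mul_one] at h
  convert h using 3
  symm
  refine Finset.filter_true_of_mem fun t ht => ?_
  have := hE (hF.subset ht)
  norm_num
  exact this

/-- The near times lie in three consecutive cells of length `ℓ`, hence `6 = 3 · 2`. -/
theorem card_near_le (hE : E ⊆ Set.Icc 1 2) (hα : 0 ≤ α) {δ ℓ : ℝ} (hδ : 0 < δ) (hℓ : δ ≤ ℓ)
    (hℓ1 : ℓ ≤ 1) {F : Finset ℝ} (hF : IsDiscretization E δ F) (t : ℝ) :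
    (({t' ∈ F | ¬ 2 ≤ |⌊t / ℓ⌋ - ⌊t' / ℓ⌋|} : Finset ℝ).card : ℝ) ≤
      6 * (assouadSup E α δ * ℓ ^ α) := by
  have hℓ0 : 0 < ℓ := hδ.trans_le hℓ
  set I : ℤ → Finset ℝ := fun e =>
    {t' ∈ F | t' ∈ Set.Icc ((⌊t / ℓ⌋ + e : ℤ) * ℓ) ((⌊t / ℓ⌋ + e : ℤ) * ℓ + ℓ)} with hI
  have hsub : ({t' ∈ F | ¬ 2 ≤ |⌊t / ℓ⌋ - ⌊t' / ℓ⌋|} : Finset ℝ) ⊆ (I (-1) ∪ I 0) ∪ I 1 := by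
    intro t' ht'
    obtain ⟨hF', hn⟩ := Finset.mem_filter.1 ht'
    have key : ∀ e : ℤ, ⌊t' / ℓ⌋ = ⌊t / ℓ⌋ + e → t' ∈ I e := by
      intro e he
      refine Finset.mem_filter.2 ⟨hF', ?_⟩
      rw [← he]
      have h1 := Int.floor_le (t' / ℓ)
      have h2 := Int.lt_floor_add_one (t' / ℓ)
      rw [le_div_iff₀ hℓ0] at h1
      rw [div_lt_iff₀ hℓ0] at h2
      exact ⟨h1, by linarith⟩
    have h3 : ⌊t' / ℓ⌋ = ⌊t / ℓ⌋ + -1 ∨ ⌊t' / ℓ⌋ = ⌊t / ℓ⌋ + 0 ∨ ⌊t' / ℓ⌋ = ⌊t / ℓ⌋ + 1 := by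
      rcases abs_cases (⌊t / ℓ⌋ - ⌊t' / ℓ⌋) with ⟨h1, h2⟩ | ⟨h1, h2⟩ <;> omega
    simp only [Finset.mem_union]
    rcases h3 with h | h | h
    · exact Or.inl (Or.inl (key _ h))
    · exact Or.inl (Or.inr (key _ h))
    · exact Or.inr (key _ h)
  have h1 : ∀ e, ((I e).card : ℝ) ≤ 2 * (assouadSup E α δ * ℓ ^ α) := fun e =>
    card_interval_le hE hα hδ hℓ hℓ1 hF _
  have h2 : ({t' ∈ F | ¬ 2 ≤ |⌊t / ℓ⌋ - ⌊t' / ℓ⌋|} : Finset ℝ).card ≤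
      (I (-1)).card + (I 0).card + (I 1).card :=
    (Finset.card_le_card hsub).trans ((Finset.card_union_le _ _).trans
      (Nat.add_le_add_right (Finset.card_union_le _ _) _))
  have h3 : (({t' ∈ F | ¬ 2 ≤ |⌊t / ℓ⌋ - ⌊t' / ℓ⌋|} : Finset ℝ).card : ℝ) ≤
      (I (-1)).card + (I 0).card + (I 1).card := by exact_mod_cast h2
  linarith [h1 (-1), h1 0, h1 1]

/-- The weak type estimate for the square function. -/
theorem exists_weak_type {n : ℕ} (hφ : ContDiff ℝ (⊤ : ℕ∞) φ)
    (hs : Function.support φ ⊆ Set.Ioo (1 / 4) 4) (hE : E ⊆ Set.Icc 1 2) (hne : E.Nonempty)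
    {p : ℝ} (hp : 1 ≤ p) :
    ∃ C : ℝ, 0 < C ∧ ∀ (j : ℕ) (F : Finset ℝ), IsDiscretization E (scale j) F →
      ∀ (f : Lp ℂ 2 (volume : Measure (EuclideanSpace ℝ (Fin (n + 1))))) (l : ℝ), 0 < l →
      (l ^ 2) ^ p * volume.real {x | l ^ 2 < squareFn φ j F f x} ≤
        C * (assouadSup E ((n : ℝ) / 2 * (p - 1)) (scale j) *
          ((scale j) ^ (-((n : ℝ) / 2 + 1))) ^ (p - 1)) * (‖f‖ ^ 2) ^ p := by
  have hV : Module.finrank ℝ (EuclideanSpace ℝ (Fin (n + 1))) = n + 1 := by simp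
  obtain ⟨Φ, hΦ, hb⟩ := exists_abs_le_of_support hφ.continuous hs
  obtain ⟨C₁, hC₁, hfull⟩ := exists_norm_sum_waveKernel_le hV hφ.continuous hs
  have hfar : ∃ C : ℝ, 0 < C ∧ (1 ≤ n → ∀ δ ℓ : ℝ, 0 < δ → δ ≤ ℓ → ∀ F : Finset ℝ, IsSep δ F →
      ∀ (c c' : ℝ → ℂ) (z : EuclideanSpace ℝ (Fin (n + 1))),
      ‖∑ t ∈ F, ∑ t' ∈ F, if 2 ≤ |⌊t / ℓ⌋ - ⌊t' / ℓ⌋| then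
          c t * (starRingEnd ℂ) (c' t') * waveKernel φ δ (t - t') z else 0‖ ≤
        C * δ⁻¹ ^ (n + 1) * (ℓ / δ) ^ (-(n : ℝ) / 2) *
          (∑ t ∈ F, ‖c t‖ ^ 2 + ∑ t ∈ F, ‖c' t‖ ^ 2)) := by
    rcases Nat.eq_zero_or_pos n with h | h
    · exact ⟨1, one_pos, fun h' => by omega⟩
    · obtain ⟨C, hC, h'⟩ := exists_norm_sum_far_waveKernel_le h hV hφ hs
      exact ⟨C, hC, fun _ => h'⟩
  obtain ⟨C₂, hC₂, hfar⟩ := hfar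
  set K := 2 * C₁ + 6 * Φ ^ 2 + 2 * C₂ with hK
  have hK0 : 0 < K := by positivity
  refine ⟨(2 * K) ^ p, by positivity, fun j F hF f l hl => ?_⟩
  have hδ := scale_pos j
  have hδ1 := scale_le_one j
  set δ := scale j with hδdef
  have hn0 : (0 : ℝ) ≤ n := n.cast_nonneg
  have hα : 0 ≤ (n : ℝ) / 2 * (p - 1) := mul_nonneg (by positivity) (by linarith)
  set S := assouadSup E ((n : ℝ) / 2 * (p - 1)) δ with hSdef
  have hS : 0 < S := lt_of_lt_of_le one_pos (one_le_assouadSup hE hne hα hδ hδ1)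
  set a := volume.real {x | l ^ 2 < squareFn φ j F f x} with ha
  have ha0 : 0 ≤ a := measureReal_nonneg
  have hD0 : 0 < δ ^ (-((n : ℝ) / 2 + 1)) := Real.rpow_pos_of_pos hδ _
  rcases ha0.eq_or_lt with h0 | hapos
  · rw [← h0, mul_zero]
    positivity
  have hf2 : 0 ≤ ‖f‖ ^ 2 := by positivity
  have hmul : (2 * K) ^ p * (S * (δ ^ (-((n : ℝ) / 2 + 1))) ^ (p - 1)) * (‖f‖ ^ 2) ^ p =
      (2 * (K * ‖f‖ ^ 2)) ^ p * (S * (δ ^ (-((n : ℝ) / 2 + 1))) ^ (p - 1)) := by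
    rw [← mul_assoc 2 K, Real.mul_rpow (by positivity) hf2]
    ring
  rw [hmul]
  refine rpow_mul_le_of_optimize (by positivity) hp hδ hapos hS (by positivity) ?_ ?_ ?_
  -- All pairs are declared far: there is no near part, and the factor `a²` cancels to leave an
  -- upper bound for the level.
  · have h := level_set_bound f hφ.continuous hs hb j F (fun _ _ => True) (fun _ _ h => h)
      (N := 0) (B := C₁ * δ⁻¹ ^ (n + 1)) (fun t _ => by simp) le_rfl
      (fun c c' z => by
        simp only [if_true]
        exact hfull δ hδ F F hF.isSep hF.isSep c c' z) (by positivity) hl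
    rw [← ha] at h
    have e : δ ^ (-(2 * ((n : ℝ) / 2) + 1)) = δ⁻¹ ^ (n + 1) := by
      rw [Real.rpow_neg hδ.le, ← Real.inv_rpow hδ.le, ← Real.rpow_natCast]
      congr 1
      push_cast
      ring
    rw [e]
    have h2 : l ^ 2 * a ^ 2 ≤ (‖f‖ ^ 2 * (2 * C₁ * δ⁻¹ ^ (n + 1))) * a ^ 2 := by
      calc l ^ 2 * a ^ 2 = (l * a) ^ 2 := by ring
        _ ≤ _ := h
        _ = _ := by ring
    have h3 := le_of_mul_le_mul_right h2 (by positivity)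
    refine h3.trans ?_
    have hd : 0 < δ⁻¹ := inv_pos.2 hδ
    calc _ = 2 * C₁ * (‖f‖ ^ 2 * δ⁻¹ ^ (n + 1)) := by ring
      _ ≤ K * (‖f‖ ^ 2 * δ⁻¹ ^ (n + 1)) := by
          gcongr
          rw [hK]
          have : 0 ≤ Φ ^ 2 := by positivity
          linarith
      _ = _ := by ring
  -- All pairs are declared near: this is the pure `L²` bound, with the number of all times.
  · have h := level_set_bound f hφ.continuous hs hb j F (fun _ _ => False) (fun _ _ h => h)
      (N := 2 * S) (B := 0) (fun t _ => by
        simpa using card_discretization_le hE hα hδ hδ1 hF) (by positivity)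
      (fun c c' z => by simp) le_rfl hl
    rw [← ha] at h
    have h2 : (l ^ 2 * a) * a ≤ (‖f‖ ^ 2 * (2 * S * Φ ^ 2)) * a := by
      calc (l ^ 2 * a) * a = (l * a) ^ 2 := by ring
        _ ≤ _ := h
        _ = _ := by ring
    have h3 := le_of_mul_le_mul_right h2 hapos
    refine h3.trans ?_
    calc _ = 2 * Φ ^ 2 * (‖f‖ ^ 2 * S) := by ring
      _ ≤ K * (‖f‖ ^ 2 * S) := by
          gcongr
          rw [hK]
          have : 0 ≤ Φ ^ 2 := by positivity
          linarith
      _ = _ := by ring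
  · intro hnp ℓ hℓ hℓ1
    have hn1 : 1 ≤ n := by
      rcases Nat.eq_zero_or_pos n with h | h
      · rw [h] at hnp; simp at hnp
      · exact h
    have hℓ0 : 0 < ℓ := hδ.trans_le hℓ
    have hd : 0 < δ⁻¹ := inv_pos.2 hδ
    have h := level_set_bound f hφ.continuous hs hb j F (fun t t' => 2 ≤ |⌊t / ℓ⌋ - ⌊t' / ℓ⌋|)
      (fun t t' h => by rwa [abs_sub_comm])
      (N := 6 * (S * ℓ ^ ((n : ℝ) / 2 * (p - 1))))
      (B := C₂ * δ⁻¹ ^ (n + 1) * (ℓ / δ) ^ (-(n : ℝ) / 2))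
      (fun t _ => card_near_le hE hα hδ hℓ hℓ1 hF t) (by positivity)
      (fun c c' z => hfar hn1 δ ℓ hδ hℓ F hF.isSep c c' z) (by positivity) hl
    rw [← ha] at h
    have e : δ⁻¹ ^ (n + 1) * (ℓ / δ) ^ (-(n : ℝ) / 2) =
        δ ^ (-((n : ℝ) / 2 + 1)) * ℓ ^ (-((n : ℝ) / 2)) := by
      rw [Real.div_rpow hℓ0.le hδ.le, neg_div, ← Real.rpow_natCast, Real.inv_rpow hδ.le,
        ← Real.rpow_neg hδ.le, div_eq_mul_inv, ← Real.rpow_neg hδ.le]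
      have : δ ^ (-((n : ℝ) / 2 + 1)) = δ ^ (-((n + 1 : ℕ) : ℝ)) * δ ^ (-(-((n : ℝ) / 2))) := by
        rw [← Real.rpow_add hδ]; congr 1; push_cast; ring
      rw [this]
      ring
    set U := S * ℓ ^ ((n : ℝ) / 2 * (p - 1)) with hU
    set W := δ ^ (-((n : ℝ) / 2 + 1)) * ℓ ^ (-((n : ℝ) / 2)) with hW
    have hU0 : 0 ≤ U := by positivity
    have hW0 : 0 ≤ W := by positivity
    have h2 : (l ^ 2 * a) * a ≤ (‖f‖ ^ 2 * (6 * Φ ^ 2 * U + 2 * C₂ * (W * a))) * a := by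
      calc (l ^ 2 * a) * a = (l * a) ^ 2 := by ring
        _ ≤ _ := h
        _ = _ := by rw [mul_assoc C₂, e]; ring
    have h3 := le_of_mul_le_mul_right h2 hapos
    refine h3.trans ?_
    calc _ ≤ ‖f‖ ^ 2 * (K * U + K * (W * a)) := by
          have : 0 ≤ Φ ^ 2 := by positivity
          gcongr <;> rw [hK] <;> linarith
      _ = _ := by ring

end WeakType

/-! ### From weak to strong type, and sufficiency. -/

section StrongType

variable {φ : ℝ → ℝ} {E : Set ℝ}

/-- The `ℓ^r` norms of a finite family decrease in `r`. -/
theorem rpow_sum_le_rpow_sum {ι : Type*} (F : Finset ι) {a : ι → ℝ} (ha : ∀ t ∈ F, 0 ≤ a t)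
    {p r : ℝ} (hp : 0 < p) (hpr : p ≤ r) :
    (∑ t ∈ F, a t ^ r) ^ (1 / r) ≤ (∑ t ∈ F, a t ^ p) ^ (1 / p) := by
  have hr : 0 < r := hp.trans_le hpr
  set T := ∑ t ∈ F, a t ^ p with hT
  have hT0 : 0 ≤ T := Finset.sum_nonneg fun t ht => Real.rpow_nonneg (ha t ht) _
  have hle : ∀ t ∈ F, a t ^ p ≤ T := fun t ht =>
    Finset.single_le_sum (f := fun t => a t ^ p) (fun t ht => Real.rpow_nonneg (ha t ht) _) ht
  have h1 : ∑ t ∈ F, a t ^ r ≤ T ^ (r / p) := by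
    have h2 : ∀ t ∈ F, a t ^ r ≤ T ^ (r / p - 1) * a t ^ p := by
      intro t ht
      have h0 : 0 ≤ a t ^ p := Real.rpow_nonneg (ha t ht) _
      have hrp : 0 ≤ r / p - 1 := by rw [sub_nonneg, one_le_div hp]; exact hpr
      calc a t ^ r = (a t ^ p) ^ (r / p - 1 + 1) := by
            rw [← Real.rpow_mul (ha t ht)]; congr 1; field_simp; ring
        _ = (a t ^ p) ^ (r / p - 1) * a t ^ p := by
            rw [Real.rpow_add_of_nonneg h0 hrp zero_le_one, Real.rpow_one]
        _ ≤ _ := by gcongr; exact hle t ht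
    calc _ ≤ ∑ t ∈ F, T ^ (r / p - 1) * a t ^ p := Finset.sum_le_sum h2
      _ = T ^ (r / p - 1) * T := by rw [← Finset.mul_sum]
      _ = T ^ (r / p) := by
        have hrp : 0 ≤ r / p - 1 := by rw [sub_nonneg, one_le_div hp]; exact hpr
        nth_rewrite 2 [← Real.rpow_one T]
        rw [← Real.rpow_add_of_nonneg hT0 hrp zero_le_one]
        congr 1; ring
  calc _ ≤ (T ^ (r / p)) ^ (1 / r) := by
        refine Real.rpow_le_rpow (Finset.sum_nonneg fun t ht => Real.rpow_nonneg (ha t ht) _) h1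
          (by positivity)
    _ = _ := by rw [← Real.rpow_mul hT0]; congr 1; field_simp

/-- If `h ≤ m`, the first term suffices. Otherwise the least `k` with `h ≤ 4^k m` is positive, and
the summand `i = k - 1` alone dominates. -/
theorem rpow_le_dyadic_sum {h m p : ℝ} (hm : 0 ≤ m) (hh : 0 ≤ h) (hp : 1 ≤ p) {N : ℕ}
    (hN : h ≤ 4 ^ N * m) :
    h ^ p ≤ m ^ (p - 1) * h +
      ∑ i ∈ Finset.range N, if 4 ^ i * m < h then (4 ^ (i + 1) * m) ^ p else 0 := by
  classical
  have hex : ∃ k : ℕ, h ≤ 4 ^ k * m := ⟨N, hN⟩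
  have hsum0 : ∀ i ∈ Finset.range N,
      0 ≤ if 4 ^ i * m < h then (4 ^ (i + 1) * m) ^ p else 0 := by
    intro i _
    split_ifs <;> positivity
  rcases Nat.eq_zero_or_pos (Nat.find hex) with h0 | hpos
  · have h1 := Nat.find_spec hex
    rw [h0, pow_zero, one_mul] at h1
    have h2 : h ^ p ≤ m ^ (p - 1) * h := by
      calc h ^ p = h ^ (p - 1 + 1) := by congr 1; ring
        _ = h ^ (p - 1) * h := by
          rw [Real.rpow_add_of_nonneg hh (by linarith) zero_le_one, Real.rpow_one]
        _ ≤ _ := by gcongr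
    linarith [Finset.sum_nonneg hsum0]
  · obtain ⟨i, hi⟩ := Nat.exists_eq_succ_of_ne_zero hpos.ne'
    have h1 := Nat.find_spec hex
    have h2 : ¬ h ≤ 4 ^ i * m := Nat.find_min hex (by omega)
    have h3 : i < N := by
      have := Nat.find_min' hex hN
      omega
    rw [hi] at h1
    have h4 := Finset.single_le_sum hsum0 (Finset.mem_range.2 h3)
    rw [if_pos (not_le.1 h2)] at h4
    have h5 : h ^ p ≤ (4 ^ (i + 1) * m) ^ p := Real.rpow_le_rpow hh h1 (by linarith)
    have h6 : 0 ≤ m ^ (p - 1) * h := by positivity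
    linarith

theorem exists_squareFn_le (n : ℕ) (hφ : ContDiff ℝ (⊤ : ℕ∞) φ)
    (hs : Function.support φ ⊆ Set.Ioo (1 / 4) 4) (hE : E ⊆ Set.Icc 1 2) :
    ∃ c : ℕ, ∀ (j : ℕ) (F : Finset ℝ), IsDiscretization E (scale j) F →
      ∀ (f : Lp ℂ 2 (volume : Measure (EuclideanSpace ℝ (Fin (n + 1))))) x,
        squareFn φ j F f x ≤ 4 ^ (c * (1 + j)) * ‖f‖ ^ 2 := by
  obtain ⟨Φ, hΦ, hb⟩ := exists_abs_le_of_support hφ.continuous hs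
  set V := (volume : Measure (EuclideanSpace ℝ (Fin (n + 1)))).real (Metric.closedBall 0 1) with hV
  have hV0 : 0 ≤ V := measureReal_nonneg
  obtain ⟨c, hc⟩ := pow_unbounded_of_one_lt (6 * (Φ ^ 2 * V)) (by norm_num : (1 : ℝ) < 4)
  -- Bernstein gives `n + 1` factors `2^j` and the number of times one more. The power `4 ^ c`
  -- absorbs the constants.
  refine ⟨c + (n + 2), fun j F hF f x => ?_⟩
  have hδ := scale_pos j
  have hδ1 := scale_le_one j
  have hcard : (F.card : ℝ) ≤ 6 * (scale j)⁻¹ := by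
    have h1 := card_discretization_le hE le_rfl hδ hδ1 hF
    have h2 := assouadSup_le hE le_rfl hδ hδ1 (α := 0)
    rw [zero_add, Real.rpow_neg_one] at h2
    linarith
  have hinv : (scale j)⁻¹ = 2 ^ j := by
    rw [scale, Real.rpow_neg two_pos.le, inv_inv, Real.rpow_natCast]
  calc squareFn φ j F f x
      ≤ F.card • (Φ ^ 2 * V * (scale j)⁻¹ ^ (n + 1) * ‖f‖ ^ 2) :=
        Finset.sum_le_card_nsmul _ _ _ fun t _ => norm_wave_sq_le f hφ.continuous hs hb j t x
    _ = F.card * (Φ ^ 2 * V * (scale j)⁻¹ ^ (n + 1) * ‖f‖ ^ 2) := nsmul_eq_mul _ _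
    _ ≤ 6 * (scale j)⁻¹ * (Φ ^ 2 * V * (scale j)⁻¹ ^ (n + 1) * ‖f‖ ^ 2) := by gcongr
    _ = (6 * (Φ ^ 2 * V)) * (2 ^ j) ^ (n + 2) * ‖f‖ ^ 2 := by rw [hinv]; ring
    _ ≤ 4 ^ c * (4 ^ j) ^ (n + 2) * ‖f‖ ^ 2 := by gcongr; norm_num
    _ ≤ 4 ^ ((c + (n + 2)) * (1 + j)) * ‖f‖ ^ 2 := by
        rw [← pow_mul, ← pow_add]
        gcongr
        · norm_num
        · nlinarith

/-- Summing the level set estimate over dyadic levels. -/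
theorem exists_strong_type {n : ℕ} (hφ : ContDiff ℝ (⊤ : ℕ∞) φ)
    (hs : Function.support φ ⊆ Set.Ioo (1 / 4) 4) (hE : E ⊆ Set.Icc 1 2) (hne : E.Nonempty)
    {p : ℝ} (hp : 1 ≤ p) :
    ∃ C : ℝ, 0 < C ∧ ∀ (j : ℕ) (F : Finset ℝ), IsDiscretization E (scale j) F →
      ∀ (f : Lp ℂ 2 (volume : Measure (EuclideanSpace ℝ (Fin (n + 1))))),
      Integrable (fun x => squareFn φ j F f x ^ p) ∧
      ∫ x, squareFn φ j F f x ^ p ≤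
        C * (1 + j) * (assouadSup E ((n : ℝ) / 2 * (p - 1)) (scale j) *
          ((scale j) ^ (-((n : ℝ) / 2 + 1))) ^ (p - 1)) * (‖f‖ ^ 2) ^ p := by
  obtain ⟨Φ, hΦ, hb⟩ := exists_abs_le_of_support hφ.continuous hs
  obtain ⟨c, hc⟩ := exists_squareFn_le (φ := φ) n hφ hs hE
  obtain ⟨C, hC, hweak⟩ := exists_weak_type (n := n) hφ hs hE hne hp
  -- The first summand comes from the energy bound for the part linear in `H`. The second comes from
  -- `c(1 + j)` dyadic levels, each losing `4^p` against the weak type bound.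
  refine ⟨2 * Φ ^ 2 + c * (4 ^ p * C), by positivity, fun j F hF f => ?_⟩
  have hδ := scale_pos j
  have hδ1 := scale_le_one j
  have hα : 0 ≤ (n : ℝ) / 2 * (p - 1) := mul_nonneg (by positivity) (by linarith)
  set S := assouadSup E ((n : ℝ) / 2 * (p - 1)) (scale j) with hSdef
  have hS : 0 < S := lt_of_lt_of_le one_pos (one_le_assouadSup hE hne hα hδ hδ1)
  set D := ((scale j) ^ (-((n : ℝ) / 2 + 1))) ^ (p - 1) with hD
  have hD1 : 1 ≤ D := by
    refine Real.one_le_rpow ?_ (by linarith)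
    refine Real.one_le_rpow_of_pos_of_le_one_of_nonpos hδ hδ1 ?_
    have : (0 : ℝ) ≤ n := n.cast_nonneg
    linarith
  set m := ‖f‖ ^ 2 with hm
  have hm0 : 0 ≤ m := by positivity
  set H := squareFn φ j F f with hH
  have hH0 : ∀ x, 0 ≤ H x := squareFn_nonneg f φ j F
  have hHc : Continuous H := continuous_squareFn f hφ.continuous hs j F
  have hHi : Integrable H := integrable_squareFn f hφ.continuous hs j F
  have hHb : ∀ x, H x ≤ 4 ^ (c * (1 + j)) * m := hc j F hF f
  rcases hm0.eq_or_lt with hm0' | hmpos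
  · have hz : ∀ x, H x = 0 := fun x => le_antisymm (by simpa [← hm0'] using hHb x) (hH0 x)
    simp only [hz, Real.zero_rpow (by linarith : p ≠ 0)]
    exact ⟨integrable_zero _ _ _, by simp; positivity⟩
  have hms : ∀ i : ℕ, MeasurableSet {x | 4 ^ i * m < H x} := fun i =>
    (isOpen_lt continuous_const hHc).measurableSet
  have hfin : ∀ i : ℕ, volume {x | 4 ^ i * m < H x} < ∞ := fun i =>
    measure_squareFn_lt_top f hφ.continuous hs j F (by positivity)
  have hpt : ∀ x, H x ^ p ≤ m ^ (p - 1) * H x + ∑ i ∈ Finset.range (c * (1 + j)),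
      {x | 4 ^ i * m < H x}.indicator (fun _ => (4 ^ (i + 1) * m) ^ p) x := by
    intro x
    refine (rpow_le_dyadic_sum hm0 (hH0 x) hp (hHb x)).trans (le_of_eq ?_)
    congr 1
  have hind : ∀ i : ℕ,
      Integrable ({x | 4 ^ i * m < H x}.indicator fun _ => ((4 : ℝ) ^ (i + 1) * m) ^ p) :=
    fun i => (integrable_indicator_iff (hms i)).2 (integrableOn_const (hfin i).ne)
  have hG : Integrable fun x => m ^ (p - 1) * H x + ∑ i ∈ Finset.range (c * (1 + j)),
      {x | 4 ^ i * m < H x}.indicator (fun _ => (4 ^ (i + 1) * m) ^ p) x :=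
    (hHi.const_mul _).add (integrable_finsetSum _ fun i _ => hind i)
  have hHp : Integrable fun x => H x ^ p := by
    refine hG.mono' (hHc.rpow_const fun x => Or.inr (by linarith)).aestronglyMeasurable
      (Filter.Eventually.of_forall fun x => ?_)
    rw [Real.norm_of_nonneg (Real.rpow_nonneg (hH0 x) _)]
    exact hpt x
  refine ⟨hHp, (integral_mono hHp hG hpt).trans ?_⟩
  rw [integral_add (hHi.const_mul _) (integrable_finsetSum _ fun i _ => hind i),
    integral_const_mul, integral_finsetSum _ fun i _ => hind i]
  have h1 : m ^ (p - 1) * ∫ x, H x ≤ 2 * Φ ^ 2 * (S * D) * m ^ p := by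
    have hcard := card_discretization_le hE hα hδ hδ1 hF
    calc m ^ (p - 1) * ∫ x, H x ≤ m ^ (p - 1) * (F.card * (Φ ^ 2 * m)) := by
          gcongr
          exact integral_squareFn_le f hφ.continuous hs hb j F
      _ ≤ m ^ (p - 1) * ((2 * S) * (Φ ^ 2 * m)) := by gcongr
      _ = 2 * Φ ^ 2 * (S * 1) * (m ^ (p - 1) * m) := by ring
      _ = 2 * Φ ^ 2 * (S * 1) * m ^ p := by
          rw [Real.rpow_sub_one hmpos.ne', div_mul_cancel₀ _ hmpos.ne']
      _ ≤ _ := by gcongr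
  have h2 : ∀ i ∈ Finset.range (c * (1 + j)),
      ∫ x, {x | 4 ^ i * m < H x}.indicator (fun _ => ((4 : ℝ) ^ (i + 1) * m) ^ p) x ≤
        4 ^ p * C * (S * D) * m ^ p := by
    intro i _
    rw [integral_indicator_const _ (hms i), smul_eq_mul]
    have hl : (4 : ℝ) ^ i * m = (2 ^ i * ‖f‖) ^ 2 := by
      rw [hm, mul_pow, ← pow_mul, mul_comm i, pow_mul]; norm_num
    have hfpos : 0 < ‖f‖ := by
      rcases (norm_nonneg f).eq_or_lt with h | h
      · rw [hm, ← h] at hmpos; simp at hmpos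
      · exact h
    have hw := hweak j F hF f (2 ^ i * ‖f‖) (by positivity)
    rw [← hl] at hw
    calc _ = 4 ^ p * ((4 ^ i * m) ^ p * volume.real {x | 4 ^ i * m < H x}) := by
          rw [pow_succ', mul_assoc 4, Real.mul_rpow (x := 4) (by norm_num) (by positivity)]
          ring
      _ ≤ 4 ^ p * (C * (S * D) * m ^ p) := by gcongr
      _ = _ := by ring
  calc _ ≤ 2 * Φ ^ 2 * (S * D) * m ^ p +
        (Finset.range (c * (1 + j))).card • (4 ^ p * C * (S * D) * m ^ p) :=
        add_le_add h1 (Finset.sum_le_card_nsmul _ _ _ h2)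
    _ = (2 * Φ ^ 2 + c * (4 ^ p * C) * (1 + j)) * ((S * D) * m ^ p) := by
        rw [Finset.card_range, nsmul_eq_mul]; push_cast; ring
    _ ≤ ((2 * Φ ^ 2 + c * (4 ^ p * C)) * (1 + j)) * ((S * D) * m ^ p) := by
        gcongr
        have : 0 ≤ 2 * Φ ^ 2 * (j : ℝ) := by positivity
        linarith
    _ = _ := by ring

theorem exists_one_add_le_rpow {η : ℝ} (hη : 0 < η) :
    ∃ K : ℝ, 0 < K ∧ ∀ j : ℕ, 1 + (j : ℝ) ≤ K * scale j ^ (-η) := by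
  have hL : 0 < Real.log 2 := Real.log_pos one_lt_two
  refine ⟨1 + 1 / (η * Real.log 2), by positivity, fun j => ?_⟩
  have h1 : 1 + (j : ℝ) * (η * Real.log 2) ≤ scale j ^ (-η) := by
    rw [scale, ← Real.rpow_mul two_pos.le, Real.rpow_def_of_pos two_pos]
    have := Real.add_one_le_exp (Real.log 2 * (-(j : ℝ) * -η))
    linarith
  calc 1 + (j : ℝ) ≤ (1 + 1 / (η * Real.log 2)) * (1 + (j : ℝ) * (η * Real.log 2)) := by
        have e : (1 + 1 / (η * Real.log 2)) * (1 + (j : ℝ) * (η * Real.log 2)) =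
          1 + j + 1 / (η * Real.log 2) + j * (η * Real.log 2) := by field_simp; ring
        rw [e]
        have : 0 ≤ 1 / (η * Real.log 2) + j * (η * Real.log 2) := by positivity
        linarith
    _ ≤ _ := by gcongr

theorem waveNorm_le {n : ℕ} (hφ : Continuous φ) (hs : Function.support φ ⊆ Set.Ioo (1 / 4) 4)
    {q r : ℝ} (hr : 2 ≤ r) (hrq : r ≤ q) (j : ℕ) (F : Finset ℝ)
    (f : Lp ℂ 2 (volume : Measure (EuclideanSpace ℝ (Fin (n + 1)))))
    (hi : Integrable fun x => squareFn φ j F f x ^ (q / 2)) :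
    waveNorm φ q r j F f ≤ ENNReal.ofReal ((∫ x, squareFn φ j F f x ^ (q / 2)) ^ (1 / q)) := by
  have hq : 0 < q := by linarith
  have hmono : waveNorm φ q r j F f ≤
      eLpNorm (fun x => squareFn φ j F f x ^ (1 / 2 : ℝ)) (ENNReal.ofReal q) volume := by
    refine eLpNorm_mono_real fun x => ?_
    rw [Real.norm_of_nonneg (by positivity)]
    refine (rpow_sum_le_rpow_sum F (fun t _ => norm_nonneg _) two_pos hr).trans (le_of_eq ?_)
    simp [squareFn]
  refine hmono.trans (le_of_eq ?_)
  have hpow : ∀ x, ‖squareFn φ j F f x ^ (1 / 2 : ℝ)‖ ^ q = squareFn φ j F f x ^ (q / 2) := by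
    intro x
    have h0 := squareFn_nonneg f φ j F x
    rw [Real.norm_of_nonneg (Real.rpow_nonneg h0 _), ← Real.rpow_mul h0]
    congr 1; ring
  have hq0 : ENNReal.ofReal q ≠ 0 := by simpa using hq
  have hmem : MemLp (fun x => squareFn φ j F f x ^ (1 / 2 : ℝ)) (ENNReal.ofReal q) volume := by
    refine (integrable_norm_rpow_iff ?_ hq0 ENNReal.ofReal_ne_top).1 ?_
    · exact ((continuous_squareFn f hφ hs j F).rpow_const
        fun x => Or.inr (by norm_num)).aestronglyMeasurable
    · rw [ENNReal.toReal_ofReal hq.le]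
      simpa only [hpow] using hi
  rw [hmem.eLpNorm_eq_integral_rpow_norm hq0 ENNReal.ofReal_ne_top, ENNReal.toReal_ofReal hq.le]
  rw [one_div q]
  congr 2
  exact integral_congr_ae (Filter.Eventually.of_forall hpow)

theorem mul_critExp (n : ℕ) (E : Set ℝ) {q : ℝ} (hq : 0 < q) :
    q * critExp (n + 1) E q = ((n : ℝ) / 2 + 1) * (q / 2 - 1) +
      legendreAssouad E ((n : ℝ) / 2 * (q / 2 - 1)) := by
  have e : (((n + 1 : ℕ) : ℝ) - 1) / 2 * (q / 2 - 1) = (n : ℝ) / 2 * (q / 2 - 1) := by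
    push_cast; ring
  rw [critExp, e]
  push_cast
  field_simp
  ring

/-- The sufficiency of `s > s_E(q)`. -/
theorem exists_waveNorm_le {n : ℕ} (hφ : ContDiff ℝ (⊤ : ℕ∞) φ)
    (hs : Function.support φ ⊆ Set.Ioo (1 / 4) 4) (hE : E ⊆ Set.Icc 1 2) (hne : E.Nonempty)
    {q : ℝ} (hq : 2 ≤ q) {s : ℝ} (hsE : critExp (n + 1) E q < s) :
    ∃ C : ℝ, 0 < C ∧ ∀ r : ℝ, 2 ≤ r → r ≤ q → ∀ j : ℕ,
      ∀ F : Finset ℝ, IsDiscretization E (scale j) F →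
        ∀ f : Lp ℂ 2 (volume : Measure (EuclideanSpace ℝ (Fin (n + 1)))),
          waveNorm φ q r j F f ≤ ENNReal.ofReal (C * 2 ^ ((j : ℝ) * s) * ‖f‖) := by
  have hq0 : 0 < q := by linarith
  have hp : 1 ≤ q / 2 := by linarith
  have hα : 0 ≤ (n : ℝ) / 2 * (q / 2 - 1) := mul_nonneg (by positivity) (by linarith)
  have hcrit := mul_critExp n E hq0
  have hlt := mul_lt_mul_of_pos_left hsE hq0
  set ν := legendreAssouad E ((n : ℝ) / 2 * (q / 2 - 1)) with hν
  -- Half of `q (s - s_E(q))`: one half pays for exceeding the `limsup`, the other for the factor `1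
  -- + j`.
  set η := (q * s - ((n : ℝ) / 2 + 1) * (q / 2 - 1) - ν) / 2 with hη
  have hη0 : 0 < η := by rw [hη]; linarith
  obtain ⟨C, hC, hst⟩ := exists_strong_type (n := n) hφ hs hE hne hp
  obtain ⟨A, hA, hS⟩ := exists_assouadSup_le_rpow hE hne hα (κ := ν + η) (by linarith)
  obtain ⟨K, hK, hj⟩ := exists_one_add_le_rpow hη0
  refine ⟨(C * K * A) ^ (1 / q), by positivity, fun r hr hrq j F hF f => ?_⟩
  have hδ := scale_pos j
  obtain ⟨hi, hle⟩ := hst j F hF f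
  refine (waveNorm_le hφ.continuous hs hr hrq j F f hi).trans (ENNReal.ofReal_le_ofReal ?_)
  have hS0 : 0 ≤ assouadSup E ((n : ℝ) / 2 * (q / 2 - 1)) (scale j) :=
    zero_le_one.trans (one_le_assouadSup hE hne hα hδ (scale_le_one j))
  have hbound : ∫ x, squareFn φ j F f x ^ (q / 2) ≤
      (C * K * A) * (2 ^ ((j : ℝ) * s) * ‖f‖) ^ q := by
    have hexp : scale j ^ (-η) * (scale j ^ (-(ν + η)) *
        (scale j ^ (-((n : ℝ) / 2 + 1))) ^ (q / 2 - 1)) = (2 ^ ((j : ℝ) * s)) ^ q := by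
      rw [← Real.rpow_mul hδ.le, ← Real.rpow_add hδ, ← Real.rpow_add hδ, scale,
        ← Real.rpow_mul two_pos.le, ← Real.rpow_mul two_pos.le]
      congr 1
      rw [hη]; ring
    have hf : (‖f‖ ^ 2) ^ (q / 2) = ‖f‖ ^ q := by
      rw [← Real.rpow_natCast, ← Real.rpow_mul (norm_nonneg f)]
      congr 1; push_cast; ring
    calc _ ≤ _ := hle
      _ ≤ C * (K * scale j ^ (-η)) * ((A * scale j ^ (-(ν + η))) *
          (scale j ^ (-((n : ℝ) / 2 + 1))) ^ (q / 2 - 1)) * (‖f‖ ^ 2) ^ (q / 2) := by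
          gcongr
          · exact hj j
          · exact hS _ hδ (scale_le_one j)
      _ = (C * K * A) * (scale j ^ (-η) * (scale j ^ (-(ν + η)) *
          (scale j ^ (-((n : ℝ) / 2 + 1))) ^ (q / 2 - 1))) * (‖f‖ ^ 2) ^ (q / 2) := by ring
      _ = _ := by
          rw [hexp, hf, Real.mul_rpow (by positivity) (norm_nonneg f)]
          ring
  calc _ ≤ ((C * K * A) * (2 ^ ((j : ℝ) * s) * ‖f‖) ^ q) ^ (1 / q) := by
        refine Real.rpow_le_rpow (integral_nonneg fun x =>
          Real.rpow_nonneg (squareFn_nonneg f φ j F x) _) hbound (by positivity)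
    _ = _ := by
        rw [Real.mul_rpow (by positivity) (by positivity), ← Real.rpow_mul (by positivity),
          mul_one_div_cancel hq0.ne', Real.rpow_one]
        ring

end StrongType

/-! ### Knapp examples. -/

section Knapp

/-- An axis-parallel box in Euclidean space. -/
def eBox {ι : Type*} (u v : ι → ℝ) : Set (EuclideanSpace ℝ ι) :=
  {x | ∀ i, u i ≤ x i ∧ x i ≤ v i}

theorem measurableSet_eBox {ι : Type*} [Fintype ι] (u v : ι → ℝ) : MeasurableSet (eBox u v) := by
  have : eBox u v = WithLp.ofLp ⁻¹' Set.Icc u v := by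
    ext x; simp [eBox, Set.mem_Icc, Pi.le_def, forall_and]
  rw [this]
  exact (PiLp.volume_preserving_ofLp ι).measurable measurableSet_Icc

theorem volume_eBox {ι : Type*} [Fintype ι] (u v : ι → ℝ) :
    volume (eBox u v) = ∏ i, ENNReal.ofReal (v i - u i) := by
  have : eBox u v = WithLp.ofLp ⁻¹' Set.Icc u v := by
    ext x; simp [eBox, Set.mem_Icc, Pi.le_def, forall_and]
  rw [this, (PiLp.volume_preserving_ofLp ι).measure_preimage measurableSet_Icc.nullMeasurableSet,
    Real.volume_Icc_pi]

theorem volume_real_eBox_cons {n : ℕ} {u₀ v₀ w : ℝ} (h : u₀ ≤ v₀) (hw : 0 ≤ w) :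
    volume.real (eBox (Fin.cons u₀ fun _ : Fin n => -w) (Fin.cons v₀ fun _ => w)) =
      (v₀ - u₀) * (2 * w) ^ n := by
  rw [measureReal_def, volume_eBox, Fin.prod_univ_succ]
  simp only [Fin.cons_zero, Fin.cons_succ, Finset.prod_const, Finset.card_univ, Fintype.card_fin,
    ENNReal.toReal_mul, ENNReal.toReal_pow]
  rw [ENNReal.toReal_ofReal (by linarith), ENNReal.toReal_ofReal (by linarith)]
  ring

theorem volume_eBox_lt_top {ι : Type*} [Fintype ι] (u v : ι → ℝ) : volume (eBox u v) < ∞ := by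
  rw [volume_eBox]
  exact ENNReal.prod_lt_top fun i _ => ENNReal.ofReal_lt_top

variable {φ : ℝ → ℝ} {E : Set ℝ} {n : ℕ}

/-- The `L²` function whose Fourier transform is `1_D(ξ) e^{2πi t₀|ξ|}`. -/
theorem exists_fourier_eq_indicator {d : ℕ} {D : Set (EuclideanSpace ℝ (Fin d))}
    (hD : MeasurableSet D) (hDfin : volume D < ∞) (t₀ : ℝ) :
    ∃ f : Lp ℂ 2 (volume : Measure (EuclideanSpace ℝ (Fin d))),
      ((𝓕 f : Lp ℂ 2 (volume : Measure (EuclideanSpace ℝ (Fin d)))) : _ → ℂ) =ᵐ[volume]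
        D.indicator (fun ξ => echar (t₀ * ‖ξ‖)) ∧ ‖f‖ ^ 2 = volume.real D := by
  have hc : Continuous fun ξ : EuclideanSpace ℝ (Fin d) => echar (t₀ * ‖ξ‖) := by
    unfold echar; fun_prop
  have hg : MemLp (D.indicator fun ξ : EuclideanSpace ℝ (Fin d) => echar (t₀ * ‖ξ‖)) 2 volume := by
    rw [memLp_indicator_iff_restrict hD]
    have : IsFiniteMeasure (volume.restrict D) := ⟨by simpa using hDfin⟩
    exact MemLp.of_bound hc.aestronglyMeasurable 1
      (Filter.Eventually.of_forall fun ξ => (norm_echar _).le)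
  let f : Lp ℂ 2 (volume : Measure (EuclideanSpace ℝ (Fin d))) := 𝓕⁻ (hg.toLp _)
  have hf : (𝓕 f : Lp ℂ 2 (volume : Measure (EuclideanSpace ℝ (Fin d)))) = hg.toLp _ :=
    FourierInvPair.fourier_fourierInv_eq _
  refine ⟨f, by rw [hf]; exact hg.coeFn_toLp, ?_⟩
  rw [← integral_norm_sq_fourier_Lp, hf, integral_congr_ae (g := D.indicator fun _ => (1 : ℝ)),
    integral_indicator_const _ hD, smul_eq_mul, mul_one]
  filter_upwards [hg.coeFn_toLp] with ξ hξ
  rw [hξ]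
  by_cases h : ξ ∈ D <;> simp [h, norm_echar]

/-- Without cancellation in the phase, the wave is comparable to the measure of its frequency
support. -/
theorem le_norm_wave_of_phase {d : ℕ} {D : Set (EuclideanSpace ℝ (Fin d))}
    (hφ : Continuous φ) (hs : Function.support φ ⊆ Set.Ioo (1 / 4) 4)
    (hD : MeasurableSet D) (hDfin : volume D < ∞) {t₀ t : ℝ} {j : ℕ}
    {f : Lp ℂ 2 (volume : Measure (EuclideanSpace ℝ (Fin d)))}
    (hf : ((𝓕 f : Lp ℂ 2 (volume : Measure (EuclideanSpace ℝ (Fin d)))) : _ → ℂ) =ᵐ[volume]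
        D.indicator (fun ξ => echar (t₀ * ‖ξ‖))) {x : EuclideanSpace ℝ (Fin d)} {σ c : ℝ}
    (hc : 0 ≤ c) (hphase : ∀ ξ ∈ D, |inner ℝ ξ x - (t - t₀) * ‖ξ‖| ≤ 1 / 8)
    (hσ : ∀ ξ ∈ D, c ≤ σ * cutoff φ (scale j) ‖ξ‖) :
    c / 2 * volume.real D ≤ |σ| * ‖wave φ j t f x‖ := by
  have hint : Integrable fun ξ => echar (inner ℝ ξ x) * waveFreq φ j t f ξ := by
    refine (integrable_waveFreq f hφ hs j t).bdd_mul (c := 1) ?_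
      (Filter.Eventually.of_forall fun ξ => (norm_echar _).le)
    have : Continuous fun ξ : EuclideanSpace ℝ (Fin d) => echar (inner ℝ ξ x) := by
      unfold echar; fun_prop
    exact this.aestronglyMeasurable
  have hre : ∀ᵐ ξ, D.indicator (fun _ => c / 2) ξ ≤
      (((σ : ℝ) : ℂ) * (echar (inner ℝ ξ x) * waveFreq φ j t f ξ)).re := by
    filter_upwards [hf] with ξ hξ
    rw [waveFreq, hξ, waveSymbol_eq]
    by_cases h : ξ ∈ D
    · rw [Set.indicator_of_mem h, Set.indicator_of_mem h]
      have e : ((σ : ℝ) : ℂ) * (echar (inner ℝ ξ x) * (echar (-(t * ‖ξ‖)) *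
          (cutoff φ (scale j) ‖ξ‖ : ℂ) * echar (t₀ * ‖ξ‖))) =
          ((σ * cutoff φ (scale j) ‖ξ‖ : ℝ) : ℂ) *
            echar (inner ℝ ξ x - (t - t₀) * ‖ξ‖) := by
        have e1 : inner ℝ ξ x - (t - t₀) * ‖ξ‖ = inner ℝ ξ x + (-(t * ‖ξ‖) + t₀ * ‖ξ‖) := by ring
        rw [e1, echar_add, echar_add]
        push_cast
        ring
      rw [e, Complex.re_ofReal_mul]
      -- The tolerance `1/8` makes the angle `2πy` at most 1 in size, where the cosine is at least
      -- `1/2`.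
      have hcos : (1 / 2 : ℝ) ≤ (echar (inner ℝ ξ x - (t - t₀) * ‖ξ‖)).re := by
        set y := inner ℝ ξ x - (t - t₀) * ‖ξ‖ with hy
        have e2 : (echar y).re = Real.cos (2 * Real.pi * y) := by
          rw [echar, ← Complex.exp_ofReal_mul_I_re]
          congr 2
          push_cast
          ring
        rw [e2]
        refine le_trans ?_ Real.one_sub_sq_div_two_le_cos
        have hy1 := hphase ξ h
        have : |2 * Real.pi * y| ≤ 1 := by
          rw [abs_mul, abs_of_pos Real.two_pi_pos]
          have := Real.pi_le_four
          nlinarith [abs_nonneg y]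
        have := sq_le_one_iff_abs_le_one _ |>.2 this
        linarith
      have := hσ ξ h
      calc c / 2 = c * (1 / 2) := by ring
        _ ≤ _ := mul_le_mul this hcos (by norm_num) (hc.trans this)
    · simp [Set.indicator_of_notMem h]
  have hI : Integrable fun ξ => (((σ : ℝ) : ℂ) * (echar (inner ℝ ξ x) * waveFreq φ j t f ξ)).re :=
    (hint.const_mul _).re
  calc c / 2 * volume.real D = ∫ ξ, D.indicator (fun _ => c / 2) ξ := by
        rw [integral_indicator_const _ hD, smul_eq_mul, mul_comm]
    _ ≤ ∫ ξ, (((σ : ℝ) : ℂ) * (echar (inner ℝ ξ x) * waveFreq φ j t f ξ)).re :=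
        integral_mono_ae ((integrable_indicator_iff hD).2 (integrableOn_const hDfin.ne)) hI hre
    _ = (((σ : ℝ) : ℂ) * ∫ ξ, echar (inner ℝ ξ x) * waveFreq φ j t f ξ).re := by
        rw [← integral_const_mul]
        exact integral_re (hint.const_mul _)
    _ ≤ ‖((σ : ℝ) : ℂ) * ∫ ξ, echar (inner ℝ ξ x) * waveFreq φ j t f ξ‖ := Complex.re_le_norm _
    _ = _ := by
        rw [norm_mul, Complex.norm_real, Real.norm_eq_abs, wave_eq, fourierInv_eq_integral_echar]

/-- The frequency box of the Knapp example. -/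
abbrev knappFreq (n : ℕ) (A κ R θ : ℝ) : Set (EuclideanSpace ℝ (Fin (n + 1))) :=
  eBox (Fin.cons (R * A) fun _ => -(κ * R * θ)) (Fin.cons (R * (A + κ)) fun _ => κ * R * θ)

/-- The spatial box of the Knapp example, centred at `τ e₀`. -/
abbrev knappBox (n : ℕ) (κ R θ τ : ℝ) : Set (EuclideanSpace ℝ (Fin (n + 1))) :=
  eBox (Fin.cons (τ - κ / R) fun _ => -(κ / (R * θ))) (Fin.cons (τ + κ / R) fun _ => κ / (R * θ))

/-- The product of `‖ξ‖ - ξ 0` and `‖ξ‖ + ξ 0` is the sum of the squared transverse coordinates, and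
the second factor is at least `2RA`. The cone deviates from its tangent by `O(Rθ²)`. -/
theorem norm_sub_coord_of_mem_knappFreq {A κ R θ : ℝ} (hA : 0 < A) (hR : 0 < R)
    {ξ : EuclideanSpace ℝ (Fin (n + 1))} (hξ : ξ ∈ knappFreq n A κ R θ) :
    ξ 0 ≤ ‖ξ‖ ∧ ‖ξ‖ - ξ 0 ≤ n * (κ ^ 2 * (R * θ ^ 2)) / (2 * A) := by
  have h0 := hξ 0
  simp only [Fin.cons_zero] at h0
  have hi : ∀ i : Fin n, ξ i.succ ^ 2 ≤ (κ * R * θ) ^ 2 := fun i => by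
    have := hξ i.succ
    simp only [Fin.cons_succ] at this
    exact sq_le_sq' this.1 this.2
  have hRA : 0 < R * A := by positivity
  have hnorm := EuclideanSpace.real_norm_sq_eq ξ
  rw [Fin.sum_univ_succ] at hnorm
  have hsum0 : 0 ≤ ∑ i : Fin n, ξ i.succ ^ 2 := Finset.sum_nonneg fun i _ => sq_nonneg _
  have hsum : ∑ i : Fin n, ξ i.succ ^ 2 ≤ n * (κ * R * θ) ^ 2 := by
    have := Finset.sum_le_card_nsmul Finset.univ (fun i : Fin n => ξ i.succ ^ 2) _ fun i _ => hi i
    simpa using this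
  have h1 : ξ 0 ≤ ‖ξ‖ := by
    refine le_of_sq_le_sq ?_ (norm_nonneg ξ)
    linarith
  refine ⟨h1, ?_⟩
  rw [le_div_iff₀ (by positivity)]
  have h2 : (‖ξ‖ - ξ 0) * (2 * (R * A)) ≤ n * (κ * R * θ) ^ 2 := by
    calc (‖ξ‖ - ξ 0) * (2 * (R * A)) ≤ (‖ξ‖ - ξ 0) * (‖ξ‖ + ξ 0) := by
          gcongr
          · linarith
      _ = ∑ i : Fin n, ξ i.succ ^ 2 := by linear_combination hnorm
      _ ≤ _ := hsum
  have h3 : R * ((‖ξ‖ - ξ 0) * (2 * A)) ≤ R * (n * (κ ^ 2 * (R * θ ^ 2))) := by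
    calc _ = (‖ξ‖ - ξ 0) * (2 * (R * A)) := by ring
      _ ≤ _ := h2
      _ = _ := by ring
  exact le_of_mul_le_mul_left h3 hR

/-- The phase splits into a longitudinal part, a transverse part and the curvature term `τ(‖ξ‖ - ξ
0)`. The first two are small since the boxes are dual, the last since `Rθ²L = 1` keeps the packet
coherent for times `O(L)`. -/
theorem abs_phase_le_of_mem_knapp {A κ R θ L τ : ℝ} (hA : 0 < A) (hκ : 0 < κ) (hκ1 : κ ≤ 1)
    (hR : 0 < R) (hθ : 0 < θ) (hθL : R * θ ^ 2 * L = 1) (hτ : |τ| ≤ 3 * L)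
    {ξ x : EuclideanSpace ℝ (Fin (n + 1))}
    (hξ : ξ ∈ knappFreq n A κ R θ) (hx : x ∈ knappBox n κ R θ τ) :
    |inner ℝ ξ x - τ * ‖ξ‖| ≤ κ * (A + 1 + n + 3 * n / (2 * A)) := by
  obtain ⟨h1, h2⟩ := norm_sub_coord_of_mem_knappFreq hA hR hξ
  have hξ0 := hξ 0
  have hx0 := hx 0
  simp only [Fin.cons_zero] at hξ0 hx0
  have hn0 : (0 : ℝ) ≤ n := n.cast_nonneg
  have hinner : inner ℝ ξ x - τ * ‖ξ‖ =
      ξ 0 * (x 0 - τ) + ∑ i : Fin n, ξ i.succ * x i.succ - τ * (‖ξ‖ - ξ 0) := by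
    rw [PiLp.inner_apply, Fin.sum_univ_succ]
    simp only [RCLike.inner_apply, conj_trivial]
    rw [Finset.sum_congr rfl fun i _ => mul_comm (x.ofLp (Fin.succ i)) (ξ.ofLp i.succ)]
    ring
  have t1 : |ξ 0 * (x 0 - τ)| ≤ κ * (A + 1) := by
    have e1 : |ξ 0| ≤ R * (A + 1) := by
      rw [abs_le]
      constructor <;> nlinarith [mul_pos hR hA]
    have e2 : |x 0 - τ| ≤ κ / R := by
      rw [abs_le]
      constructor <;> linarith
    rw [abs_mul]
    calc _ ≤ R * (A + 1) * (κ / R) := by gcongr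
      _ = _ := by field_simp
  have t2 : |∑ i : Fin n, ξ i.succ * x i.succ| ≤ n * κ := by
    refine (Finset.abs_sum_le_sum_abs _ _).trans ?_
    have e : ∀ i ∈ (Finset.univ : Finset (Fin n)), |ξ i.succ * x i.succ| ≤ κ := by
      intro i _
      have a1 := hξ i.succ
      have a2 := hx i.succ
      simp only [Fin.cons_succ] at a1 a2
      rw [abs_mul]
      calc _ ≤ (κ * R * θ) * (κ / (R * θ)) := by
            gcongr
            · exact abs_le.2 a1
            · exact abs_le.2 a2
        _ = κ * κ := by field_simp
        _ ≤ κ := by nlinarith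
    have := Finset.sum_le_card_nsmul _ _ _ e
    simpa using this
  have t3 : |τ * (‖ξ‖ - ξ 0)| ≤ κ * (3 * n / (2 * A)) := by
    rw [abs_mul, abs_of_nonneg (sub_nonneg.2 h1)]
    have hL : 0 ≤ L := by linarith [abs_nonneg τ]
    calc _ ≤ 3 * L * (n * (κ ^ 2 * (R * θ ^ 2)) / (2 * A)) := by
          gcongr
      _ = (R * θ ^ 2 * L) * (κ ^ 2 * (3 * n / (2 * A))) := by ring
      _ = κ ^ 2 * (3 * n / (2 * A)) := by rw [hθL, one_mul]
      _ ≤ _ := by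
          gcongr
          nlinarith
  rw [hinner]
  calc _ ≤ |ξ 0 * (x 0 - τ) + ∑ i : Fin n, ξ i.succ * x i.succ| + |τ * (‖ξ‖ - ξ 0)| := abs_sub _ _
    _ ≤ |ξ 0 * (x 0 - τ)| + |∑ i : Fin n, ξ i.succ * x i.succ| + |τ * (‖ξ‖ - ξ 0)| := by
        gcongr
        exact abs_add_le _ _
    _ ≤ κ * (A + 1) + n * κ + κ * (3 * n / (2 * A)) := by gcongr
    _ = _ := by ring

/-- The parameters of the Knapp example: a frequency shell on which `φ` keeps its sign. -/
theorem exists_knapp_parameters (n : ℕ) (hφ : Continuous φ)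
    (hs : Function.support φ ⊆ Set.Ioo (1 / 4) 4) (hne : φ ≠ 0) :
    ∃ A κ σ c : ℝ, 0 < A ∧ 0 < κ ∧ κ ≤ 1 ∧ 0 < c ∧ σ ≠ 0 ∧
      κ * (A + 1 + n + 3 * n / (2 * A)) ≤ 1 / 8 ∧
      ∀ R θ : ℝ, 0 < R → 0 < θ → θ ≤ 1 → ∀ ξ ∈ knappFreq n A κ R θ,
        c ≤ σ * cutoff φ R⁻¹ ‖ξ‖ := by
  obtain ⟨ρ, hρ⟩ : ∃ ρ, φ ρ ≠ 0 := by
    by_contra h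
    push Not at h
    exact hne (funext h)
  have hρpos : 0 < ρ := by
    have := (hs hρ).1
    linarith
  have hsq : 0 < φ ρ * φ ρ := mul_self_pos.2 hρ
  obtain ⟨η, hη, hηb⟩ : ∃ η > 0, ∀ u, |u - ρ| ≤ η → φ ρ * φ ρ / 2 ≤ φ ρ * φ u := by
    have hcont : Continuous fun u => φ ρ * φ u := continuous_const.mul hφ
    have hev : ∀ᶠ u in 𝓝 ρ, φ ρ * φ ρ / 2 < φ ρ * φ u :=
      hcont.continuousAt.eventually (lt_mem_nhds (by linarith))
    obtain ⟨η, hη, h⟩ := Metric.eventually_nhds_iff.1 hev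
    refine ⟨η / 2, by positivity, fun u hu => (h ?_).le⟩
    rw [Real.dist_eq]
    linarith
  have hπ := Real.pi_pos
  set A := ρ / (2 * Real.pi) with hA
  have hA0 : 0 < A := by positivity
  set K₁ := A + 1 + n + 3 * n / (2 * A) with hK₁
  set K₂ := 2 * Real.pi * (1 + n / (2 * A)) with hK₂
  have hK₁0 : 0 < K₁ := by positivity
  have hK₂0 : 0 < K₂ := by positivity
  -- The second entry keeps the phase below `1/8`. The third keeps the rescaled frequencies within
  -- `η` of `ρ`, where multiplication by `σ = φ ρ` makes the symbol positive.
  set κ := min 1 (min (1 / (8 * K₁)) (η / K₂)) with hκ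
  have hκ0 : 0 < κ := by positivity
  have hκ1 : κ ≤ 1 := min_le_left _ _
  have hκ2 : κ * K₁ ≤ 1 / 8 := by
    have : κ ≤ 1 / (8 * K₁) := (min_le_right _ _).trans (min_le_left _ _)
    calc κ * K₁ ≤ 1 / (8 * K₁) * K₁ := by gcongr
      _ = 1 / 8 := by field_simp
  have hκ3 : κ * K₂ ≤ η := by
    have : κ ≤ η / K₂ := (min_le_right _ _).trans (min_le_right _ _)
    exact (le_div_iff₀ hK₂0).1 this
  refine ⟨A, κ, φ ρ, φ ρ * φ ρ / 2, hA0, hκ0, hκ1, by positivity, hρ, hκ2,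
    fun R θ hR hθ hθ1 ξ hξ => hηb _ ?_⟩
  obtain ⟨h1, h2⟩ := norm_sub_coord_of_mem_knappFreq hA0 hR hξ
  have hξ0 := hξ 0
  simp only [Fin.cons_zero] at hξ0
  have e0 : R⁻¹ * (2 * Real.pi * (R * A)) = ρ := by rw [hA]; field_simp
  have hlow : ρ ≤ R⁻¹ * (2 * Real.pi * ‖ξ‖) := by
    rw [← e0]
    gcongr
    exact hξ0.1.trans h1
  have hup : R⁻¹ * (2 * Real.pi * ‖ξ‖) ≤ ρ + η := by
    have hn0 : (0 : ℝ) ≤ n := n.cast_nonneg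
    have hθ2 : θ ^ 2 ≤ 1 := pow_le_one₀ hθ.le hθ1
    have hκκ : κ ^ 2 ≤ κ := by nlinarith
    have h3 : ‖ξ‖ ≤ R * (A + κ) + n * (κ * (R * 1)) / (2 * A) := by
      have h4 : n * (κ ^ 2 * (R * θ ^ 2)) / (2 * A) ≤ n * (κ * (R * 1)) / (2 * A) := by gcongr
      linarith [hξ0.2]
    calc _ ≤ R⁻¹ * (2 * Real.pi * (R * (A + κ) + n * (κ * (R * 1)) / (2 * A))) := by gcongr
      _ = R⁻¹ * (2 * Real.pi * (R * A)) + κ * K₂ := by rw [hK₂]; field_simp; ring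
      _ ≤ _ := by rw [e0]; linarith
  rw [abs_le]
  constructor <;> linarith

end Knapp

/-! ### Necessity of the exponent. -/

section Necessity

variable {φ : ℝ → ℝ} {E : Set ℝ} {n : ℕ}

/-- Since `r ≤ q`, the `ℓ^r` norm dominates the `ℓ^q` norm, whose `L^q` norm decouples into a sum
over times. This makes the lower bound independent of `r`. -/
theorem sum_lintegral_le_waveNorm_rpow {d : ℕ} (hφ : Continuous φ)
    (hs : Function.support φ ⊆ Set.Ioo (1 / 4) 4) {q r : ℝ} (hr : 0 < r) (hrq : r ≤ q) (j : ℕ)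
    (F : Finset ℝ) (f : Lp ℂ 2 (volume : Measure (EuclideanSpace ℝ (Fin d)))) :
    ∑ t ∈ F, ∫⁻ x, ENNReal.ofReal (‖wave φ j t f x‖ ^ q) ≤ waveNorm φ q r j F f ^ q := by
  have hq : 0 < q := hr.trans_le hrq
  have hmono : eLpNorm (fun x => (∑ t ∈ F, ‖wave φ j t f x‖ ^ q) ^ (1 / q)) (ENNReal.ofReal q)
      volume ≤ waveNorm φ q r j F f := by
    refine eLpNorm_mono_real fun x => ?_
    rw [Real.norm_of_nonneg (by positivity)]
    exact rpow_sum_le_rpow_sum F (fun t _ => norm_nonneg _) hr hrq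
  refine le_trans (le_of_eq ?_) (ENNReal.rpow_le_rpow hmono hq.le)
  rw [eLpNorm_eq_lintegral_rpow_enorm_toReal (by simpa using hq) ENNReal.ofReal_ne_top,
    ENNReal.toReal_ofReal hq.le, ← ENNReal.rpow_mul, one_div_mul_cancel hq.ne', ENNReal.rpow_one,
    ← lintegral_finsetSum]
  · refine lintegral_congr fun x => ?_
    have h0 : 0 ≤ ∑ t ∈ F, ‖wave φ j t f x‖ ^ q := by positivity
    rw [Real.enorm_of_nonneg (by positivity), ENNReal.ofReal_rpow_of_nonneg (by positivity) hq.le,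
      ← Real.rpow_mul h0, one_div_mul_cancel hq.ne', Real.rpow_one,
      ENNReal.ofReal_sum_of_nonneg fun t _ => by positivity]
  · intro t _
    exact ((continuous_wave f hφ hs j t).norm.rpow_const
      fun x => Or.inr hq.le).measurable.ennreal_ofReal

/-- Testing the estimate on the Knapp example. -/
theorem card_mul_le_of_waveNorm_le (hφ : Continuous φ)
    (hs : Function.support φ ⊆ Set.Ioo (1 / 4) 4) {q r : ℝ} (hr : 0 < r) (hrq : r ≤ q)
    {A κ σ c : ℝ} (hA : 0 < A) (hκ : 0 < κ) (hκ1 : κ ≤ 1) (hc : 0 < c) (hσ0 : σ ≠ 0)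
    (hκA : κ * (A + 1 + n + 3 * n / (2 * A)) ≤ 1 / 8)
    (hσ : ∀ R θ : ℝ, 0 < R → 0 < θ → θ ≤ 1 → ∀ ξ ∈ knappFreq n A κ R θ,
        c ≤ σ * cutoff φ R⁻¹ ‖ξ‖) {j : ℕ} {F T : Finset ℝ} (hT : T ⊆ F) {t₀ L θ B : ℝ}
    (hθ : 0 < θ) (hθ1 : θ ≤ 1) (hθL : (scale j)⁻¹ * θ ^ 2 * L = 1)
    (hTL : ∀ t ∈ T, |t - t₀| ≤ 3 * L) (hB : 0 ≤ B)
    (h : ∀ f : Lp ℂ 2 (volume : Measure (EuclideanSpace ℝ (Fin (n + 1)))),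
      waveNorm φ q r j F f ≤ ENNReal.ofReal (B * ‖f‖)) :
    T.card * ((2 * (κ / (scale j)⁻¹)) * (2 * (κ / ((scale j)⁻¹ * θ))) ^ n *
        (c / (2 * |σ|) * volume.real (knappFreq n A κ (scale j)⁻¹ θ)) ^ q) ≤
      B ^ q * volume.real (knappFreq n A κ (scale j)⁻¹ θ) ^ (q / 2) := by
  have hq : 0 < q := hr.trans_le hrq
  have hδ := scale_pos j
  set R := (scale j)⁻¹ with hR
  have hR0 : 0 < R := inv_pos.2 hδ
  set D := knappFreq n A κ R θ with hD
  have hDm : MeasurableSet D := measurableSet_eBox _ _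
  have hDfin : volume D < ∞ := volume_eBox_lt_top _ _
  obtain ⟨f, hf, hfn⟩ := exists_fourier_eq_indicator hDm hDfin t₀
  have hσpos : 0 < |σ| := abs_pos.2 hσ0
  set v := volume.real D with hv
  have hv0 : 0 ≤ v := measureReal_nonneg
  have hlow : ∀ t ∈ T, ∀ x ∈ knappBox n κ R θ (t - t₀), c / (2 * |σ|) * v ≤ ‖wave φ j t f x‖ := by
    intro t ht x hx
    have := le_norm_wave_of_phase (j := j) (t := t) (x := x) (σ := σ) hφ hs hDm hDfin hf hc.le
      (fun ξ hξ => (abs_phase_le_of_mem_knapp hA hκ hκ1 hR0 hθ hθL (hTL t ht) hξ hx).trans hκA)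
      (fun ξ hξ => by
        have := hσ R θ hR0 hθ hθ1 ξ hξ
        rwa [hR, inv_inv] at this)
    calc c / (2 * |σ|) * v = (c / 2 * v) / |σ| := by field_simp
      _ ≤ _ := by rw [div_le_iff₀' hσpos]; exact this
  set P := (2 * (κ / R)) * (2 * (κ / (R * θ))) ^ n with hP
  have hP0 : 0 ≤ P := by positivity
  have hPv : ∀ τ, volume (knappBox n κ R θ τ) = ENNReal.ofReal P := by
    intro τ
    have hκR : 0 < κ / R := by positivity
    rw [← ENNReal.ofReal_toReal (volume_eBox_lt_top _ _).ne, ← measureReal_def,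
      volume_real_eBox_cons (by linarith) (by positivity), hP]
    congr 2
    ring
  have hcv : 0 ≤ c / (2 * |σ|) * v := by positivity
  have hterm : ∀ t ∈ T, ENNReal.ofReal (P * (c / (2 * |σ|) * v) ^ q) ≤
      ∫⁻ x, ENNReal.ofReal (‖wave φ j t f x‖ ^ q) := by
    intro t ht
    calc ENNReal.ofReal (P * (c / (2 * |σ|) * v) ^ q)
        = ∫⁻ x in knappBox n κ R θ (t - t₀), ENNReal.ofReal ((c / (2 * |σ|) * v) ^ q) := by
          rw [setLIntegral_const, hPv, ENNReal.ofReal_mul hP0, mul_comm]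
      _ ≤ ∫⁻ x in knappBox n κ R θ (t - t₀), ENNReal.ofReal (‖wave φ j t f x‖ ^ q) := by
          refine setLIntegral_mono' (measurableSet_eBox _ _) fun x hx => ?_
          exact ENNReal.ofReal_le_ofReal (Real.rpow_le_rpow hcv (hlow t ht x hx) hq.le)
      _ ≤ _ := setLIntegral_le_lintegral _ _
  have hBf : 0 ≤ B * ‖f‖ := by positivity
  have hall : ENNReal.ofReal (T.card * (P * (c / (2 * |σ|) * v) ^ q)) ≤
      ENNReal.ofReal ((B * ‖f‖) ^ q) := by
    calc _ = T.card • ENNReal.ofReal (P * (c / (2 * |σ|) * v) ^ q) := by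
          rw [ENNReal.ofReal_mul (by positivity), ENNReal.ofReal_natCast, nsmul_eq_mul]
      _ ≤ ∑ t ∈ T, ∫⁻ x, ENNReal.ofReal (‖wave φ j t f x‖ ^ q) :=
          Finset.card_nsmul_le_sum _ _ _ hterm
      _ ≤ ∑ t ∈ F, ∫⁻ x, ENNReal.ofReal (‖wave φ j t f x‖ ^ q) := Finset.sum_le_sum_of_subset hT
      _ ≤ waveNorm φ q r j F f ^ q := sum_lintegral_le_waveNorm_rpow hφ hs hr hrq j F f
      _ ≤ ENNReal.ofReal (B * ‖f‖) ^ q := ENNReal.rpow_le_rpow (h f) hq.le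
      _ = _ := ENNReal.ofReal_rpow_of_nonneg hBf hq.le
  have hreal := (ENNReal.ofReal_le_ofReal_iff (by positivity)).1 hall
  refine hreal.trans (le_of_eq ?_)
  rw [Real.mul_rpow hB (norm_nonneg f), ← hfn, ← Real.rpow_natCast, ← Real.rpow_mul (norm_nonneg f)]
  congr 2
  push_cast
  ring

/-- The necessity of `s ≥ s_E(q)`. -/
theorem critExp_le_of_waveNorm_le (hφ : Continuous φ)
    (hs : Function.support φ ⊆ Set.Ioo (1 / 4) 4) (hφne : φ ≠ 0) (hE : E ⊆ Set.Icc 1 2)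
    (hne : E.Nonempty) {q r s C : ℝ} (hr : 2 ≤ r) (hrq : r ≤ q) {F : ℕ → Finset ℝ}
    (hF : ∀ j : ℕ, 1 ≤ j → IsDiscretization E (scale j) (F j)) (hC : 0 < C)
    (h : ∀ j : ℕ, 1 ≤ j → ∀ f : Lp ℂ 2 (volume : Measure (EuclideanSpace ℝ (Fin (n + 1)))),
      waveNorm φ q r j (F j) f ≤ ENNReal.ofReal (C * 2 ^ ((j : ℝ) * s) * ‖f‖)) :
    critExp (n + 1) E q ≤ s := by
  have hr0 : 0 < r := by linarith
  have hq : 0 < q := by linarith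
  have hα : 0 ≤ (n : ℝ) / 2 * (q / 2 - 1) := mul_nonneg (by positivity) (by linarith)
  obtain ⟨A, κ, σ, c, hA, hκ, hκ1, hc, hσ0, hκA, hσ⟩ := exists_knapp_parameters n hφ hs hφne
  have hσpos : 0 < |σ| := abs_pos.2 hσ0
  set k := κ * (2 * κ) ^ n with hk
  have hk0 : 0 < k := by positivity
  set c' := c / (2 * |σ|) with hc'
  have hc'0 : 0 < c' := by positivity
  set K := 2 * k * c' ^ q * k ^ (q / 2) with hK
  have hK0 : 0 < K := by positivity
  have key : legendreAssouad E ((n : ℝ) / 2 * (q / 2 - 1)) ≤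
      s * q - ((n : ℝ) / 2 + 1) * (q / 2 - 1) := by
    refine legendreAssouad_le_of_forall_scale hE hne hα (C := 2 * (C ^ q / K)) (by positivity)
      fun j hj => assouadSup_le_of_forall (scale_le_one j) fun a b h1 h2 => ?_
    have hδ := scale_pos j
    set δ := scale j with hδdef
    set L := b - a with hL
    have hL0 : 0 < L := hδ.trans_le h1
    set T := ({t ∈ F j | t ∈ Set.Icc (a - δ) (b + δ)} : Finset ℝ) with hT
    have hcov := coverNum_le_card_discretization hδ (hF j hj) a b
    rw [← hT] at hcov
    -- The largest angular width for which the packet stays coherent over the whole interval. It is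
    -- at most 1 because `L ≥ δ`.
    set θ := √(δ / L) with hθ
    have hθ0 : 0 < θ := Real.sqrt_pos.2 (by positivity)
    have hθ1 : θ ≤ 1 := Real.sqrt_le_one.2 ((div_le_one hL0).2 h1)
    have hθsq : θ ^ 2 = δ / L := Real.sq_sqrt (by positivity)
    have hcard := card_mul_le_of_waveNorm_le (n := n) hφ hs hr0 hrq hA hκ hκ1 hc hσ0 hκA hσ
      (j := j) (F := F j) (T := T) (Finset.filter_subset _ _) (t₀ := a) (L := L) hθ0 hθ1
      (by rw [hθsq, ← hδdef]; field_simp) (fun t ht => by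
        have := (Finset.mem_filter.1 ht).2
        rw [abs_le]
        constructor <;> linarith [this.1, this.2]) (B := C * 2 ^ ((j : ℝ) * s)) (by positivity)
      (h j hj)
    have hR0 : 0 < δ⁻¹ := inv_pos.2 hδ
    -- Up to constants `X` is the volume of the frequency box and `X⁻¹` that of the dual spatial
    -- box. Comparing both sides leaves `X^{q/2-1}` times the number of times.
    set X := δ⁻¹ ^ (n + 1) * θ ^ n with hX
    have hX0 : 0 < X := by positivity
    have hvol : volume.real (knappFreq n A κ δ⁻¹ θ) = k * X := by
      rw [volume_real_eBox_cons (by nlinarith) (by positivity), hk, hX]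
      ring
    have hP : 2 * (κ / δ⁻¹) * (2 * (κ / (δ⁻¹ * θ))) ^ n = 2 * k / X := by
      rw [hk, hX, mul_pow, mul_pow, div_pow, mul_pow, pow_succ']
      field_simp
    rw [← hδdef, hvol, hP] at hcard
    have hkX : 0 < k * X := by positivity
    have hsplit : (c' * (k * X)) ^ q = c' ^ q * ((k * X) ^ (q / 2) * (k * X) ^ (q / 2)) := by
      rw [Real.mul_rpow hc'0.le hkX.le, ← Real.rpow_add hkX]
      congr 2; ring
    have hXp : (k * X) ^ (q / 2) / X = k ^ (q / 2) * X ^ (q / 2 - 1) := by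
      rw [Real.mul_rpow hk0.le hX0.le, Real.rpow_sub_one hX0.ne']
      ring
    have hN : (T.card : ℝ) * (K * X ^ (q / 2 - 1)) ≤ (C * 2 ^ ((j : ℝ) * s)) ^ q := by
      have hpos : 0 < (k * X) ^ (q / 2) := by positivity
      refine le_of_mul_le_mul_right ?_ hpos
      refine le_trans (le_of_eq ?_) hcard
      rw [hsplit, hK]
      calc _ = T.card * (2 * k * c' ^ q * (k ^ (q / 2) * X ^ (q / 2 - 1)) *
            (k * X) ^ (q / 2)) := by ring
        _ = _ := by rw [← hXp]; ring
    have hXe : X = δ ^ (-((n : ℝ) / 2 + 1)) * L ^ (-((n : ℝ) / 2)) := by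
      have e1 : θ ^ n = δ ^ ((n : ℝ) / 2) * L ^ (-((n : ℝ) / 2)) := by
        rw [hθ, Real.sqrt_eq_rpow, ← Real.rpow_natCast, ← Real.rpow_mul (by positivity),
          Real.div_rpow hδ.le hL0.le, Real.rpow_neg hL0.le, div_eq_mul_inv]
        congr 2 <;> ring_nf
      have e2 : δ⁻¹ ^ (n + 1) = δ ^ (-((n + 1 : ℕ) : ℝ)) := by
        rw [Real.rpow_neg hδ.le, Real.rpow_natCast, inv_pow]
      rw [hX, e1, e2, ← mul_assoc, ← Real.rpow_add hδ]
      congr 2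
      push_cast
      ring
    have hXq : X ^ (q / 2 - 1) = δ ^ (-(((n : ℝ) / 2 + 1) * (q / 2 - 1))) *
        L ^ (-((n : ℝ) / 2 * (q / 2 - 1))) := by
      rw [hXe, Real.mul_rpow (by positivity) (by positivity), ← Real.rpow_mul hδ.le,
        ← Real.rpow_mul hL0.le, neg_mul, neg_mul]
    have h2j : ((2 : ℝ) ^ ((j : ℝ) * s)) ^ q = δ ^ (-(s * q)) := by
      rw [hδdef, scale, ← Real.rpow_mul two_pos.le, ← Real.rpow_mul two_pos.le]
      congr 1
      ring
    have hδe : 0 < δ ^ (-(((n : ℝ) / 2 + 1) * (q / 2 - 1))) := Real.rpow_pos_of_pos hδ _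
    have hfin : L ^ (-((n : ℝ) / 2 * (q / 2 - 1))) * T.card ≤
        C ^ q / K * δ ^ (-(s * q - ((n : ℝ) / 2 + 1) * (q / 2 - 1))) := by
      have e3 : δ ^ (-(s * q - ((n : ℝ) / 2 + 1) * (q / 2 - 1))) *
          δ ^ (-(((n : ℝ) / 2 + 1) * (q / 2 - 1))) = δ ^ (-(s * q)) := by
        rw [← Real.rpow_add hδ]; congr 1; ring
      refine le_of_mul_le_mul_right ?_ (mul_pos hK0 hδe)
      calc _ = (T.card : ℝ) * (K * X ^ (q / 2 - 1)) := by rw [hXq]; ring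
        _ ≤ _ := hN
        _ = C ^ q * δ ^ (-(s * q)) := by rw [Real.mul_rpow hC.le (by positivity), h2j]
        _ = _ := by rw [← e3]; field_simp
    calc L ^ (-((n : ℝ) / 2 * (q / 2 - 1))) * (coverNum (E ∩ Set.Icc a b) δ : ℝ)
        ≤ L ^ (-((n : ℝ) / 2 * (q / 2 - 1))) * (2 * T.card) := by
          gcongr
          exact_mod_cast hcov
      _ = 2 * (L ^ (-((n : ℝ) / 2 * (q / 2 - 1))) * T.card) := by ring
      _ ≤ 2 * (C ^ q / K * δ ^ (-(s * q - ((n : ℝ) / 2 + 1) * (q / 2 - 1)))) := by gcongr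
      _ = _ := by ring
  have hcrit := mul_critExp n E hq
  refine le_of_mul_le_mul_left ?_ hq
  linarith

end Necessity

end FractalWave

end

theorem theorem1p5 (d : ℕ) (hd : 1 ≤ d)
    (φ : ℝ → ℝ) (hφ : ContDiff ℝ (⊤ : ℕ∞) φ)
    (hφ_supp : Function.support φ ⊆ Set.Ioo (1 / 4) 4) (hφ_ne : φ ≠ 0)
    (E : Set ℝ) (hE : E ⊆ Set.Icc 1 2) (hE_ne : E.Nonempty)
    (q : ℝ) (hq : 2 ≤ q) :
    (∀ s : ℝ, FractalWave.critExp d E q < s →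
      ∃ C : ℝ, 0 < C ∧ ∀ r : ℝ, 2 ≤ r → r ≤ q → ∀ j : ℕ, 1 ≤ j →
        ∀ F : Finset ℝ, FractalWave.IsDiscretization E ((2 : ℝ) ^ (-(j : ℝ))) F →
          ∀ f : Lp ℂ 2 (volume : Measure (EuclideanSpace ℝ (Fin d))),
            FractalWave.waveNorm φ q r j F f ≤ ENNReal.ofReal (C * 2 ^ ((j : ℝ) * s) * ‖f‖)) ∧
    (∀ s : ℝ, s < FractalWave.critExp d E q → ∀ r : ℝ, 2 ≤ r → r ≤ q →
      ∀ F : ℕ → Finset ℝ,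
        (∀ j : ℕ, 1 ≤ j → FractalWave.IsDiscretization E ((2 : ℝ) ^ (-(j : ℝ))) (F j)) →
        ¬ ∃ C : ℝ, 0 < C ∧ ∀ j : ℕ, 1 ≤ j →
          ∀ f : Lp ℂ 2 (volume : Measure (EuclideanSpace ℝ (Fin d))),
            FractalWave.waveNorm φ q r j (F j) f
              ≤ ENNReal.ofReal (C * 2 ^ ((j : ℝ) * s) * ‖f‖)) := by
  -- With `d = n + 1` the decay rate `(d - 1)/2` becomes `n/2`, free of natural subtraction.
  obtain ⟨n, rfl⟩ := Nat.exists_eq_add_of_le' hd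
  refine ⟨fun s hs => ?_, fun s hs r hr hrq F hF => ?_⟩
  · obtain ⟨C, hC, h⟩ := FractalWave.exists_waveNorm_le (n := n) hφ hφ_supp hE hE_ne hq hs
    exact ⟨C, hC, fun r hr hrq j _ F hF f => h r hr hrq j F hF f⟩
  · rintro ⟨C, hC, h⟩
    exact absurd (FractalWave.critExp_le_of_waveNorm_le (n := n) hφ.continuous hφ_supp hφ_ne hE
      hE_ne hr hrq hF hC h) (not_le.2 hs)
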